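/- **Setting.** Let $f:\mathbb R^d\to\mathbb R$ be convex, twice differentiable and $L_1$-smooth, $L_1>0$ (so $0\preceq\nabla^2 f\preceq L_1 I$), let its Hessian satisfy $\|\nabla^2f(x)-\nabla^2f(y)\|_{\rm op}\le L_2\|x-y\|$ for all $x,y$, and let $x^*$ be a minimizer of $f$. Let $\alpha_1,\alpha_2,\beta\in(0,1)$ with $\alpha_1+\alpha_2<1$, $\sigma_0>0$, $p\in(0,1)$, $x_0,z_0\in\mathbb R^d$, and let $B_0$ be symmetric with $0\preceq B_0\preceq L_1I$. **Oracles.** $\mathsf{LinearSolver}(A,b;\alpha)$ returns, for $A\succeq0$ and $\alpha\in(0,1)$, a vector $s$ with $\|As-b\|\le\alpha\|s\|$. $\mathsf{SEP}(W;\delta,q)$ is a randomized oracle, using fresh independent randomness in every call, which for symmetric $W$, $\delta>0$, $q\in(0,1)$ returns $\gamma>0$ and a symmetric $S$ such that, with probability at least $1-q$: if $\gamma\le1$ then $\|W\|_{\rm op}\le1$; if $\gamma>1$ then $\|W/\gamma\|_{\rm op}\le1$, $\|S\|_F\le3$ and $\langle S,W-\hat B\rangle\ge\gamma-1-\delta$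 for all symmetric $\hat B$ with $\|\hat B\|_{\rm op}\le1$. **Method (A-QNPE).** Start with $A_0=0$, $\eta_0=\sigma_0$, a round counter $t=0$, $W_0=\frac2{L_1}(B_0-\frac{L_1}2I)$ and $\hat B_0=W_0$. In iteration $k=0,1,\dots$, with $B_k=\frac{L_1}2\hat B_t+\frac{L_1}2I$: 1. Set $a_k=\frac12\bigl(\eta_k+\sqrt{\eta_k^2+4\eta_kA_k}\bigr)$ and $y_k=\frac{A_k}{A_k+a_k}x_k+\frac{a_k}{A_k+a_k}z_k$. 2. For $i=0,1,\dots$ try $\hat\eta=\eta_k\beta^i$, $\hat x=y_k+\mathsf{LinearSolver}(I+\hat\eta B_k,-\hat\eta\nabla f(y_k);\alpha_1)$ until $\|\hat x-y_k+\hat\eta\nabla f(\hat x)\|\le(\alpha_1+\alpha_2)\|\hat x-y_k\|$; let $(\hat\eta_k,\hat x_{k+1})$ be the accepted pair and $\tilde x_{k+1}$ the last rejected point, if any. 3. If $\hat\eta_k=\eta_k$: $x_{k+1}=\hat x_{k+1}$, $z_{k+1}=z_k-a_k\nabla f(\hat x_{k+1})$, $A_{k+1}=A_k+a_k$, $\eta_{k+1}=\hat\eta_k/\beta$,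 and the matrices and $t$ do not change. 4. Otherwise, with $\gamma=\hat\eta_k/\eta_k$: $x_{k+1}=\frac{(1-\gamma)A_k}{A_k+\gamma a_k}x_k+\frac{\gamma(A_k+a_k)}{A_k+\gamma a_k}\hat x_{k+1}$, $z_{k+1}=z_k-\gamma a_k\nabla f(\hat x_{k+1})$, $A_{k+1}=A_k+\gamma a_k$, $\eta_{k+1}=\hat\eta_k$. Put $s=\tilde x_{k+1}-y_k$, $w=\nabla f(\tilde x_{k+1})-\nabla f(y_k)$, $\ell_t(B)=\|w-Bs\|^2/\|s\|^2$ and $G_t=\frac2{L_1}\nabla\ell_t(B_k)$ (gradient in the space of symmetric matrices). Let $\tilde G_t=G_t$ if $t=0$ or $\gamma_t\le1$, and $\tilde G_t=G_t+\max\{0,-\langle G_t,\hat B_t\rangle\}S_t$ otherwise. Let $W_{t+1}=\frac{\sqrt d}{\max\{\sqrt d,\|W_t-\rho\tilde G_t\|_F\}}(W_t-\rho\tilde G_t)$, query $(\gamma_{t+1},S_{t+1})=\mathsf{SEP}(W_{t+1};\delta_{t+1},q_{t+1})$, let $\hat B_{t+1}=W_{t+1}$ if $\gamma_{t+1}\le1$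 and $\hat B_{t+1}=W_{t+1}/\gamma_{t+1}$ otherwise, and increase $t$ by one. Here $\rho=\frac1{128}$, $\delta_t=\frac1{\sqrt{t+2}\,\ln(t+2)}$ and $q_t=\frac p{2.5(t+1)\ln^2(t+1)}$. **Theorem.** There are positive constants $C_4,\dots,C_{10}$ depending only on $\alpha_1,\alpha_2,\beta$ such that, with probability at least $1-p$, the following statements hold. (a) For all $k\ge1$, $$f(x_k)-f(x^*)\le\frac{C_4L_1\|z_0-x^*\|^2}{k^2}+\frac{C_5\|z_0-x^*\|^2}{\sigma_0k^{2.5}}.$$ (b) For all $k\ge1$, with $\log^+u=\max\{\log u,0\}$, $$f(x_k)-f(x^*)\le\frac{\|z_0-x^*\|^2}{k^{2.5}}\Bigl(M+C_{10}L_1L_2d\|z_0-x^*\|\log^+\Bigl(\frac{\max\{\frac{L_1}{\alpha_2\beta},\frac1{\sigma_0}\}k^{2.5}}{\sqrt M}\Bigr)\Bigr)^{1/2},$$ where $$M=\frac{C_6}{\sigma_0^2}+C_7L_1^2+C_8\|B_0-\nabla^2f(z_0)\|_F^2+C_9L_2^2\|z_0-x^*\|^2+C_{10}L_1L_2d\|z_0-x^*\|.$$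 (c) Consequently, for all $R\ge\|z_0-x^*\|$ and all $k\ge2$, $$f(x_k)-f(x^*)\le K\min\Bigl\{\frac1{k^2},\frac{\sqrt{d\log k}}{k^{2.5}}\Bigr\},$$ where $K$ depends only on $\alpha_1,\alpha_2,\beta,L_1,L_2,\sigma_0$ and $R$ (not on $d$, $f$, $k$ or $p$). -/

import Mathlib

noncomputable section

namespace AQNPE

open MeasureTheory

/-- Points of `ℝ^d` with the Euclidean norm. -/
abbrev Vec (d : ℕ) := EuclideanSpace ℝ (Fin d)

/-- Real `d × d` matrices. -/
abbrev Mat (d : ℕ) := Matrix (Fin d) (Fin d) ℝ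

/-- The Borel (product) measurable structure on matrices. -/
instance instMeasurableSpaceMat (d : ℕ) : MeasurableSpace (Matrix (Fin d) (Fin d) ℝ) :=
  inferInstanceAs (MeasurableSpace (Fin d → Fin d → ℝ))

instance instBorelSpaceMat (d : ℕ) : BorelSpace (Matrix (Fin d) (Fin d) ℝ) :=
  inferInstanceAs (BorelSpace (Fin d → Fin d → ℝ))

/-- A matrix as a bounded operator of Euclidean space (so `‖op B‖` is the operator norm). -/
abbrev op {d : ℕ} (B : Mat d) : Vec d →L[ℝ] Vec d :=
  Matrix.toEuclideanCLM (n := Fin d) (𝕜 := ℝ) B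

/-- The Frobenius inner product. -/
def frobInner {d : ℕ} (A B : Mat d) : ℝ := ∑ i, ∑ j, A i j * B i j

/-- The Frobenius norm. -/
def frobNorm {d : ℕ} (A : Mat d) : ℝ := √(frobInner A A)

/-! ### The objective function -/

/-- The Hessian of `f` at `x`, as an operator: the derivative of the gradient. -/
def hess {d : ℕ} (f : Vec d → ℝ) (x : Vec d) : Vec d →L[ℝ] Vec d :=
  fderiv ℝ (gradient f) x

/-- The Hessian of `f` at `x`, as a matrix. -/
def hessMat {d : ℕ} (f : Vec d → ℝ) (x : Vec d) : Mat d :=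
  (Matrix.toEuclideanCLM (n := Fin d) (𝕜 := ℝ)).symm (hess f x)

/-- `f` is twice differentiable, convex and `L₁`-smooth. -/
structure IsSmoothConvex {d : ℕ} (f : Vec d → ℝ) (L₁ : ℝ) : Prop where
  differentiable : Differentiable ℝ f
  differentiable_gradient : Differentiable ℝ (gradient f)
  convex : ConvexOn ℝ Set.univ f
  smooth : ∀ x y, ‖gradient f x - gradient f y‖ ≤ L₁ * ‖x - y‖

/-- The Hessian of `f` is `L₂`-Lipschitz with respect to the operator norm. -/
def HasLipschitzHessian {d : ℕ} (f : Vec d → ℝ) (L₂ : ℝ) : Prop :=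
  ∀ x y, ‖hess f x - hess f y‖ ≤ L₂ * ‖x - y‖

/-! ### The two oracles -/

/-- `LinearSolver(A, b; α)`: for positive semidefinite `A` and `α ∈ (0,1)` it returns a point `s`
with `‖A s - b‖ ≤ α ‖s‖`. -/
structure IsLinearSolver {d : ℕ} (solver : Mat d → Vec d → ℝ → Vec d) : Prop where
  measurable : ∀ α, Measurable fun i : Mat d × Vec d => solver i.1 i.2 α
  accurate : ∀ (A : Mat d) (b : Vec d) (α : ℝ), A.PosSemidef → 0 < α → α < 1 →
    ‖op A (solver A b α) - b‖ ≤ α * ‖solver A b α‖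

/-- The answer `(γ, S)` to the separation query `(W, δ)` for the unit ball of the operator norm on
symmetric matrices is correct. -/
def SepCorrect {d : ℕ} (W : Mat d) (δ : ℝ) (ans : ℝ × Mat d) : Prop :=
  (ans.1 ≤ 1 → ‖op W‖ ≤ 1) ∧
  (1 < ans.1 →
    ‖op (ans.1⁻¹ • W)‖ ≤ 1 ∧ frobNorm ans.2 ≤ 3 ∧
    ∀ Bh : Mat d, Bh.IsSymm → ‖op Bh‖ ≤ 1 → ans.1 - 1 - δ ≤ frobInner ans.2 (W - Bh))

/-- `SEP(W; δ, q)`, a randomized oracle: `sep W δ q e` is the answer when the internal randomness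
of the call is `e`, which is drawn from `ν`. The answer to a given query is correct with
probability at least `1 - q`. -/
structure IsSepOracle {d : ℕ} {E : Type*} [MeasurableSpace E] (ν : Measure E)
    (sep : Mat d → ℝ → ℝ → E → ℝ × Mat d) : Prop where
  measurable : ∀ δ q, Measurable fun i : Mat d × E => sep i.1 δ q i.2
  pos : ∀ W δ q e, W.IsSymm → 0 < δ → 0 < q → q < 1 → 0 < (sep W δ q e).1
  symm : ∀ W δ q e, W.IsSymm → 0 < δ → 0 < q → q < 1 → (sep W δ q e).2.IsSymm
  correct : ∀ W δ q, W.IsSymm → 0 < δ → 0 < q → q < 1 →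
    1 - ENNReal.ofReal q ≤ ν {e | SepCorrect W δ (sep W δ q e)}

/-! ### The online loss of the Hessian approximation -/

/-- The loss `‖w - B s‖² / ‖s‖²`. -/
def loss {d : ℕ} (s w : Vec d) (B : Mat d) : ℝ := ‖w - op B s‖ ^ 2 / ‖s‖ ^ 2

/-- The gradient of `loss s w` at `B`, in the space of symmetric matrices with the Frobenius
inner product. -/
def lossGrad {d : ℕ} (s w : Vec d) (B : Mat d) : Mat d :=
  (1 / ‖s‖ ^ 2) •
    (-Matrix.vecMulVec (s : Fin d → ℝ) (w - op B s : Vec d)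
      - Matrix.vecMulVec (w - op B s : Vec d) (s : Fin d → ℝ))

/-- `lossGrad` is the gradient: it represents the derivative along every symmetric direction, and
it is itself symmetric. -/
theorem lossGrad_spec {d : ℕ} (s w : Vec d) (B : Mat d) :
    (lossGrad s w B).IsSymm ∧ ∀ D : Mat d, D.IsSymm →
      HasDerivAt (fun r : ℝ => loss s w (B + r • D)) (frobInner (lossGrad s w B) D) 0 := by
  constructor
  · ext i j
    simp only [lossGrad, Matrix.transpose_apply, Matrix.smul_apply, Matrix.sub_apply,
      Matrix.neg_apply, Matrix.vecMulVec_apply, smul_eq_mul]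
    ring
  intro D hD
  have h1 : HasDerivAt (fun r : ℝ => (w - op B s) - r • op D s) (-(op D s)) 0 := by
    have := ((hasDerivAt_id (0 : ℝ)).smul_const (op D s)).const_sub (w - op B s)
    simpa using this
  have h2 := (h1.norm_sq).div_const (‖s‖ ^ 2)
  have e1 : (fun r : ℝ => loss s w (B + r • D))
      = fun r : ℝ => ‖(w - op B s) - r • op D s‖ ^ 2 / ‖s‖ ^ 2 := by
    funext r
    have : w - op (B + r • D) s = (w - op B s) - r • op D s := by
      simp [op, map_add, map_smul, sub_sub]
    simp only [loss, this]
  rw [e1]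
  set v := w - op B s with hv
  have key : inner ℝ v (op D s) = ∑ i, ∑ j, v i * s j * D i j := by
    rw [Matrix.inner_toEuclideanCLM]
    simp only [dotProduct, Matrix.mulVec, Finset.mul_sum]
    refine Finset.sum_congr rfl fun i _ => Finset.sum_congr rfl fun j _ => ?_
    ring
  have key2 : ∑ i, ∑ j, s i * v j * D i j = ∑ i, ∑ j, v i * s j * D i j := by
    rw [Finset.sum_comm]
    refine Finset.sum_congr rfl fun i _ => Finset.sum_congr rfl fun j _ => ?_
    rw [hD.apply i j]
    ring
  have key3 : frobInner (lossGrad s w B) D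
      = 1 / ‖s‖ ^ 2 * (-(∑ i, ∑ j, s i * v j * D i j) - ∑ i, ∑ j, v i * s j * D i j) := by
    simp only [frobInner, lossGrad, ← hv, Matrix.smul_apply, Matrix.sub_apply, Matrix.neg_apply,
      Matrix.vecMulVec_apply, smul_eq_mul, ← Finset.sum_neg_distrib, ← Finset.sum_sub_distrib,
      Finset.mul_sum]
    refine Finset.sum_congr rfl fun i _ => Finset.sum_congr rfl fun j _ => ?_
    ring
  have key4 : frobInner (lossGrad s w B) D
      = 2 * inner ℝ (v - (0 : ℝ) • op D s) (-(op D s)) / ‖s‖ ^ 2 := by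
    rw [key3, key2, ← key, zero_smul, sub_zero, inner_neg_right]
    ring
  rw [key4]
  exact h2

/-! ### The method -/

/-- The parameters of the method: the line search parameters `α₁, α₂, β`, the initial step size
`σ₀`, the smoothness constant `L₁` and the failure probability `p`. -/
structure Params where
  α₁ : ℝ
  α₂ : ℝ
  β : ℝ
  σ₀ : ℝ
  L₁ : ℝ
  p : ℝ

/-- The step size of the online learner. -/
def rho : ℝ := 1 / 128

/-- The accuracy `δ_t` of the separation query of round `t`. -/
def delta (t : ℕ) : ℝ := 1 / (√((t : ℝ) + 2) * Real.log ((t : ℝ) + 2))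

/-- The failure probability `q_t` allowed for the separation query of round `t ≥ 1`. -/
def failProb (p : ℝ) (t : ℕ) : ℝ := p / (2.5 * ((t : ℝ) + 1) * Real.log ((t : ℝ) + 1) ^ 2)

/-- The state at the start of an iteration: the iterates `x, z`, the scalars `A, η`, and the state
of the online learner, i.e. the number `t` of its current round (the number of updates made so
far), its auxiliary matrix `W`, and the answer `(γ, S)` that the separation oracle gave for `W`. -/
structure State (d : ℕ) where
  x : Vec d
  z : Vec d
  A : ℝ
  η : ℝ
  t : ℕ
  W : Mat d
  γ : ℝ
  S : Mat d

namespace State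

/-- Start: `A₀ = 0`, `η₀ = σ₀`, `W₀ = (2/L₁)(B₀ - (L₁/2) I)`. Round `0` makes no separation query,
and `W₀` is used as it is, as if the answer had been `γ = 1`. -/
def init {d : ℕ} (P : Params) (x₀ z₀ : Vec d) (B₀ : Mat d) : State d where
  x := x₀
  z := z₀
  A := 0
  η := P.σ₀
  t := 0
  W := (2 / P.L₁) • (B₀ - (P.L₁ / 2) • (1 : Mat d))
  γ := 1
  S := 0

section

variable {d : ℕ} (P : Params) (f : Vec d → ℝ) (solver : Mat d → Vec d → ℝ → Vec d) (s : State d)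

/-- `B̂`: the matrix `W`, rescaled if the oracle reported `γ > 1`. -/
def Bhat : Mat d := if s.γ ≤ 1 then s.W else s.γ⁻¹ • s.W

/-- The Hessian approximation `B = (L₁/2) B̂ + (L₁/2) I`. -/
def B : Mat d := (P.L₁ / 2) • s.Bhat + (P.L₁ / 2) • (1 : Mat d)

/-- `a = (η + √(η² + 4 η A)) / 2`. -/
def a : ℝ := (s.η + √(s.η ^ 2 + 4 * s.η * s.A)) / 2

/-- `y = A/(A+a) x + a/(A+a) z`. -/
def y : Vec d := (s.A / (s.A + s.a)) • s.x + (s.a / (s.A + s.a)) • s.z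

/-- The `i`-th trial step size `η β^i` of the line search. -/
def trialStep (i : ℕ) : ℝ := s.η * P.β ^ i

/-- The `i`-th trial point of the line search. -/
def trialPoint (i : ℕ) : Vec d :=
  s.y + solver (1 + s.trialStep P i • s.B P) (-(s.trialStep P i • gradient f s.y)) P.α₁

/-- The line search test at the `i`-th trial. -/
def Accepts (i : ℕ) : Prop :=
  ‖s.trialPoint P f solver i - s.y
      + s.trialStep P i • gradient f (s.trialPoint P f solver i)‖
    ≤ (P.α₁ + P.α₂) * ‖s.trialPoint P f solver i - s.y‖

/-- The number of backtracking steps: the first trial that is accepted. -/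
def numBacktracks : ℕ := sInf {i | s.Accepts P f solver i}

/-- The accepted step size `η̂`. -/
def etaHat : ℝ := s.trialStep P (s.numBacktracks P f solver)

/-- The accepted point `x̂`. -/
def xHat : Vec d := s.trialPoint P f solver (s.numBacktracks P f solver)

/-- The last rejected point `x̃` (used only if there was a rejection). -/
def xTilde : Vec d := s.trialPoint P f solver (s.numBacktracks P f solver - 1)

/-- `G = (2/L₁) ∇ℓ(B)` for the loss with `s = x̃ - y` and `w = ∇f(x̃) - ∇f(y)`. -/
def G : Mat d :=
  (2 / P.L₁) • lossGrad (s.xTilde P f solver - s.y)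
    (gradient f (s.xTilde P f solver) - gradient f s.y) (s.B P)

/-- The surrogate gradient `G̃`. -/
def Gtilde : Mat d :=
  if s.γ ≤ 1 then s.G P f solver
  else s.G P f solver + max 0 (-frobInner (s.G P f solver) s.Bhat) • s.S

/-- The next auxiliary matrix: a gradient step, projected to the Frobenius ball of
radius `√d`. -/
def nextW : Mat d :=
  (√(d : ℝ) / max (√(d : ℝ)) (frobNorm (s.W - rho • s.Gtilde P f solver))) •
    (s.W - rho • s.Gtilde P f solver)

/-- `η̂/η`. -/
def ratio : ℝ := s.etaHat P f solver / s.η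

/-- One iteration. If the initial step size is accepted, the Hessian approximation is kept.
Otherwise the momentum is damped, the learner updates `W` and queries the separation oracle, whose
internal randomness for this iteration is `e`. -/
def next {E : Type*} (sep : Mat d → ℝ → ℝ → E → ℝ × Mat d) (e : E) : State d :=
  if s.numBacktracks P f solver = 0 then
    { s with
      x := s.xHat P f solver
      z := s.z - s.a • gradient f (s.xHat P f solver)
      A := s.A + s.a
      η := s.etaHat P f solver / P.β }
  else
    { x := ((1 - s.ratio P f solver) * s.A / (s.A + s.ratio P f solver * s.a)) • s.x
        + (s.ratio P f solver * (s.A + s.a) / (s.A + s.ratio P f solver * s.a)) •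
          s.xHat P f solver
      z := s.z - (s.ratio P f solver * s.a) • gradient f (s.xHat P f solver)
      A := s.A + s.ratio P f solver * s.a
      η := s.etaHat P f solver
      t := s.t + 1
      W := s.nextW P f solver
      γ := (sep (s.nextW P f solver) (delta (s.t + 1)) (failProb P.p (s.t + 1)) e).1
      S := (sep (s.nextW P f solver) (delta (s.t + 1)) (failProb P.p (s.t + 1)) e).2 }

end

end State

/-- The state at the start of iteration `k`, when iteration `j` has the internal oracle
randomness `e j`. -/
def run {d : ℕ} {E : Type*} (P : Params) (f : Vec d → ℝ) (solver : Mat d → Vec d → ℝ → Vec d)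
    (sep : Mat d → ℝ → ℝ → E → ℝ × Mat d) (x₀ z₀ : Vec d) (B₀ : Mat d) (e : ℕ → E) :
    ℕ → State d
  | 0 => State.init P x₀ z₀ B₀
  | k + 1 => (run P f solver sep x₀ z₀ B₀ e k).next P f solver sep (e k)

end AQNPE

end

/-! The randomness is isolated in one event, that every separation query is answered correctly; on
it all rates hold deterministically. Write D = ‖z₀ - x*‖.

Potential. `State.potential_step` shows that A(f(x) - f*) + ‖z - x*‖²/2 drops in each iteration by a
multiple of (a/η)²‖x̂ - y‖². Hence the gap is at most D²/(2A_k), the scaled displacements are square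
summable, and the iterates stay within a multiple of D of x*, apart from x₀, which carries weight A₀
= 0. What remains is a lower bound on A_k.

Growth. √A gains at least √η/2 whenever the initial step is accepted, and backtracking shrinks √η by
at least √β, so √A_N dominates a multiple of Σ √η̂_j (`ValidRun.sqrt_A_ge`). A power mean inequality
turns this into N⁵ ≤ C A_N² Σ η̂_j⁻² (`ValidRun.pow_five_le`). Only backtracking iterations matter
in the last sum, since accepted steps make η grow geometrically; in a backtracking iteration the
failed test bounds η̂⁻² by a multiple of the loss of the current matrix (`State.inv_etaHat_sq_le`).

Rates. Each loss is at most (2L₁)², which gives the k⁻² rate. For the faster rate the losses are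
summed by online learning: the learner is projected gradient descent on a Frobenius ball, with the
surrogate gradient replacing projection onto the operator norm ball (`online_step`). Because ‖∇ℓ‖ ≤
2√ℓ, the quadratic term of the regret is absorbed by half of the loss. The comparator is the Hessian
at y_k, whose own loss is at most L₂²‖x̃ - y‖² and is summable through the potential. Its drift
costs d L₁L₂ times the path length of the y_k, which is at most a multiple of D(1 + log(A_N/A₁))
(`ValidRun.sum_theta_le`, `ValidRun.sum_norm_y_sub_le`). This bound needs A_N from above while the
goal is A_N from below; `ValidRun.quasi_newton_rate` resolves this by noting that a large A_N
already gives the claim.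

Probability. The randomness of a query is independent of the past, so by Fubini its failure
probability is at most q_t times the probability that round t is played in that iteration. For a
fixed round these events are disjoint over the iterations, and the q_t sum to at most p
(`measure_exists_failure_le`). -/

namespace AQNPE

/-! ### Frobenius geometry, the loss and its gradient, and normalization of matrices. -/

section Frobenius

variable {d : ℕ}

/-- A matrix as a vector of the Euclidean space of its entries. -/
def frobVec : Mat d →ₗ[ℝ] EuclideanSpace ℝ (Fin d × Fin d) where
  toFun A := WithLp.toLp 2 fun p => A p.1 p.2
  map_add' _ _ := rfl
  map_smul' _ _ := rfl

theorem frobInner_eq_inner (A B : Mat d) : frobInner A B = inner ℝ (frobVec A) (frobVec B) := by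
  simp only [frobInner, PiLp.inner_apply, Fintype.sum_prod_type]
  exact Finset.sum_congr rfl fun i _ => Finset.sum_congr rfl fun j _ => mul_comm _ _

theorem frobNorm_eq_norm (A : Mat d) : frobNorm A = ‖frobVec A‖ := by
  rw [frobNorm, frobInner_eq_inner, real_inner_self_eq_norm_sq, Real.sqrt_sq (norm_nonneg _)]

theorem frobNorm_nonneg (A : Mat d) : 0 ≤ frobNorm A := Real.sqrt_nonneg _

theorem op_col (A : Mat d) (i j : Fin d) : op A (EuclideanSpace.single j 1) i = A i j := by
  simp [op]

/-- The columns of A are the images of unit vectors, so each has norm at most ‖op A‖. The factor √d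
is a source of the dimension in the final rate. -/
theorem frobNorm_le (A : Mat d) : frobNorm A ≤ √d * ‖op A‖ := by
  rw [frobNorm]
  refine Real.sqrt_le_iff.2 ⟨by positivity, ?_⟩
  rw [mul_pow, Real.sq_sqrt (Nat.cast_nonneg d), frobInner, Finset.sum_comm]
  have h : ∀ j : Fin d, ∑ i, A i j * A i j ≤ ‖op A‖ ^ 2 := by
    intro j
    have h1 := (op A).le_opNorm (EuclideanSpace.single j (1 : ℝ))
    have h2 : ‖op A (EuclideanSpace.single j (1 : ℝ))‖ ^ 2 = ∑ i, A i j * A i j := by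
      rw [EuclideanSpace.norm_sq_eq]
      refine Finset.sum_congr rfl fun i _ => ?_
      rw [op_col, Real.norm_eq_abs, sq_abs, sq]
    rw [← h2]
    simp only [PiLp.norm_single, norm_one, mul_one] at h1
    gcongr
  calc ∑ j, ∑ i, A i j * A i j ≤ ∑ _j : Fin d, ‖op A‖ ^ 2 := Finset.sum_le_sum fun j _ => h j
    _ = d * ‖op A‖ ^ 2 := by simp

theorem op_add (A B : Mat d) : op (A + B) = op A + op B := map_add _ A B
theorem op_sub (A B : Mat d) : op (A - B) = op A - op B := map_sub _ A B
theorem op_smul (c : ℝ) (A : Mat d) : op (c • A) = c • op A := map_smul _ c A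
theorem op_one : op (1 : Mat d) = ContinuousLinearMap.id ℝ (Vec d) := map_one _

theorem inner_op (A : Mat d) (u v : Vec d) :
    inner ℝ u (op A v) = ∑ i, ∑ j, u i * v j * A i j := by
  rw [Matrix.inner_toEuclideanCLM]
  simp only [dotProduct, Matrix.mulVec, Finset.mul_sum]
  refine Finset.sum_congr rfl fun i _ => Finset.sum_congr rfl fun j _ => ?_
  ring

theorem inner_op_comm {A : Mat d} (hA : A.IsSymm) (u v : Vec d) :
    inner ℝ u (op A v) = inner ℝ v (op A u) := by
  rw [inner_op, inner_op, Finset.sum_comm]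
  refine Finset.sum_congr rfl fun i _ => Finset.sum_congr rfl fun j _ => ?_
  rw [hA.apply i j]
  ring

theorem frobInner_vecMulVec (u v : Vec d) (D : Mat d) :
    frobInner (Matrix.vecMulVec (u : Fin d → ℝ) (v : Fin d → ℝ)) D = inner ℝ u (op D v) := by
  rw [inner_op, frobInner]
  rfl

theorem frobNorm_vecMulVec (u v : Vec d) :
    frobNorm (Matrix.vecMulVec (u : Fin d → ℝ) (v : Fin d → ℝ)) = ‖u‖ * ‖v‖ := by
  rw [frobNorm, Real.sqrt_eq_iff_mul_self_eq (by
    rw [frobInner_eq_inner]; exact real_inner_self_nonneg) (by positivity)]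
  have : ‖u‖ * ‖v‖ * (‖u‖ * ‖v‖) = ‖u‖ ^ 2 * ‖v‖ ^ 2 := by ring
  rw [this, EuclideanSpace.norm_sq_eq, EuclideanSpace.norm_sq_eq, Finset.sum_mul_sum, frobInner]
  refine Finset.sum_congr rfl fun i _ => Finset.sum_congr rfl fun j _ => ?_
  simp only [Matrix.vecMulVec_apply, Real.norm_eq_abs, sq_abs]
  ring

theorem frobInner_lossGrad (s w : Vec d) (B : Mat d) {D : Mat d} (hD : D.IsSymm) :
    frobInner (lossGrad s w B) D = -(2 * inner ℝ (w - op B s) (op D s)) / ‖s‖ ^ 2 := by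
  have h1 := frobInner_vecMulVec s (w - op B s) D
  have h2 := frobInner_vecMulVec (w - op B s) s D
  rw [inner_op_comm hD] at h1
  rw [frobInner_eq_inner] at h1 h2 ⊢
  simp only [lossGrad, map_smul, map_sub, map_neg, inner_smul_left, inner_sub_left, inner_neg_left,
    h1, h2]
  simp
  ring

theorem sqrt_loss (s w : Vec d) (B : Mat d) : √(loss s w B) = ‖w - op B s‖ / ‖s‖ := by
  rw [loss, ← div_pow, Real.sqrt_sq (by positivity)]

theorem loss_nonneg (s w : Vec d) (B : Mat d) : 0 ≤ loss s w B := by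
  unfold loss; positivity

/-- The gradient is a symmetrized rank-one matrix, and ‖s vᵀ‖_F = ‖s‖‖v‖. Bounding it by the root of
the loss itself is what later lets the squared gradient in the regret be absorbed by the loss. -/
theorem frobNorm_lossGrad_le (s w : Vec d) (B : Mat d) :
    frobNorm (lossGrad s w B) ≤ 2 * √(loss s w B) := by
  have h1 := frobNorm_vecMulVec s (w - op B s)
  have h2 := frobNorm_vecMulVec (w - op B s) s
  rw [frobNorm_eq_norm] at h1 h2 ⊢
  simp only [lossGrad, map_smul, map_sub, map_neg, norm_smul]
  rw [sqrt_loss]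
  have h3 := norm_sub_le (-frobVec (Matrix.vecMulVec (s : Fin d → ℝ) (w - op B s : Vec d)))
    (frobVec (Matrix.vecMulVec (w - op B s : Vec d) (s : Fin d → ℝ)))
  rw [norm_neg, h1, h2] at h3
  rcases eq_or_ne ‖s‖ 0 with hs | hs
  · simp [hs]
  calc _ ≤ ‖1 / ‖s‖ ^ 2‖ * (‖s‖ * ‖w - op B s‖ + ‖w - op B s‖ * ‖s‖) := by gcongr
    _ = _ := by
      rw [Real.norm_of_nonneg (by positivity)]
      field_simp
      ring

/-- Pairing with a low-rank matrix only tests D on the single vector s, so the operator norm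
suffices; Cauchy–Schwarz in the Frobenius norm would lose a factor √d. -/
theorem abs_frobInner_lossGrad_le (s w : Vec d) (B : Mat d) {D : Mat d} (hD : D.IsSymm)
    (hD1 : ‖op D‖ ≤ 1) : |frobInner (lossGrad s w B) D| ≤ 2 * √(loss s w B) := by
  rw [frobInner_lossGrad s w B hD, sqrt_loss, abs_div, abs_neg, abs_mul, abs_two,
    abs_of_nonneg (sq_nonneg ‖s‖)]
  have h1 := abs_real_inner_le_norm (w - op B s) (op D s)
  have h2 : ‖op D s‖ ≤ ‖s‖ := by
    simpa using (op D).le_of_opNorm_le hD1 s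
  rcases eq_or_ne ‖s‖ 0 with hs | hs
  · simp [hs]
  have hs' : 0 < ‖s‖ := lt_of_le_of_ne (norm_nonneg _) hs.symm
  rw [div_le_iff₀ (by positivity)]
  calc 2 * |inner ℝ (w - op B s) (op D s)| ≤ 2 * (‖w - op B s‖ * ‖s‖) := by
        gcongr
        exact h1.trans (by gcongr)
    _ = _ := by field_simp

/-- The loss is quadratic in B, and the term dropped is ‖(B - H)s‖²/‖s‖². -/
theorem loss_sub_le (s w : Vec d) {B H : Mat d} (hD : (B - H).IsSymm) :
    loss s w B - loss s w H ≤ frobInner (lossGrad s w B) (B - H) := by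
  rw [frobInner_lossGrad s w B hD, loss, loss, ← sub_div]
  gcongr
  have : w - op H s = (w - op B s) + op (B - H) s := by
    rw [op_sub, sub_apply]; abel
  rw [this, norm_add_sq_real]
  nlinarith [sq_nonneg ‖op (B - H) s‖]

theorem isSymm_vecMulVec_add (u v : Fin d → ℝ) (c : ℝ) :
    (c • (-Matrix.vecMulVec u v - Matrix.vecMulVec v u)).IsSymm := by
  ext i j
  simp only [Matrix.transpose_apply, Matrix.smul_apply, Matrix.sub_apply,
      Matrix.neg_apply, Matrix.vecMulVec_apply, smul_eq_mul]
  ring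

theorem lossGrad_isSymm (s w : Vec d) (B : Mat d) : (lossGrad s w B).IsSymm :=
  isSymm_vecMulVec_add _ _ _

theorem posSemidef_iff_inner {A : Mat d} :
    A.PosSemidef ↔ A.IsSymm ∧ ∀ v : Vec d, 0 ≤ inner ℝ v (op A v) := by
  rw [Matrix.posSemidef_iff_dotProduct_mulVec]
  simp only [Matrix.inner_toEuclideanCLM]
  constructor
  · rintro ⟨h1, h2⟩
    refine ⟨by simpa [Matrix.IsHermitian, Matrix.IsSymm] using h1, fun v => ?_⟩
    simpa using h2 (v : Fin d → ℝ)
  · rintro ⟨h1, h2⟩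
    refine ⟨by simpa [Matrix.IsHermitian, Matrix.IsSymm] using h1, fun v => ?_⟩
    simpa using h2 (WithLp.toLp 2 v)

/-- A positive semidefinite symmetric operator bounded by `L` satisfies `‖A v‖² ≤ L ⟪v, A v⟫`. -/
theorem norm_sq_le_of_posSemidef {V : Type*} [NormedAddCommGroup V] [InnerProductSpace ℝ V]
    {T : V →L[ℝ] V} {L : ℝ}
    (hsym : ∀ u v, inner ℝ u (T v) = inner ℝ v (T u)) (hpos : ∀ v, 0 ≤ inner ℝ v (T v))
    (hle : ∀ v, inner ℝ v (T v) ≤ L * ‖v‖ ^ 2) (hL : 0 < L) (v : V) :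
    ‖T v‖ ^ 2 ≤ L * inner ℝ v (T v) := by
  -- Positivity at v - Tv/L plays the role of Cauchy–Schwarz for the form ⟪·, T·⟫ and avoids an
  -- operator square root.
  have h := hpos (v - (1 / L) • T v)
  have h2 := hle (T v)
  have h3 : inner ℝ (T v) (T v) = ‖T v‖ ^ 2 := real_inner_self_eq_norm_sq _
  have h4 : inner ℝ v (T (T v)) = ‖T v‖ ^ 2 := by rw [hsym, h3]
  simp only [map_sub, map_smul, inner_sub_left, inner_sub_right, inner_smul_left,
    inner_smul_right, h3, h4, RCLike.conj_to_real] at h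
  have h5 : 1 / L * (1 / L * inner ℝ (T v) (T (T v))) ≤ 1 / L * (1 / L * (L * ‖T v‖ ^ 2)) := by
    gcongr
  have h6 : 1 / L * (1 / L * (L * ‖T v‖ ^ 2)) = 1 / L * ‖T v‖ ^ 2 := by field_simp
  have h7 : 1 / L * ‖T v‖ ^ 2 ≤ inner ℝ v (T v) := by nlinarith
  rw [one_div, inv_mul_le_iff₀ hL] at h7
  exact h7

/-- Expanding ‖(2/L)Tv - v‖² leaves ‖v‖² plus (4/L²)(‖Tv‖² - L⟪v, Tv⟫), which is at most ‖v‖². It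
places both the initial matrix and every Hessian in the unit ball where the separation oracle
applies. -/
theorem norm_rescaled_le {V : Type*} [NormedAddCommGroup V] [InnerProductSpace ℝ V]
    {T : V →L[ℝ] V} {L : ℝ}
    (hsym : ∀ u v, inner ℝ u (T v) = inner ℝ v (T u)) (hpos : ∀ v, 0 ≤ inner ℝ v (T v))
    (hle : ∀ v, inner ℝ v (T v) ≤ L * ‖v‖ ^ 2) (hL : 0 < L) :
    ‖(2 / L) • T - ContinuousLinearMap.id ℝ V‖ ≤ 1 := by
  refine ContinuousLinearMap.opNorm_le_bound _ zero_le_one fun v => ?_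
  rw [one_mul]
  have h := norm_sq_le_of_posSemidef hsym hpos hle hL v
  refine abs_le_of_sq_le_sq' (b := ‖v‖) ?_ (norm_nonneg _) |>.2
  simp only [sub_apply, smul_apply,
    ContinuousLinearMap.id_apply]
  rw [norm_sub_sq_real, norm_smul, inner_smul_left, real_inner_comm,
    Real.norm_of_nonneg (by positivity), RCLike.conj_to_real, mul_pow]
  have h1 : (2 / L) ^ 2 * ‖T v‖ ^ 2 ≤ (2 / L) ^ 2 * (L * inner ℝ v (T v)) := by gcongr
  have h2 : (2 / L) ^ 2 * (L * inner ℝ v (T v)) = 2 * (2 / L * inner ℝ v (T v)) := by field_simp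
  nlinarith

/-- The normalization `(2/L)(A - (L/2) I)` of the matrix `A`. -/
noncomputable def normalized (L : ℝ) (A : Mat d) : Mat d := (2 / L) • (A - (L / 2) • (1 : Mat d))

theorem op_normalized {L : ℝ} (hL : 0 < L) (A : Mat d) :
    op (normalized L A) = (2 / L) • op A - ContinuousLinearMap.id ℝ (Vec d) := by
  rw [normalized, op_smul, op_sub, op_smul, op_one, smul_sub, smul_smul]
  congr 1
  rw [show 2 / L * (L / 2) = 1 by field_simp, one_smul]

theorem isSymm_one : (1 : Mat d).IsSymm := Matrix.transpose_one

theorem normalized_isSymm {L : ℝ} {A : Mat d} (hA : A.IsSymm) : (normalized L A).IsSymm :=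
  (hA.sub (isSymm_one.smul _)).smul _

theorem norm_normalized_le {L : ℝ} (hL : 0 < L) {A : Mat d} (hA : A.PosSemidef)
    (hA' : (L • (1 : Mat d) - A).PosSemidef) : ‖op (normalized L A)‖ ≤ 1 := by
  rw [op_normalized hL]
  rw [posSemidef_iff_inner] at hA hA'
  refine norm_rescaled_le (fun u v => inner_op_comm hA.1 u v) hA.2 (fun v => ?_) hL
  have := hA'.2 v
  rw [op_sub, op_smul, op_one] at this
  simp only [sub_apply, smul_apply,
    ContinuousLinearMap.id_apply, inner_sub_right, inner_smul_right,
    real_inner_self_eq_norm_sq] at this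
  linarith

theorem sub_of_normalized {L : ℝ} (hL : 0 < L) (Bh H : Mat d) :
    ((L / 2) • Bh + (L / 2) • (1 : Mat d)) - H = (L / 2) • (Bh - normalized L H) := by
  rw [normalized, smul_sub, smul_smul, show L / 2 * (2 / L) = 1 by field_simp, one_smul]
  abel

theorem normalized_sub {L : ℝ} (A B : Mat d) :
    normalized L A - normalized L B = (2 / L) • (A - B) := by
  rw [normalized, normalized, ← smul_sub]
  congr 1
  abel

end Frobenius

/-! ### The Hessian approximation built from a matrix in the unit ball. -/

section Smoothed

variable {d : ℕ} {L : ℝ} {Bh : Mat d}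

theorem op_smoothed (v : Vec d) :
    op ((L / 2) • Bh + (L / 2) • (1 : Mat d)) v = (L / 2) • (op Bh v + v) := by
  rw [op_add, op_smul, op_smul, op_one]
  simp

theorem isSymm_smoothed (hs : Bh.IsSymm) : ((L / 2) • Bh + (L / 2) • (1 : Mat d)).IsSymm :=
  (hs.smul _).add (isSymm_one.smul _)

theorem inner_smoothed_nonneg (hL : 0 < L) (hn : ‖op Bh‖ ≤ 1) (v : Vec d) :
    0 ≤ inner ℝ v (op ((L / 2) • Bh + (L / 2) • (1 : Mat d)) v) := by
  rw [op_smoothed, inner_smul_right, inner_add_right, real_inner_self_eq_norm_sq]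
  have h1 := (abs_le.1 (abs_real_inner_le_norm v (op Bh v))).1
  have h2 : ‖op Bh v‖ ≤ ‖v‖ := by simpa using (op Bh).le_of_opNorm_le hn v
  have : 0 ≤ inner ℝ v (op Bh v) + ‖v‖ ^ 2 := by nlinarith [norm_nonneg v]
  positivity

theorem norm_smoothed_le (hL : 0 < L) (hn : ‖op Bh‖ ≤ 1) (v : Vec d) :
    ‖op ((L / 2) • Bh + (L / 2) • (1 : Mat d)) v‖ ≤ L * ‖v‖ := by
  rw [op_smoothed, norm_smul, Real.norm_of_nonneg (by positivity)]
  have h2 : ‖op Bh v‖ ≤ ‖v‖ := by simpa using (op Bh).le_of_opNorm_le hn v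
  have h3 := norm_add_le (op Bh v) v
  nlinarith

end Smoothed

/-! ### Projection onto a ball, and the surrogate gradient, in an inner product space. -/

section Projection

variable {V : Type*} [NormedAddCommGroup V] [InnerProductSpace ℝ V]

theorem norm_proj_le {r : ℝ} (hr : 0 ≤ r) (x : V) : ‖(r / max r ‖x‖) • x‖ ≤ r := by
  rw [norm_smul, Real.norm_of_nonneg (by positivity)]
  rcases eq_or_lt_of_le hr with h | h
  · simp [← h]
  · have : 0 < max r ‖x‖ := lt_max_of_lt_left h
    rw [div_mul_eq_mul_div, div_le_iff₀ this]
    gcongr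
    exact le_max_right _ _

/-- When x lies outside the ball, split x - h as (tx - h) + (1 - t)x, where tx is the projection.
The cross term is nonnegative because ⟪h, x⟫ ≤ r‖x‖ = t‖x‖², so removing the second summand cannot
lengthen the vector. -/
theorem norm_proj_sub_le {r : ℝ} (x : V) {h : V} (hh : ‖h‖ ≤ r) :
    ‖(r / max r ‖x‖) • x - h‖ ≤ ‖x - h‖ := by
  have hr : 0 ≤ r := (norm_nonneg h).trans hh
  rcases eq_or_lt_of_le hr with h0 | h0
  · have : h = 0 := by rw [← norm_le_zero_iff, h0]; exact hh
    simp [← h0, this]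
  rcases le_or_gt ‖x‖ r with hx | hx
  · rw [max_eq_left hx, div_self h0.ne', one_smul]
  rw [max_eq_right hx.le]
  have hx0 : 0 < ‖x‖ := h0.trans hx
  set t := r / ‖x‖ with ht
  have ht0 : 0 < t := by positivity
  have ht1 : t < 1 := (div_lt_one hx0).2 hx
  have htx : t * ‖x‖ = r := by rw [ht]; field_simp
  refine abs_le_of_sq_le_sq' (b := ‖x - h‖) ?_ (norm_nonneg _) |>.2
  have e : x - h = (t • x - h) + (1 - t) • x := by module
  rw [e, norm_add_sq_real, inner_smul_right, inner_sub_left, inner_smul_left,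
    real_inner_self_eq_norm_sq, RCLike.conj_to_real]
  have h1 : inner ℝ h x ≤ r * ‖x‖ := (real_inner_le_norm h x).trans (by gcongr)
  have h2 : 0 ≤ t * ‖x‖ ^ 2 - inner ℝ h x := by
    rw [sq, ← mul_assoc, htx]; linarith
  have h3 : 0 ≤ (1 - t) * (t * ‖x‖ ^ 2 - inner ℝ h x) := mul_nonneg (by linarith) h2
  nlinarith [sq_nonneg ‖(1 - t) • x‖]

theorem norm_proj_step_sq_le {r : ℝ} (ρ : ℝ) (w g : V) {h : V} (hh : ‖h‖ ≤ r) :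
    ‖(r / max r ‖w - ρ • g‖) • (w - ρ • g) - h‖ ^ 2
      ≤ ‖w - h‖ ^ 2 - 2 * ρ * inner ℝ g (w - h) + ρ ^ 2 * ‖g‖ ^ 2 := by
  have h1 := norm_proj_sub_le (w - ρ • g) hh
  have h2 : w - ρ • g - h = (w - h) - ρ • g := by abel
  have h3 : ‖w - ρ • g - h‖ ^ 2
      = ‖w - h‖ ^ 2 - 2 * ρ * inner ℝ g (w - h) + ρ ^ 2 * ‖g‖ ^ 2 := by
    rw [h2, norm_sub_sq_real, inner_smul_right, norm_smul, mul_pow, Real.norm_eq_abs, sq_abs,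
      real_inner_comm]
    ring
  rw [← h3]
  gcongr

/-- The surrogate gradient `g + m S`, `m = max 0 (-⟪g, b⟫)`, where `b = w / γ` with `γ > 1`:
its linear regret dominates that of `g` up to the accuracy of the separating direction. -/
theorem inner_surrogate_ge {g S w h : V} {γ δ r : ℝ} (hγ : 1 < γ) (hδ : 0 ≤ δ)
    (hS : γ - 1 - δ ≤ inner ℝ S (w - h)) (hg : |inner ℝ g (γ⁻¹ • w)| ≤ 2 * r) :
    inner ℝ g (γ⁻¹ • w - h) - 2 * r * δ
      ≤ inner ℝ (g + max 0 (-inner ℝ g (γ⁻¹ • w)) • S) (w - h) := by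
  set b := γ⁻¹ • w with hb
  have hw : w = γ • b := by rw [hb, smul_smul, mul_inv_cancel₀ (by linarith), one_smul]
  set m := max 0 (-inner ℝ g b) with hm
  have hm0 : 0 ≤ m := le_max_left _ _
  have hm1 : -inner ℝ g b ≤ m := le_max_right _ _
  have hm2 : m ≤ 2 * r := max_le ((abs_nonneg _).trans hg) ((neg_le_abs _).trans hg)
  rw [inner_add_left, inner_smul_left, RCLike.conj_to_real]
  have e : inner ℝ g (w - h) = inner ℝ g (b - h) + (γ - 1) * inner ℝ g b := by
    rw [inner_sub_right, inner_sub_right, hw, inner_smul_right]; ring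
  rw [e]
  have h1 : m * (γ - 1 - δ) ≤ m * inner ℝ S (w - h) := by gcongr
  have h2 : (γ - 1) * (-inner ℝ g b) ≤ (γ - 1) * m := by
    have : 0 ≤ γ - 1 := by linarith
    gcongr
  have h3 : m * δ ≤ 2 * r * δ := by gcongr
  nlinarith

theorem norm_surrogate_le {g S b : V} {r : ℝ} (hS : ‖S‖ ≤ 3) (hg : ‖g‖ ≤ 2 * r)
    (hgb : |inner ℝ g b| ≤ 2 * r) : ‖g + max 0 (-inner ℝ g b) • S‖ ≤ 8 * r := by
  have hr : 0 ≤ 2 * r := (norm_nonneg _).trans hg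
  have hm2 : max 0 (-inner ℝ g b) ≤ 2 * r := max_le hr ((neg_le_abs _).trans hgb)
  calc _ ≤ ‖g‖ + ‖max 0 (-inner ℝ g b) • S‖ := norm_add_le _ _
    _ ≤ 2 * r + 2 * r * 3 := by
      rw [norm_smul, Real.norm_of_nonneg (le_max_left _ _)]
      gcongr
    _ = _ := by ring

end Projection

/-! ### One round of online learning, and the cost of a moving comparator. -/

section OnlineStep

variable {d : ℕ}

theorem frobNorm_normalized_le {Hh : Mat d} (h : ‖op Hh‖ ≤ 1) : ‖frobVec Hh‖ ≤ √d := by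
  rw [← frobNorm_eq_norm]
  exact (frobNorm_le _).trans (mul_le_of_le_one_right (Real.sqrt_nonneg _) h)

/-- One step of the online learner against the comparator `H`. -/
theorem online_step {L γ δ : ℝ} (hL : 0 < L) (hδ : 0 ≤ δ) {W S Bh G Gt H : Mat d} {s w : Vec d}
    (hW : W.IsSymm) (hH : H.IsSymm) (hHn : ‖op (normalized L H)‖ ≤ 1)
    (hsep : SepCorrect W δ (γ, S)) (hBh : Bh = if γ ≤ 1 then W else γ⁻¹ • W)
    (hG : G = (2 / L) • lossGrad s w ((L / 2) • Bh + (L / 2) • (1 : Mat d)))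
    (hGt : Gt = if γ ≤ 1 then G else G + max 0 (-frobInner G Bh) • S) :
    loss s w ((L / 2) • Bh + (L / 2) • (1 : Mat d)) / 2 ≤ loss s w H + L ^ 2 * δ ^ 2
      + 16 * L ^ 2 * (frobNorm (W - normalized L H) ^ 2
        - frobNorm ((√d / max √d (frobNorm (W - rho • Gt))) • (W - rho • Gt)
            - normalized L H) ^ 2) := by
  set B := (L / 2) • Bh + (L / 2) • (1 : Mat d) with hB
  set ℓ := loss s w B with hℓ
  set r := 2 / L * √ℓ with hr
  have hr2 : r ^ 2 = (2 / L) ^ 2 * ℓ := by rw [hr, mul_pow, Real.sq_sqrt (loss_nonneg _ _ _)]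
  have hr0 : 0 ≤ r := by positivity
  have hL2 : 0 < 2 / L := by positivity
  have hBhs : Bh.IsSymm := by
    rw [hBh]; split_ifs
    · exact hW
    · exact hW.smul _
  have hBhn : ‖op Bh‖ ≤ 1 := by
    rw [hBh]; split_ifs with h
    · exact hsep.1 h
    · exact (hsep.2 (not_le.1 h)).1
  have hGn : ‖frobVec G‖ ≤ 2 * r := by
    rw [hG, map_smul, norm_smul, ← frobNorm_eq_norm, Real.norm_of_nonneg hL2.le, hr]
    have := frobNorm_lossGrad_le s w B
    calc _ ≤ 2 / L * (2 * √ℓ) := by gcongr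
      _ = _ := by ring
  have hGB : |inner ℝ (frobVec G) (frobVec Bh)| ≤ 2 * r := by
    rw [hG, map_smul, inner_smul_left, RCLike.conj_to_real, abs_mul, abs_of_pos hL2,
      ← frobInner_eq_inner, hr]
    have := abs_frobInner_lossGrad_le s w B hBhs hBhn
    calc _ ≤ 2 / L * (2 * √ℓ) := by gcongr
      _ = _ := by ring
  have hconv : (2 / L) ^ 2 * (ℓ - loss s w H)
      ≤ inner ℝ (frobVec G) (frobVec Bh - frobVec (normalized L H)) := by
    have hs : B - H = (L / 2) • (Bh - normalized L H) := sub_of_normalized hL Bh H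
    have h1 := loss_sub_le s w (B := B) (H := H)
      (by rw [hs]; exact (hBhs.sub (normalized_isSymm hH)).smul _)
    rw [hs, frobInner_eq_inner, map_smul, inner_smul_right, map_sub] at h1
    rw [hG, map_smul, inner_smul_left, RCLike.conj_to_real]
    calc (2 / L) ^ 2 * (ℓ - loss s w H) ≤ (2 / L) ^ 2 * (L / 2 *
          inner ℝ (frobVec (lossGrad s w B)) (frobVec Bh - frobVec (normalized L H))) := by
          gcongr
      _ = _ := by field_simp
  have hreg : inner ℝ (frobVec G) (frobVec Bh - frobVec (normalized L H)) - 2 * r * δ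
      ≤ inner ℝ (frobVec Gt) (frobVec W - frobVec (normalized L H)) ∧ ‖frobVec Gt‖ ≤ 8 * r := by
    by_cases h : γ ≤ 1
    · rw [hGt, if_pos h]
      rw [if_pos h] at hBh
      rw [← hBh]
      exact ⟨by nlinarith, by linarith⟩
    · rw [if_neg h] at hBh hGt
      obtain ⟨-, h2, h3⟩ := hsep.2 (not_le.1 h)
      have h3 := h3 _ (normalized_isSymm hH) hHn
      rw [frobInner_eq_inner, map_sub] at h3
      rw [frobNorm_eq_norm] at h2
      rw [hGt, map_add, map_smul, frobInner_eq_inner]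
      refine ⟨?_, norm_surrogate_le h2 hGn hGB⟩
      rw [hBh, map_smul] at hGB ⊢
      exact inner_surrogate_ge (not_le.1 h) hδ h3 hGB
  have hstep := norm_proj_step_sq_le rho (frobVec W) (frobVec Gt) (frobNorm_normalized_le hHn)
  have e1 : frobVec ((√d / max √d (frobNorm (W - rho • Gt))) • (W - rho • Gt) - normalized L H)
      = (√d / max √d ‖frobVec W - rho • frobVec Gt‖) • (frobVec W - rho • frobVec Gt)
        - frobVec (normalized L H) := by
    rw [map_sub, map_smul, frobNorm_eq_norm, map_sub, map_smul]
  rw [frobNorm_eq_norm, frobNorm_eq_norm, e1, map_sub]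
  set N₁ := ‖frobVec W - frobVec (normalized L H)‖ ^ 2
  set N₂ := ‖(√d / max √d ‖frobVec W - rho • frobVec Gt‖) • (frobVec W - rho • frobVec Gt)
        - frobVec (normalized L H)‖ ^ 2
  obtain ⟨h1, h2⟩ := hreg
  have h3 : ‖frobVec Gt‖ ^ 2 ≤ (8 * r) ^ 2 := by gcongr
  rw [rho] at hstep
  -- With ρ = 1/128 and ‖G̃‖ ≤ 8r, the term ρ‖G̃‖²/2 is at most r²/4. Another r²/4 pays for the
  -- oracle error, so together they use half of the r² on the left.
  have h4 : 2 * r * δ ≤ r ^ 2 / 4 + 4 * δ ^ 2 := by nlinarith [sq_nonneg (r / 2 - 2 * δ)]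
  have h5 : (2 / L) ^ 2 * (ℓ - loss s w H) ≤ 64 * (N₁ - N₂) + r ^ 2 / 2 + 4 * δ ^ 2 := by
    nlinarith
  rw [hr2] at h5
  have h6 : (2 / L) ^ 2 * (ℓ / 2)
      ≤ (2 / L) ^ 2 * (loss s w H + L ^ 2 * δ ^ 2 + 16 * L ^ 2 * (N₁ - N₂)) := by
    have : (2 / L) ^ 2 * (loss s w H + L ^ 2 * δ ^ 2 + 16 * L ^ 2 * (N₁ - N₂))
        = (2 / L) ^ 2 * loss s w H + 4 * δ ^ 2 + 64 * (N₁ - N₂) := by field_simp; ring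
    rw [this]
    linarith
  exact le_of_mul_le_mul_left h6 (by positivity)

/-- Changing the comparator moves the squared distance by at most `4√d` times the change. -/
theorem frobNorm_sub_sq_le {W H₁ H₂ : Mat d} (hW : frobNorm W ≤ √d) (h₁ : ‖op H₁‖ ≤ 1)
    (h₂ : ‖op H₂‖ ≤ 1) :
    frobNorm (W - H₂) ^ 2 ≤ frobNorm (W - H₁) ^ 2 + 4 * d * ‖op (H₂ - H₁)‖ := by
  have h3 := frobNorm_le (H₂ - H₁)
  rw [frobNorm_eq_norm] at *
  rw [frobNorm_eq_norm]
  have h1 := frobNorm_normalized_le h₁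
  have h2 := frobNorm_normalized_le h₂
  rw [map_sub] at *
  rw [map_sub] at *
  have h4 : frobVec W - frobVec H₂ = (frobVec W - frobVec H₁) - (frobVec H₂ - frobVec H₁) := by
    abel
  have h5 : ‖frobVec W - frobVec H₂‖ ≤ 2 * √d := (norm_sub_le _ _).trans (by linarith)
  have h6 : ‖frobVec W - frobVec H₁‖ ≤ 2 * √d := (norm_sub_le _ _).trans (by linarith)
  have h7 : ‖frobVec W - frobVec H₂‖ ≤ ‖frobVec W - frobVec H₁‖ + ‖frobVec H₂ - frobVec H₁‖ := by
    rw [h4]; exact norm_sub_le _ _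
  have hd : √(d : ℝ) * √d = d := Real.mul_self_sqrt (Nat.cast_nonneg d)
  have h8 : (‖frobVec W - frobVec H₂‖ - ‖frobVec W - frobVec H₁‖) *
      (‖frobVec W - frobVec H₂‖ + ‖frobVec W - frobVec H₁‖)
      ≤ (√d * ‖op (H₂ - H₁)‖) * (4 * √d) := by
    apply mul_le_mul <;> first | positivity | linarith
  have h9 : √d * ‖op (H₂ - H₁)‖ * (4 * √d) = 4 * (√(d : ℝ) * √d) * ‖op (H₂ - H₁)‖ := by ring
  rw [h9, hd] at h8
  linarith

end OnlineStep

/-! ### Gradient and Hessian of a smooth convex function. -/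

section Objective

variable {d : ℕ} {f : Vec d → ℝ} {L₁ L₂ : ℝ}

theorem hasFDerivAt_innerSL_gradient (hf : Differentiable ℝ f) (x : Vec d) :
    HasFDerivAt f (innerSL ℝ (gradient f x)) x := by
  have h : innerSL ℝ (gradient f x) = fderiv ℝ f x := by
    ext v
    simp
  rw [h]
  exact (hf x).hasFDerivAt

theorem gradient_inequality (hf : IsSmoothConvex f L₁) (x y : Vec d) :
    f x + inner ℝ (gradient f x) (y - x) ≤ f y := by
  have h1 : ConvexOn ℝ Set.univ (f ∘ (AffineMap.lineMap x y : ℝ →ᵃ[ℝ] Vec d)) := by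
    simpa using hf.convex.comp_affineMap (AffineMap.lineMap x y : ℝ →ᵃ[ℝ] Vec d)
  have h2 : HasDerivAt (f ∘ (AffineMap.lineMap x y : ℝ →ᵃ[ℝ] Vec d))
      (inner ℝ (gradient f x) (y - x)) 0 := by
    have h3 := hasFDerivAt_innerSL_gradient hf.differentiable (AffineMap.lineMap x y (0 : ℝ))
    have h4 : HasDerivAt (AffineMap.lineMap x y : ℝ →ᵃ[ℝ] Vec d) (y - x) 0 :=
      AffineMap.hasDerivAt_lineMap
    simpa using h3.comp_hasDerivAt (0 : ℝ) h4
  have h5 := h1.le_slope_of_hasDerivAt (Set.mem_univ 0) (Set.mem_univ 1) zero_lt_one h2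
  simp only [slope, sub_zero, inv_one, Function.comp_apply, AffineMap.lineMap_apply_one,
    AffineMap.lineMap_apply_zero, vsub_eq_sub, one_smul] at h5
  linarith

theorem gradient_monotone (hf : IsSmoothConvex f L₁) (x y : Vec d) :
    0 ≤ inner ℝ (gradient f y - gradient f x) (y - x) := by
  have h1 := gradient_inequality hf x y
  have h2 := gradient_inequality hf y x
  rw [← neg_sub, inner_neg_right] at h2
  rw [inner_sub_left]
  linarith

theorem hasFDerivAt_gradient (hf : IsSmoothConvex f L₁) (x : Vec d) :
    HasFDerivAt (gradient f) (hess f x) x :=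
  (hf.differentiable_gradient x).hasFDerivAt

theorem norm_hess_le (hL : 0 ≤ L₁) (hf : IsSmoothConvex f L₁) (x : Vec d) : ‖hess f x‖ ≤ L₁ :=
  (hasFDerivAt_gradient hf x).le_of_lip' hL (Filter.Eventually.of_forall fun y => hf.smooth y x)

/-- The Riesz map of `ℝ^d`, as a linear map. -/
noncomputable def rieszMap (d : ℕ) : Vec d →L[ℝ] Vec d →L[ℝ] ℝ :=
  LinearMap.toContinuousLinearMap
    { toFun := fun v => innerSL ℝ v
      map_add' := fun u v => by ext w; simp
      map_smul' := fun c v => by ext w; simp }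

theorem rieszMap_apply (u v : Vec d) : rieszMap d u v = inner ℝ u v := rfl

/-- The differential of f is the Riesz map applied to the gradient, so this is the symmetry of
second derivatives; continuity of the Hessian plays no role. -/
theorem hess_symm (hf : IsSmoothConvex f L₁) (x u v : Vec d) :
    inner ℝ u (hess f x v) = inner ℝ v (hess f x u) := by
  have h := second_derivative_symmetric (𝕜 := ℝ) (f := f) (x := x)
    (f' := fun y => rieszMap d (gradient f y)) (f'' := (rieszMap d).comp (hess f x))
    (fun y => hasFDerivAt_innerSL_gradient hf.differentiable y)
    ((rieszMap d).hasFDerivAt.comp x (hasFDerivAt_gradient hf x)) v u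
  rw [ContinuousLinearMap.comp_apply, ContinuousLinearMap.comp_apply, rieszMap_apply,
    rieszMap_apply] at h
  rw [real_inner_comm, h, real_inner_comm]

/-- The quadratic form is the derivative at 0 of t ↦ ⟪v, ∇f(x + tv)⟫, which is monotone because the
gradient is. -/
theorem inner_hess_nonneg (hf : IsSmoothConvex f L₁) (x v : Vec d) :
    0 ≤ inner ℝ v (hess f x v) := by
  have h1 : HasDerivAt (fun t : ℝ => inner ℝ v (gradient f (x + t • v)))
      (inner ℝ v (hess f x v)) 0 := by
    have h2 : HasDerivAt (fun t : ℝ => x + t • v) v 0 := by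
      simpa using ((hasDerivAt_id (0 : ℝ)).smul_const v).const_add x
    have h3 : HasFDerivAt (gradient f) (hess f x) (x + (0 : ℝ) • v) := by
      simpa using hasFDerivAt_gradient hf x
    have h4 := h3.comp_hasDerivAt (0 : ℝ) h2
    exact ((innerSL ℝ v).hasFDerivAt).comp_hasDerivAt (0 : ℝ) h4
  have hm : Monotone (fun t : ℝ => inner ℝ v (gradient f (x + t • v))) := by
    intro a b hab
    rcases eq_or_lt_of_le hab with rfl | hab
    · exact le_rfl
    have h5 := gradient_monotone hf (x + a • v) (x + b • v)
    have h6 : x + b • v - (x + a • v) = (b - a) • v := by module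
    rw [h6, inner_smul_right, real_inner_comm, inner_sub_right] at h5
    have := nonneg_of_mul_nonneg_right h5 (by linarith)
    simp only
    linarith
  exact h1.nonneg_of_monotone hm

theorem op_hessMat (x : Vec d) : op (hessMat f x) = hess f x := by
  simp [op, hessMat]

theorem hessMat_isSymm (hf : IsSmoothConvex f L₁) (x : Vec d) : (hessMat f x).IsSymm := by
  ext i j
  have h := hess_symm hf x (EuclideanSpace.single i 1) (EuclideanSpace.single j 1)
  rw [← op_hessMat, EuclideanSpace.inner_single_left, EuclideanSpace.inner_single_left,
    op_col, op_col] at h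
  simpa using h.symm

theorem norm_normalized_hessMat_le (hL : 0 < L₁) (hf : IsSmoothConvex f L₁) (x : Vec d) :
    ‖op (normalized L₁ (hessMat f x))‖ ≤ 1 := by
  rw [op_normalized hL, op_hessMat]
  refine norm_rescaled_le (hess_symm hf x) (inner_hess_nonneg hf x) (fun v => ?_) hL
  have h1 := real_inner_le_norm v (hess f x v)
  have h2 := (hess f x).le_of_opNorm_le (norm_hess_le hL.le hf x) v
  nlinarith [norm_nonneg v]

theorem norm_normalized_hessMat_sub_le (hL : 0 < L₁) (hf2 : HasLipschitzHessian f L₂)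
    (x y : Vec d) :
    ‖op (normalized L₁ (hessMat f x) - normalized L₁ (hessMat f y))‖
      ≤ 2 / L₁ * (L₂ * ‖x - y‖) := by
  rw [normalized_sub, op_smul, op_sub, op_hessMat, op_hessMat, norm_smul,
    Real.norm_of_nonneg (by positivity)]
  gcongr
  exact hf2 x y

/-- Mean value inequality for ∇f minus its linearization, on the ball around x of radius ‖y - x‖.
The sharp factor 1/2 is not needed. -/
theorem norm_gradient_sub_hess_le (hf : IsSmoothConvex f L₁) (hL2 : 0 ≤ L₂)
    (hf2 : HasLipschitzHessian f L₂) (x y : Vec d) :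
    ‖gradient f y - gradient f x - hess f x (y - x)‖ ≤ L₂ * ‖y - x‖ * ‖y - x‖ := by
  refine Convex.norm_image_sub_le_of_norm_fderiv_le' (𝕜 := ℝ) (s := Metric.closedBall x ‖y - x‖)
    (fun z _ => hf.differentiable_gradient z) (fun z hz => ?_) (convex_closedBall _ _)
    (by simp) (by simp [dist_eq_norm])
  refine (hf2 z x).trans ?_
  gcongr
  simpa [dist_eq_norm] using hz

/-- The comparator of the regret bound is the Hessian at the base point y_k; its loss is quadratic
in the length of the rejected step, hence summable. -/
theorem loss_hessMat_le (hf : IsSmoothConvex f L₁) (hL2 : 0 ≤ L₂)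
    (hf2 : HasLipschitzHessian f L₂) (x y : Vec d) :
    loss (y - x) (gradient f y - gradient f x) (hessMat f x) ≤ L₂ ^ 2 * ‖y - x‖ ^ 2 := by
  have h := norm_gradient_sub_hess_le hf hL2 hf2 x y
  rw [loss, op_hessMat]
  rcases eq_or_ne ‖y - x‖ 0 with h0 | h0
  · simp [h0]
  rw [div_le_iff₀ (by positivity)]
  calc _ ≤ (L₂ * ‖y - x‖ * ‖y - x‖) ^ 2 := by gcongr
    _ = _ := by ring

theorem loss_smoothed_le (hL : 0 < L₁) (hf : IsSmoothConvex f L₁) (x y : Vec d) {Bh : Mat d}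
    (hn : ‖op Bh‖ ≤ 1) :
    loss (y - x) (gradient f y - gradient f x) ((L₁ / 2) • Bh + (L₁ / 2) • (1 : Mat d))
      ≤ (2 * L₁) ^ 2 := by
  rw [loss]
  rcases eq_or_ne ‖y - x‖ 0 with h0 | h0
  · simp only [h0]
    simp
    positivity
  rw [div_le_iff₀ (by positivity), ← mul_pow]
  have h1 := hf.smooth y x
  have h2 := norm_smoothed_le hL hn (y - x)
  have h3 := norm_sub_le (gradient f y - gradient f x)
    (op ((L₁ / 2) • Bh + (L₁ / 2) • (1 : Mat d)) (y - x))
  gcongr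
  linarith

end Objective

/-! ### Invariants of a state and the backtracking line search. -/

/-- The admissible range of the parameters. -/
structure Params.Valid (P : Params) : Prop where
  α₁_pos : 0 < P.α₁
  α₂_pos : 0 < P.α₂
  add_lt : P.α₁ + P.α₂ < 1
  β_pos : 0 < P.β
  β_lt : P.β < 1
  σ₀_pos : 0 < P.σ₀
  L₁_pos : 0 < P.L₁
  p_pos : 0 < P.p
  p_lt : P.p < 1

namespace State

variable {d : ℕ}

/-- The invariants of the method, valid as long as every oracle answer is correct. -/
structure Valid (s : State d) : Prop where
  η_pos : 0 < s.η
  A_nonneg : 0 ≤ s.A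
  W_symm : s.W.IsSymm
  S_symm : s.S.IsSymm
  W_le : frobNorm s.W ≤ √d
  sep : SepCorrect s.W (delta s.t) (s.γ, s.S)

theorem Bhat_isSymm {s : State d} (h : s.W.IsSymm) : s.Bhat.IsSymm := by
  unfold Bhat; split_ifs
  · exact h
  · exact h.smul _

theorem Valid.norm_Bhat_le {s : State d} (h : s.Valid) : ‖op s.Bhat‖ ≤ 1 := by
  unfold Bhat; split_ifs with h1
  · exact h.sep.1 h1
  · exact (h.sep.2 (not_le.1 h1)).1

/-- The number a is the larger root of a² = η(A + a), the balance that makes the terms of the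
potential cancel. -/
theorem a_sq {s : State d} (hη : 0 ≤ s.η) (hA : 0 ≤ s.A) : s.a ^ 2 = s.η * (s.A + s.a) := by
  have h : √(s.η ^ 2 + 4 * s.η * s.A) ^ 2 = s.η ^ 2 + 4 * s.η * s.A :=
    Real.sq_sqrt (by positivity)
  rw [a]
  linear_combination h / 4

theorem η_le_a {s : State d} (hη : 0 ≤ s.η) (hA : 0 ≤ s.A) : s.η ≤ s.a := by
  have h : s.η ≤ √(s.η ^ 2 + 4 * s.η * s.A) := Real.le_sqrt_of_sq_le (by nlinarith [mul_nonneg hη hA])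
  rw [a]
  linarith

theorem sqrt_le_a {s : State d} (hη : 0 ≤ s.η) (hA : 0 ≤ s.A) :
    s.η / 2 + √s.η * √s.A ≤ s.a := by
  have h : 2 * (√s.η * √s.A) ≤ √(s.η ^ 2 + 4 * s.η * s.A) := by
    refine Real.le_sqrt_of_sq_le ?_
    rw [mul_pow, mul_pow, Real.sq_sqrt hη, Real.sq_sqrt hA]
    nlinarith [sq_nonneg s.η]
  rw [a]
  linarith

section LineSearch

variable {P : Params} {f : Vec d → ℝ} {solver : Mat d → Vec d → ℝ → Vec d} {s : State d}

theorem trialStep_pos (hP : P.Valid) (hs : 0 < s.η) (i : ℕ) : 0 < s.trialStep P i :=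
  mul_pos hs (pow_pos hP.β_pos i)

theorem trial_residual (hP : P.Valid) (hsol : IsLinearSolver solver) (hs : s.Valid) (i : ℕ) :
    ‖(s.trialPoint P f solver i - s.y) + s.trialStep P i • op (s.B P)
        (s.trialPoint P f solver i - s.y) + s.trialStep P i • gradient f s.y‖
      ≤ P.α₁ * ‖s.trialPoint P f solver i - s.y‖ := by
  have hη := trialStep_pos (P := P) hP hs.η_pos i
  have hpsd : (1 + s.trialStep P i • s.B P).PosSemidef := by
    rw [posSemidef_iff_inner]
    refine ⟨isSymm_one.add ((isSymm_smoothed (Bhat_isSymm hs.W_symm)).smul _), fun v => ?_⟩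
    have h1 := inner_smoothed_nonneg hP.L₁_pos hs.norm_Bhat_le v
    rw [op_add, op_smul, op_one]
    simp only [add_apply, ContinuousLinearMap.id_apply, smul_apply, inner_add_right,
      inner_smul_right, real_inner_self_eq_norm_sq]
    have h2 := mul_nonneg hη.le h1
    have h3 := sq_nonneg ‖v‖
    unfold B
    linarith
  have h := hsol.accurate _ (-(s.trialStep P i • gradient f s.y)) P.α₁ hpsd hP.α₁_pos
    (by linarith [hP.add_lt, hP.α₂_pos])
  have e : s.trialPoint P f solver i - s.y
      = solver (1 + s.trialStep P i • s.B P) (-(s.trialStep P i • gradient f s.y)) P.α₁ := by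
    rw [trialPoint]; abel
  rw [e]
  convert h using 2
  rw [op_add, op_smul, op_one, sub_neg_eq_add]
  simp

theorem norm_gradient_error_le (hP : P.Valid) (hf : IsSmoothConvex f P.L₁) (hs : s.Valid)
    (x : Vec d) : ‖gradient f x - gradient f s.y - op (s.B P) (x - s.y)‖
      ≤ 2 * P.L₁ * ‖x - s.y‖ := by
  have h1 := hf.smooth x s.y
  have h2 := norm_smoothed_le hP.L₁_pos hs.norm_Bhat_le (x - s.y)
  have h3 := norm_sub_le (gradient f x - gradient f s.y) (op (s.B P) (x - s.y))
  unfold B at *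
  linarith

/-- The tested residual is that of the linear system plus η̂ times the error of replacing ∇f by its
linear model at y. The first accounts for α₁, so α₂ measures the second. -/
theorem test_residual_le (hP : P.Valid) (hsol : IsLinearSolver solver) (hs : s.Valid) (i : ℕ) :
    ‖s.trialPoint P f solver i - s.y
      + s.trialStep P i • gradient f (s.trialPoint P f solver i)‖
    ≤ P.α₁ * ‖s.trialPoint P f solver i - s.y‖ + s.trialStep P i *
      ‖gradient f (s.trialPoint P f solver i) - gradient f s.y
        - op (s.B P) (s.trialPoint P f solver i - s.y)‖ := by
  have h := trial_residual (f := f) hP hsol hs i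
  have hη := trialStep_pos (P := P) hP hs.η_pos i
  set x := s.trialPoint P f solver i
  set η := s.trialStep P i
  have e : x - s.y + η • gradient f x = ((x - s.y) + η • op (s.B P) (x - s.y)
      + η • gradient f s.y) + η • (gradient f x - gradient f s.y - op (s.B P) (x - s.y)) := by
    module
  rw [e]
  refine (norm_add_le _ _).trans ?_
  rw [norm_smul, Real.norm_of_nonneg hη.le]
  gcongr

/-- The linear model is off by at most 2L₁‖x - y‖, so every trial step with 2L₁η̂ ≤ α₂ passes the
test. -/
theorem exists_accepts (hP : P.Valid) (hf : IsSmoothConvex f P.L₁)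
    (hsol : IsLinearSolver solver) (hs : s.Valid) : ∃ i, s.Accepts P f solver i := by
  have hL := hP.L₁_pos
  have hη := hs.η_pos
  obtain ⟨i, hi⟩ := exists_pow_lt_of_lt_one
    (show 0 < P.α₂ / (s.η * (2 * P.L₁)) from div_pos hP.α₂_pos (by positivity)) hP.β_lt
  refine ⟨i, (test_residual_le hP hsol hs i).trans ?_⟩
  have h1 := norm_gradient_error_le hP hf hs (s.trialPoint P f solver i)
  have hη' := trialStep_pos (P := P) hP hs.η_pos i
  rw [lt_div_iff₀ (by positivity)] at hi
  have h2 : s.trialStep P i * (2 * P.L₁) ≤ P.α₂ := by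
    rw [trialStep]
    calc _ = P.β ^ i * (s.η * (2 * P.L₁)) := by ring
      _ ≤ _ := hi.le
  calc _ ≤ P.α₁ * ‖s.trialPoint P f solver i - s.y‖ + s.trialStep P i *
        (2 * P.L₁ * ‖s.trialPoint P f solver i - s.y‖) := by gcongr
    _ = P.α₁ * ‖s.trialPoint P f solver i - s.y‖ + s.trialStep P i *
        (2 * P.L₁) * ‖s.trialPoint P f solver i - s.y‖ := by ring
    _ ≤ P.α₁ * ‖s.trialPoint P f solver i - s.y‖ +
        P.α₂ * ‖s.trialPoint P f solver i - s.y‖ := by gcongr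
    _ = _ := by ring

theorem accepted (hP : P.Valid) (hf : IsSmoothConvex f P.L₁)
    (hsol : IsLinearSolver solver) (hs : s.Valid) :
    ‖s.xHat P f solver - s.y + s.etaHat P f solver • gradient f (s.xHat P f solver)‖
      ≤ (P.α₁ + P.α₂) * ‖s.xHat P f solver - s.y‖ :=
  Nat.sInf_mem (s := {i | s.Accepts P f solver i}) (exists_accepts hP hf hsol hs)

theorem etaHat_pos (hP : P.Valid) (hs : 0 < s.η) : 0 < s.etaHat P f solver :=
  trialStep_pos hP hs _

theorem etaHat_eq_of_eq_zero (h : s.numBacktracks P f solver = 0) : s.etaHat P f solver = s.η := by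
  simp [etaHat, trialStep, h]

theorem etaHat_eq_trialStep_mul (h : s.numBacktracks P f solver ≠ 0) :
    s.etaHat P f solver = s.trialStep P (s.numBacktracks P f solver - 1) * P.β := by
  obtain ⟨n, hn⟩ := Nat.exists_eq_succ_of_ne_zero h
  simp [etaHat, trialStep, hn, pow_succ, mul_assoc]

theorem etaHat_le_beta_mul (hP : P.Valid) (hs : 0 < s.η) (h : s.numBacktracks P f solver ≠ 0) :
    s.etaHat P f solver ≤ P.β * s.η := by
  rw [etaHat_eq_trialStep_mul h, trialStep, mul_comm]
  have := hP.β_pos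
  gcongr
  exact mul_le_of_le_one_right hs.le (pow_le_one₀ hP.β_pos.le hP.β_lt.le)

theorem etaHat_le (hP : P.Valid) (hs : 0 < s.η) : s.etaHat P f solver ≤ s.η :=
  mul_le_of_le_one_right hs.le (pow_le_one₀ hP.β_pos.le hP.β_lt.le)

theorem ratio_pos (hP : P.Valid) (hs : 0 < s.η) : 0 < s.ratio P f solver :=
  div_pos (etaHat_pos hP hs) hs

theorem ratio_le_one (hP : P.Valid) (hs : 0 < s.η) : s.ratio P f solver ≤ 1 :=
  (div_le_one hs).2 (etaHat_le hP hs)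

/-- Rejection at the previous trial η̂/β means that the linearization error there exceeds α₂‖x̃ -
y‖/(η̂/β). Dividing by ‖x̃ - y‖, which the strict inequality makes nonzero, turns small steps into
large losses. -/
theorem inv_etaHat_sq_le (hP : P.Valid) (hsol : IsLinearSolver solver) (hs : s.Valid)
    (h : s.numBacktracks P f solver ≠ 0) :
    1 / s.etaHat P f solver ^ 2 ≤ loss (s.xTilde P f solver - s.y)
      (gradient f (s.xTilde P f solver) - gradient f s.y) (s.B P) / (P.α₂ * P.β) ^ 2 := by
  have hrej : ¬ s.Accepts P f solver (s.numBacktracks P f solver - 1) := by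
    refine Nat.notMem_of_lt_sInf (s := {i | s.Accepts P f solver i}) ?_
    exact Nat.sub_lt (Nat.pos_of_ne_zero h) one_pos
  have h1 := not_le.1 hrej
  have h2 := h1.trans_le (test_residual_le hP hsol hs _)
  have hη := trialStep_pos (P := P) hP hs.η_pos (s.numBacktracks P f solver - 1)
  have hβ := hP.β_pos
  have hα := hP.α₂_pos
  rw [etaHat_eq_trialStep_mul h]
  change _ ≤ loss (s.trialPoint P f solver (s.numBacktracks P f solver - 1) - s.y)
      (gradient f (s.trialPoint P f solver (s.numBacktracks P f solver - 1)) - gradient f s.y)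
      (s.B P) / _
  set η := s.trialStep P (s.numBacktracks P f solver - 1)
  set x := s.trialPoint P f solver (s.numBacktracks P f solver - 1)
  have h3 : P.α₂ * ‖x - s.y‖ < η * ‖gradient f x - gradient f s.y - op (s.B P) (x - s.y)‖ := by
    linarith
  have h4 : 0 < ‖x - s.y‖ := by
    refine lt_of_le_of_ne (norm_nonneg _) fun h0 => ?_
    have h5 : x - s.y = 0 := norm_eq_zero.1 h0.symm
    have h6 : x = s.y := sub_eq_zero.1 h5
    rw [h6] at h3
    simp at h3
  rw [loss, div_le_div_iff₀ (by positivity) (by positivity), one_mul]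
  have h7 : (P.α₂ * ‖x - s.y‖) ^ 2
      ≤ (η * ‖gradient f x - gradient f s.y - op (s.B P) (x - s.y)‖) ^ 2 := by
    gcongr
  rw [div_mul_eq_mul_div, le_div_iff₀ (by positivity)]
  calc (P.α₂ * P.β) ^ 2 * ‖x - s.y‖ ^ 2 = (P.α₂ * ‖x - s.y‖) ^ 2 * P.β ^ 2 := by ring
    _ ≤ _ := mul_le_mul_of_nonneg_right h7 (sq_nonneg _)
    _ = _ := by ring

/-- Approximate solutions of `(I + η T) u = -η g` grow at most linearly in the step size. -/
theorem norm_le_of_residuals {V : Type*} [NormedAddCommGroup V] [InnerProductSpace ℝ V]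
    {T : V →L[ℝ] V} (hT : ∀ v, 0 ≤ inner ℝ v (T v)) {u v g : V} {η α β : ℝ} (hη : 0 < η)
    (hβ : 0 < β) (hβ1 : β ≤ 1) (hα : α < 1)
    (hu : ‖u + η • T u + η • g‖ ≤ α * ‖u‖)
    (hv : ‖v + (η * β) • T v + (η * β) • g‖ ≤ α * ‖v‖) :
    ‖u‖ ≤ (1 + α) / (β * (1 - α)) * ‖v‖ := by
  set r := u + η • T u + η • g
  set q := v + (η * β) • T v + (η * β) • g
  -- Scaling the second residual by β⁻¹ gives both the same terms in T and g, so g cancels in the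
  -- difference. What remains of T is -ηT(u - v), which has the right sign when paired with u - v.
  have e : u - v = (r - β⁻¹ • q) + (β⁻¹ - 1) • v - η • T (u - v) := by
    simp only [r, q, map_sub, smul_add, smul_smul]
    rw [show β⁻¹ * (η * β) = η by field_simp]
    module
  have h1 : ‖u - v‖ ^ 2 ≤ ‖u - v‖ * (α * ‖u‖ + β⁻¹ * (α * ‖v‖) + (β⁻¹ - 1) * ‖v‖) := by
    rw [← real_inner_self_eq_norm_sq]
    nth_rewrite 2 [e]
    rw [inner_sub_right, inner_smul_right]
    have h2 := mul_nonneg hη.le (hT (u - v))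
    have hβ2 : 0 ≤ β⁻¹ - 1 := by
      have := (one_le_inv₀ hβ).2 hβ1
      linarith
    have h3 : ‖(r - β⁻¹ • q) + (β⁻¹ - 1) • v‖
        ≤ α * ‖u‖ + β⁻¹ * (α * ‖v‖) + (β⁻¹ - 1) * ‖v‖ := by
      refine (norm_add_le _ _).trans ?_
      refine add_le_add ((norm_sub_le _ _).trans (add_le_add hu ?_)) ?_
      · rw [norm_smul, Real.norm_of_nonneg (by positivity)]
        gcongr
      · rw [norm_smul, Real.norm_of_nonneg hβ2]
    have h4 := real_inner_le_norm (u - v) ((r - β⁻¹ • q) + (β⁻¹ - 1) • v)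
    have h5 := mul_le_mul_of_nonneg_left h3 (norm_nonneg (u - v))
    linarith
  have h2 : ‖u - v‖ ≤ α * ‖u‖ + β⁻¹ * (α * ‖v‖) + (β⁻¹ - 1) * ‖v‖ := by
    rcases eq_or_lt_of_le (norm_nonneg (u - v)) with h0 | h0
    · rw [← h0]
      have h6 := (norm_nonneg _).trans hu
      have h7 := (norm_nonneg _).trans hv
      have hβ2 := (one_le_inv₀ hβ).2 hβ1
      have h8 : 0 ≤ (β⁻¹ - 1) * ‖v‖ := mul_nonneg (by linarith) (norm_nonneg _)
      positivity
    · rw [sq] at h1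
      exact le_of_mul_le_mul_left h1 h0
  have h3 : ‖u‖ ≤ ‖u - v‖ + ‖v‖ := by
    calc ‖u‖ = ‖(u - v) + v‖ := by rw [sub_add_cancel]
      _ ≤ _ := norm_add_le _ _
  have h4 : (1 - α) * ‖u‖ ≤ β⁻¹ * (1 + α) * ‖v‖ := by linarith
  have h5 : 0 < 1 - α := by linarith
  calc ‖u‖ = (1 - α)⁻¹ * ((1 - α) * ‖u‖) := by field_simp
    _ ≤ (1 - α)⁻¹ * (β⁻¹ * (1 + α) * ‖v‖) := by gcongr
    _ = _ := by field_simp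

/-- The losses involve rejected steps, whereas the potential controls only accepted ones; this
comparison connects the two. -/
theorem norm_xTilde_sub_le (hP : P.Valid) (hsol : IsLinearSolver solver) (hs : s.Valid)
    (h : s.numBacktracks P f solver ≠ 0) :
    ‖s.xTilde P f solver - s.y‖
      ≤ (1 + P.α₁) / (P.β * (1 - P.α₁)) * ‖s.xHat P f solver - s.y‖ := by
  have h1 := trial_residual (f := f) hP hsol hs (s.numBacktracks P f solver - 1)
  have h2 := trial_residual (f := f) hP hsol hs (s.numBacktracks P f solver)
  have e : s.trialStep P (s.numBacktracks P f solver)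
      = s.trialStep P (s.numBacktracks P f solver - 1) * P.β := etaHat_eq_trialStep_mul h
  rw [e] at h2
  exact norm_le_of_residuals (inner_smoothed_nonneg hP.L₁_pos hs.norm_Bhat_le)
    (trialStep_pos hP hs.η_pos _) hP.β_pos hP.β_lt.le
    (by linarith [hP.add_lt, hP.α₂_pos]) h1 h2

end LineSearch

end State

/-! ### Step size scalars and the effect of one iteration on the iterates. -/

namespace State

variable {d : ℕ} {P : Params} {f : Vec d → ℝ} {solver : Mat d → Vec d → ℝ → Vec d} {s : State d}

/-- The interpolation weight `a/(A+a) = η/a`. -/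
noncomputable def theta (s : State d) : ℝ := s.η / s.a

section Scalars

theorem a_pos (hη : 0 < s.η) (hA : 0 ≤ s.A) : 0 < s.a := hη.trans_le (η_le_a hη.le hA)

theorem theta_pos (hη : 0 < s.η) (hA : 0 ≤ s.A) : 0 < s.theta := div_pos hη (a_pos hη hA)

theorem theta_le_one (hη : 0 < s.η) (hA : 0 ≤ s.A) : s.theta ≤ 1 :=
  (div_le_one (a_pos hη hA)).2 (η_le_a hη.le hA)

theorem theta_eq (hη : 0 < s.η) (hA : 0 ≤ s.A) : s.theta = s.a / (s.A + s.a) := by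
  have h := a_sq hη.le hA
  have ha := a_pos hη hA
  rw [theta, div_eq_div_iff (by positivity) (by positivity), ← h, sq]

theorem theta_le_sqrt (hη : 0 < s.η) (hA : 0 < s.A) : s.theta ≤ √s.η / √s.A := by
  have h := sqrt_le_a hη.le hA.le
  have ha := a_pos hη hA.le
  have h1 : √s.η * √s.η = s.η := Real.mul_self_sqrt hη.le
  have h2 := Real.sqrt_pos.2 hη
  have h3 := Real.sqrt_pos.2 hA
  rw [theta, div_le_div_iff₀ ha h3]
  calc s.η * √s.A = √s.η * (√s.η * √s.A) := by rw [← mul_assoc, h1]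
    _ ≤ _ := by gcongr; linarith

/-- A converse of `theta_le_sqrt` up to a constant. It lets √(η/A), which is easy to follow from one
iteration to the next, be charged to the logarithmic growth of A. -/
theorem sqrt_le_theta (hη : 0 < s.η) (hA : 0 < s.A) {b : ℝ} (hb : √s.η / √s.A ≤ b) :
    √s.η / √s.A ≤ (1 + b) * s.theta := by
  have ha := a_pos hη hA.le
  have h1 : √s.η * √s.η = s.η := Real.mul_self_sqrt hη.le
  have h1' : √s.A * √s.A = s.A := Real.mul_self_sqrt hA.le
  have h2 := Real.sqrt_pos.2 hη
  have h3 := Real.sqrt_pos.2 hA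
  have h4 : s.a ≤ s.η + √s.η * √s.A := by
    have : √(s.η ^ 2 + 4 * s.η * s.A) ≤ s.η + 2 * (√s.η * √s.A) := by
      refine Real.sqrt_le_iff.2 ⟨by positivity, ?_⟩
      have : (s.η + 2 * (√s.η * √s.A)) ^ 2 = s.η ^ 2 + 4 * s.η * (√s.η * √s.A)
        + 4 * (√s.η * √s.η) * (√s.A * √s.A) := by ring
      rw [this, h1, h1']
      have : 0 ≤ s.η * (√s.η * √s.A) := by positivity
      linarith
    rw [a]; linarith
  rw [theta, ← mul_div_assoc, le_div_iff₀ ha]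
  calc √s.η / √s.A * s.a ≤ √s.η / √s.A * (s.η + √s.η * √s.A) := by gcongr
    _ = √s.η / √s.A * s.η + s.η := by field_simp; linear_combination √s.A * h1
    _ ≤ b * s.η + s.η := by gcongr
    _ = _ := by ring

theorem theta_le_log (hη : 0 < s.η) (hA : 0 < s.A) :
    s.theta ≤ Real.log (s.A + s.a) - Real.log s.A := by
  have ha := a_pos hη hA.le
  have h := Real.log_le_sub_one_of_pos (show 0 < s.A / (s.A + s.a) by positivity)
  rw [Real.log_div (by positivity) (by positivity)] at h
  rw [theta_eq hη hA.le]
  have : s.a / (s.A + s.a) = 1 - s.A / (s.A + s.a) := by field_simp; ring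
  linarith

/-- The square of the left side is A + √(ηA) + η/4, while a ≥ η/2 + √(ηA). -/
theorem sqrt_add_le (hη : 0 < s.η) (hA : 0 ≤ s.A) : √s.A + √s.η / 2 ≤ √(s.A + s.a) := by
  have h := sqrt_le_a hη.le hA
  refine Real.le_sqrt_of_sq_le ?_
  have h1 : √s.η * √s.η = s.η := Real.mul_self_sqrt hη.le
  have h1' : √s.A * √s.A = s.A := Real.mul_self_sqrt hA
  nlinarith

theorem y_eq (hη : 0 < s.η) (hA : 0 ≤ s.A) : s.y = s.x + s.theta • (s.z - s.x) := by
  have ha := a_pos hη hA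
  rw [theta_eq hη hA, y]
  have : s.A / (s.A + s.a) = 1 - s.a / (s.A + s.a) := by field_simp; ring
  rw [this]
  module

theorem add_smul_y (hη : 0 < s.η) (hA : 0 ≤ s.A) :
    (s.A + s.a) • s.y = s.A • s.x + s.a • s.z := by
  have ha := a_pos hη hA
  have h : s.A + s.a ≠ 0 := by positivity
  rw [y, smul_add, smul_smul, smul_smul, mul_div_cancel₀ _ h, mul_div_cancel₀ _ h]

end Scalars

section Next

variable {E : Type*} {sep : Mat d → ℝ → ℝ → E → ℝ × Mat d} {e : E}

theorem ratio_eq_one (hs : 0 < s.η) (h : s.numBacktracks P f solver = 0) :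
    s.ratio P f solver = 1 := by
  rw [ratio, etaHat_eq_of_eq_zero h, div_self hs.ne']

/-- Accepting the initial step is the damped update with ratio 1, where the old x gets weight zero.
Hence A, z and x obey one formula in both branches, and the potential argument needs no case split.
-/
theorem next_A (hs : 0 < s.η) :
    (s.next P f solver sep e).A = s.A + s.ratio P f solver * s.a := by
  unfold next
  split_ifs with h
  · simp [ratio_eq_one hs h]
  · rfl

theorem next_z (hs : 0 < s.η) : (s.next P f solver sep e).z
    = s.z - (s.ratio P f solver * s.a) • gradient f (s.xHat P f solver) := by
  unfold next
  split_ifs with h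
  · simp [ratio_eq_one hs h]
  · rfl

theorem next_x (hs : 0 < s.η) (hA : 0 ≤ s.A) : (s.next P f solver sep e).x
    = ((1 - s.ratio P f solver) * s.A / (s.A + s.ratio P f solver * s.a)) • s.x
        + (s.ratio P f solver * (s.A + s.a) / (s.A + s.ratio P f solver * s.a)) •
          s.xHat P f solver := by
  unfold next
  split_ifs with h
  · have ha := a_pos hs hA
    rw [ratio_eq_one hs h, one_mul, one_mul, div_self (by positivity)]
    simp
  · rfl

theorem next_eta_zero (h : s.numBacktracks P f solver = 0) :
    (s.next P f solver sep e).η = s.η / P.β := by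
  simp [next, h, etaHat_eq_of_eq_zero h]

theorem next_eta_ne (h : s.numBacktracks P f solver ≠ 0) :
    (s.next P f solver sep e).η = s.etaHat P f solver := by
  simp [next, h]

theorem ratio_mul (hs : 0 < s.η) : s.ratio P f solver * s.η = s.etaHat P f solver :=
  div_mul_cancel₀ _ hs.ne'

theorem etaHat_le_ratio_mul_a (hP : P.Valid) (hs : 0 < s.η) (hA : 0 ≤ s.A) :
    s.etaHat P f solver ≤ s.ratio P f solver * s.a := by
  rw [← ratio_mul hs]
  exact mul_le_mul_of_nonneg_left (η_le_a hs.le hA) (ratio_pos hP hs).le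

theorem frobNorm_nextW_le : frobNorm (s.nextW P f solver) ≤ √d := by
  unfold nextW
  rw [frobNorm_eq_norm (_ • _), map_smul, frobNorm_eq_norm]
  exact norm_proj_le (Real.sqrt_nonneg _) _

theorem nextW_isSymm (hW : s.W.IsSymm) (hS : s.S.IsSymm) : (s.nextW P f solver).IsSymm := by
  have hG : (s.G P f solver).IsSymm := (lossGrad_isSymm _ _ _).smul _
  have hGt : (s.Gtilde P f solver).IsSymm := by
    unfold Gtilde; split_ifs
    · exact hG
    · exact hG.add (hS.smul _)
  exact (hW.sub (hGt.smul _)).smul _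

theorem Valid.next (hP : P.Valid) (hs : s.Valid) (hS : (s.next P f solver sep e).S.IsSymm)
    (hsep : s.numBacktracks P f solver ≠ 0 → SepCorrect (s.nextW P f solver) (delta (s.t + 1))
      (sep (s.nextW P f solver) (delta (s.t + 1)) (failProb P.p (s.t + 1)) e)) :
    (s.next P f solver sep e).Valid where
  η_pos := by
    by_cases h : s.numBacktracks P f solver = 0
    · rw [next_eta_zero h]; exact div_pos hs.η_pos hP.β_pos
    · rw [next_eta_ne h]; exact etaHat_pos hP hs.η_pos
  A_nonneg := by
    rw [next_A hs.η_pos]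
    exact add_nonneg hs.A_nonneg (mul_nonneg (ratio_pos hP hs.η_pos).le
      (a_pos hs.η_pos hs.A_nonneg).le)
  W_symm := by
    unfold State.next; split_ifs
    · exact hs.W_symm
    · exact nextW_isSymm hs.W_symm hs.S_symm
  S_symm := hS
  W_le := by
    unfold State.next; split_ifs
    · exact hs.W_le
    · exact frobNorm_nextW_le
  sep := by
    unfold State.next; split_ifs with h
    · exact hs.sep
    · exact hsep h

/-- The scaled displacement `(a/η) ‖x̂ - y‖`. -/
noncomputable def disp (P : Params) (f : Vec d → ℝ) (solver : Mat d → Vec d → ℝ → Vec d)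
    (s : State d) : ℝ := s.a / s.η * ‖s.xHat P f solver - s.y‖

theorem norm_xHat_sub (hη : 0 < s.η) (hA : 0 ≤ s.A) :
    ‖s.xHat P f solver - s.y‖ = s.theta * s.disp P f solver := by
  have ha := a_pos hη hA
  rw [theta, disp]; field_simp

theorem disp_nonneg (hη : 0 < s.η) (hA : 0 ≤ s.A) : 0 ≤ s.disp P f solver := by
  have ha := a_pos hη hA
  unfold disp; positivity

theorem norm_xHat_sub_le (hη : 0 < s.η) (hA : 0 ≤ s.A) :
    ‖s.xHat P f solver - s.y‖ ≤ s.disp P f solver := by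
  rw [norm_xHat_sub hη hA]
  exact mul_le_of_le_one_left (disp_nonneg hη hA) (theta_le_one hη hA)

/-- The decrease of the potential `A (f(x) - f(u)) + ‖z - u‖²/2` in one iteration. -/
theorem potential_step (hP : P.Valid) (hf : IsSmoothConvex f P.L₁)
    (hsol : IsLinearSolver solver) (hs : s.Valid) (u : Vec d) :
    (s.next P f solver sep e).A * (f (s.next P f solver sep e).x - f u)
      + ‖(s.next P f solver sep e).z - u‖ ^ 2 / 2
      + (1 - (P.α₁ + P.α₂) ^ 2) / 2 * s.disp P f solver ^ 2
    ≤ s.A * (f s.x - f u) + ‖s.z - u‖ ^ 2 / 2 := by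
  have hη := hs.η_pos
  have hA := hs.A_nonneg
  have ha := a_pos hη hA
  have hasq := a_sq hη.le hA
  have hγ := ratio_pos (f := f) (solver := solver) hP hη
  have hγ1 := ratio_le_one (f := f) (solver := solver) hP hη
  have hacc := accepted hP hf hsol hs
  have hrm := ratio_mul (P := P) (f := f) (solver := solver) hη
  have hy := add_smul_y hη hA
  rw [next_A hη, next_z hη, next_x hη hA, disp]
  set γ := s.ratio P f solver
  set xh := s.xHat P f solver
  set η' := s.etaHat P f solver
  set g := gradient f xh with hg
  set A' := s.A + γ * s.a with hA'
  have hA'pos : 0 < A' := by positivity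
  have hconv := hf.convex.2 (Set.mem_univ s.x) (Set.mem_univ xh)
    (show 0 ≤ (1 - γ) * s.A / A' from div_nonneg (mul_nonneg (by linarith) hA) hA'pos.le)
    (show 0 ≤ γ * (s.A + s.a) / A' by positivity)
    (by rw [← add_div, div_eq_one_iff_eq hA'pos.ne']; rw [hA']; ring)
  simp only [smul_eq_mul] at hconv
  have h1 : A' * f (((1 - γ) * s.A / A') • s.x + (γ * (s.A + s.a) / A') • xh)
      ≤ (1 - γ) * s.A * f s.x + γ * (s.A + s.a) * f xh := by
    calc _ ≤ A' * ((1 - γ) * s.A / A' * f s.x + γ * (s.A + s.a) / A' * f xh) := by gcongr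
      _ = _ := by field_simp
  have h2 := gradient_inequality hf xh s.x
  have h3 := gradient_inequality hf xh u
  have h4 : s.A * inner ℝ g (s.x - xh) + s.a * inner ℝ g (u - xh)
      = -((s.A + s.a) * inner ℝ g (xh - s.y) + s.a * inner ℝ g (s.z - u)) := by
    rw [← inner_smul_right, ← inner_smul_right, ← inner_smul_right, ← inner_smul_right,
      ← inner_add_right, ← inner_add_right, ← inner_neg_right]
    congr 1
    rw [smul_sub (s.A + s.a), hy]
    module
  have h5 : ‖s.z - (γ * s.a) • g - u‖ ^ 2
      = ‖s.z - u‖ ^ 2 - 2 * (γ * s.a) * inner ℝ g (s.z - u) + (γ * s.a) ^ 2 * ‖g‖ ^ 2 := by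
    rw [show s.z - (γ * s.a) • g - u = (s.z - u) - (γ * s.a) • g by abel, norm_sub_sq_real,
      inner_smul_right, norm_smul, mul_pow, Real.norm_eq_abs, sq_abs, real_inner_comm]
    ring
  have h6 : ‖xh - s.y‖ ^ 2 + 2 * η' * inner ℝ g (xh - s.y) + η' ^ 2 * ‖g‖ ^ 2
      ≤ (P.α₁ + P.α₂) ^ 2 * ‖xh - s.y‖ ^ 2 := by
    have h7 := pow_le_pow_left₀ (norm_nonneg _) hacc 2
    rw [norm_add_sq_real, inner_smul_right, norm_smul, mul_pow, mul_pow, Real.norm_eq_abs,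
      sq_abs, real_inner_comm] at h7
    linarith
  have h7 : γ * (s.A * (f xh - f s.x) + s.a * (f xh - f u))
      ≤ γ * ((s.A + s.a) * inner ℝ g (xh - s.y) + s.a * inner ℝ g (s.z - u)) := by
    rw [← hg] at h2 h3
    refine mul_le_mul_of_nonneg_left ?_ hγ.le
    have h8 := mul_le_mul_of_nonneg_left h2 hA
    have h9 := mul_le_mul_of_nonneg_left h3 ha.le
    linarith
  have h8 : (s.a / s.η * ‖xh - s.y‖) ^ 2 = (s.A + s.a) / s.η * ‖xh - s.y‖ ^ 2 := by
    rw [mul_pow, div_pow, hasq]; field_simp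
  -- The factor (A + a)/η equals a²/η². It turns the squared acceptance test into exactly the terms
  -- in ⟪g, x̂ - y⟫ and ‖g‖² left over from convexity and from the update of z.
  have h9 : (s.A + s.a) / s.η * (‖xh - s.y‖ ^ 2 + 2 * η' * inner ℝ g (xh - s.y)
      + η' ^ 2 * ‖g‖ ^ 2) ≤ (s.A + s.a) / s.η * ((P.α₁ + P.α₂) ^ 2 * ‖xh - s.y‖ ^ 2) := by
    gcongr
  have h10 : (s.A + s.a) / s.η * (2 * η' * inner ℝ g (xh - s.y) + η' ^ 2 * ‖g‖ ^ 2)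
      = 2 * γ * (s.A + s.a) * inner ℝ g (xh - s.y) + (γ * s.a) ^ 2 * ‖g‖ ^ 2 := by
    rw [← hrm, mul_pow γ s.a, hasq]; field_simp
  rw [h5, h8]
  have e1 : A' = s.A + γ * s.a := hA'
  have h11 : A' * f u = s.A * f u + γ * s.a * f u := by rw [e1]; ring
  rw [mul_sub A', h11]
  linarith

/-- A'(x' - u) = A(x - u) + γa(z - u) + γ(A + a)(x̂ - y), and (A + a)‖x̂ - y‖ is a times the scaled
displacement. The weight A makes the estimate insensitive to the arbitrary starting point x₀. -/
theorem A_mul_norm_next_x_sub_le (hP : P.Valid) (hs : s.Valid) (u : Vec d) :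
    (s.next P f solver sep e).A * ‖(s.next P f solver sep e).x - u‖
      ≤ s.A * ‖s.x - u‖ + s.ratio P f solver * s.a * (‖s.z - u‖ + s.disp P f solver) := by
  have hη := hs.η_pos
  have hA := hs.A_nonneg
  have ha := a_pos hη hA
  have hγ := ratio_pos (f := f) (solver := solver) hP hη
  have hγ1 := ratio_le_one (f := f) (solver := solver) hP hη
  have hy := add_smul_y hη hA
  have hθ : (s.A + s.a) * ‖s.xHat P f solver - s.y‖ = s.a * s.disp P f solver := by
    rw [norm_xHat_sub hη hA, theta_eq hη hA]; field_simp
  rw [next_A hη, next_x hη hA]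
  set γ := s.ratio P f solver
  set xh := s.xHat P f solver
  set A' := s.A + γ * s.a with hA'
  have hA'pos : 0 < A' := by positivity
  have e1 : A' • ((((1 - γ) * s.A / A') • s.x + (γ * (s.A + s.a) / A') • xh) - u)
      = s.A • (s.x - u) + (γ * s.a) • (s.z - u) + (γ * (s.A + s.a)) • (xh - s.y) := by
    have h1 : (γ * (s.A + s.a)) • s.y = γ • (s.A • s.x + s.a • s.z) := by
      rw [mul_smul, hy]
    rw [smul_sub, smul_add, smul_smul, smul_smul, mul_div_cancel₀ _ hA'pos.ne',
      mul_div_cancel₀ _ hA'pos.ne', smul_sub (γ * (s.A + s.a)), h1, hA']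
    module
  calc A' * ‖(((1 - γ) * s.A / A') • s.x + (γ * (s.A + s.a) / A') • xh) - u‖
      = ‖A' • ((((1 - γ) * s.A / A') • s.x + (γ * (s.A + s.a) / A') • xh) - u)‖ := by
        rw [norm_smul, Real.norm_of_nonneg hA'pos.le]
    _ ≤ ‖s.A • (s.x - u)‖ + ‖(γ * s.a) • (s.z - u)‖ + ‖(γ * (s.A + s.a)) • (xh - s.y)‖ := by
        rw [e1]; exact norm_add₃_le
    _ = s.A * ‖s.x - u‖ + γ * s.a * ‖s.z - u‖ + γ * ((s.A + s.a) * ‖xh - s.y‖) := by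
        rw [norm_smul, norm_smul, norm_smul, Real.norm_of_nonneg hA,
          Real.norm_of_nonneg (by positivity), Real.norm_of_nonneg (by positivity)]
        ring
    _ = _ := by rw [hθ]; ring

theorem norm_next_y_sub_le (hP : P.Valid) (hs : s.Valid) (hs' : (s.next P f solver sep e).Valid)
    {C : ℝ} (hC : 0 ≤ C) (hx : 0 < s.A → ‖s.x - s.z‖ ≤ C) :
    ‖(s.next P f solver sep e).y - s.y‖ ≤ s.theta * (C + 2 * s.disp P f solver)
      + (s.next P f solver sep e).theta *
        ‖(s.next P f solver sep e).x - (s.next P f solver sep e).z‖ := by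
  have hη := hs.η_pos
  have hA := hs.A_nonneg
  have ha := a_pos hη hA
  have hγ := ratio_pos (f := f) (solver := solver) hP hη
  have hγ1 := ratio_le_one (f := f) (solver := solver) hP hη
  have hθ := theta_pos hη hA
  have hθ' := theta_pos hs'.η_pos hs'.A_nonneg
  have hy := y_eq hη hA
  have hu := norm_xHat_sub (P := P) (f := f) (solver := solver) hη hA
  rw [y_eq hs'.η_pos hs'.A_nonneg]
  set x' := (s.next P f solver sep e).x with hx'
  set z' := (s.next P f solver sep e).z
  set θ' := (s.next P f solver sep e).theta
  rw [next_x hη hA] at hx'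
  set γ := s.ratio P f solver
  set xh := s.xHat P f solver
  set A' := s.A + γ * s.a with hA'
  have hA'pos : 0 < A' := by positivity
  set κ := (1 - γ) * s.A / A' with hκ
  have hκ0 : 0 ≤ κ := div_nonneg (mul_nonneg (by linarith) hA) hA'pos.le
  have hκ1 : κ ≤ 1 := by
    rw [hκ, div_le_one hA'pos, hA']
    nlinarith [mul_nonneg hγ.le hA, mul_nonneg hγ.le ha.le]
  have hκ2 : γ * (s.A + s.a) / A' = 1 - κ := by
    rw [hκ, eq_sub_iff_add_eq, ← add_div, div_eq_one_iff_eq hA'pos.ne', hA']; ring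
  rw [hκ2] at hx'
  -- The new x is the combination of x and x̂ with weights κ and 1 - κ, and y differs from x by θ(z
  -- - x). If A = 0, then κ = 0, so no bound on x - z is required there.
  have e1 : x' + θ' • (z' - x') - s.y
      = κ • (s.theta • (s.x - s.z)) + (1 - κ) • (xh - s.y) + θ' • (z' - x') := by
    rw [hx', hy]
    module
  have h1 : κ * (s.theta * ‖s.x - s.z‖) ≤ s.theta * C := by
    rcases eq_or_lt_of_le hA with h | h
    · rw [hκ, ← h]; simp; positivity
    · calc κ * (s.theta * ‖s.x - s.z‖) ≤ 1 * (s.theta * C) := by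
            gcongr
            exact hx h
        _ = _ := one_mul _
  rw [e1]
  calc _ ≤ ‖κ • (s.theta • (s.x - s.z))‖ + ‖(1 - κ) • (xh - s.y)‖ + ‖θ' • (z' - x')‖ :=
        norm_add₃_le
    _ = κ * (s.theta * ‖s.x - s.z‖) + (1 - κ) * ‖xh - s.y‖ + θ' * ‖x' - z'‖ := by
        rw [norm_smul, norm_smul, norm_smul, norm_smul, Real.norm_of_nonneg hκ0,
          Real.norm_of_nonneg hθ.le, Real.norm_of_nonneg hθ'.le,
          Real.norm_of_nonneg (by linarith), norm_sub_rev z']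
    _ ≤ s.theta * C + 2 * ‖xh - s.y‖ + θ' * ‖x' - z'‖ := by
        have := norm_nonneg (xh - s.y)
        have : (1 - κ) * ‖xh - s.y‖ ≤ 2 * ‖xh - s.y‖ := by gcongr; linarith
        linarith
    _ = _ := by rw [hu]; ring

end Next

end State

/-! ### The series behind the oracle parameters, and a power mean inequality. -/

section Series

/-- Discrete form of the antiderivative -1/log of 1/(x log² x); it makes the series telescope. -/
theorem one_div_mul_log_sq_le {n : ℝ} (hn : 3 ≤ n) :
    1 / (n * Real.log n ^ 2) ≤ 1 / Real.log (n - 1) - 1 / Real.log n := by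
  have h1 : 0 < Real.log (n - 1) := Real.log_pos (by linarith)
  have h2 : Real.log (n - 1) ≤ Real.log n := Real.log_le_log (by linarith) (by linarith)
  have h3 : 1 / n ≤ Real.log n - Real.log (n - 1) := by
    have h := Real.log_le_sub_one_of_pos (show 0 < (n - 1) / n from
      div_pos (by linarith) (by linarith))
    rw [Real.log_div (by linarith) (by linarith), sub_div, div_self (by linarith)] at h
    linarith
  have h4 : 0 < Real.log n := h1.trans_le h2
  have hn0 : 0 < n := by linarith
  calc 1 / (n * Real.log n ^ 2) = 1 / n / (Real.log n * Real.log n) := by field_simp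
    _ ≤ (Real.log n - Real.log (n - 1)) / (Real.log n * Real.log (n - 1)) := by gcongr
    _ = _ := by field_simp

theorem sum_one_div_mul_log_sq_le (n : ℕ) :
    ∑ i ∈ Finset.range n, 1 / (((i : ℝ) + 2) * Real.log ((i : ℝ) + 2) ^ 2) ≤ 2.5 := by
  have hl := Real.log_two_gt_d9
  have key : ∀ n : ℕ, ∑ i ∈ Finset.range (n + 1), 1 / (((i : ℝ) + 2) * Real.log ((i : ℝ) + 2) ^ 2)
      ≤ 2.5 - 1 / Real.log ((n : ℝ) + 2) := by
    intro n
    induction n with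
    | zero =>
      simp only [zero_add, Finset.sum_range_one, Nat.cast_zero]
      have : 1 / (2 * Real.log 2 ^ 2) + 1 / Real.log 2 = (1 / 2 + Real.log 2) / Real.log 2 ^ 2 := by
        field_simp
      -- The value (1/2 + log 2)/log² 2 is about 2.483, which the constant 2.5 accommodates.
      rw [le_sub_iff_add_le, this, div_le_iff₀ (by positivity)]
      nlinarith
    | succ n ih =>
      rw [Finset.sum_range_succ]
      have h := one_div_mul_log_sq_le (n := ((n + 1 : ℕ) : ℝ) + 2) (by push_cast; linarith)
      have e : ((n + 1 : ℕ) : ℝ) + 2 - 1 = n + 2 := by push_cast; ring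
      rw [e] at h
      linarith
  cases n with
  | zero => norm_num
  | succ n =>
    refine (key n).trans ?_
    have : 0 ≤ 1 / Real.log ((n : ℝ) + 2) := by
      have := Real.log_nonneg (x := (n : ℝ) + 2) (by linarith [n.cast_nonneg (α := ℝ)])
      positivity
    linarith

theorem delta_pos (t : ℕ) : 0 < delta t := by
  have : 0 < Real.log ((t : ℝ) + 2) := Real.log_pos (by linarith [t.cast_nonneg (α := ℝ)])
  unfold delta; positivity

theorem sum_delta_sq_le (n : ℕ) : ∑ i ∈ Finset.range n, delta i ^ 2 ≤ 2.5 := by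
  refine le_trans (le_of_eq (Finset.sum_congr rfl fun i _ => ?_)) (sum_one_div_mul_log_sq_le n)
  rw [delta, div_pow, mul_pow, Real.sq_sqrt (by positivity), one_pow]

/-- The power mean inequality between exponents `1/2` and `-2`. -/
theorem pow_five_le_sum (n : ℕ) {h : ℕ → ℝ} (hpos : ∀ i, 0 < h i) :
    (n : ℝ) ^ 5 ≤ (∑ i ∈ Finset.range n, √(h i)) ^ 4 * ∑ i ∈ Finset.range n, 1 / h i ^ 2 := by
  set r : ℕ → ℝ := fun i => √(h i) with hr
  have hr0 : ∀ i, 0 < r i := fun i => Real.sqrt_pos.2 (hpos i)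
  have hr4 : ∀ i, h i ^ 2 = r i ^ 4 := fun i => by
    rw [show r i ^ 4 = (r i ^ 2) ^ 2 by ring, Real.sq_sqrt (hpos i).le]
  simp only [hr4]
  set X := ∑ i ∈ Finset.range n, r i
  set Q := ∑ i ∈ Finset.range n, 1 / r i ^ 4
  have h1 : (n : ℝ) ^ 2 ≤ X * ∑ i ∈ Finset.range n, 1 / r i := by
    have := Finset.sum_sq_le_sum_mul_sum_of_sq_le_mul (Finset.range n) (r := fun _ => (1 : ℝ))
      (f := r) (g := fun i => 1 / r i) (fun i _ => (hr0 i).le)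
      (fun i _ => by have := hr0 i; positivity)
      (fun i _ => by have := hr0 i; field_simp; exact le_rfl)
    simpa using this
  have h2 : (∑ i ∈ Finset.range n, 1 / r i) ^ 2 ≤ n * ∑ i ∈ Finset.range n, (1 / r i) ^ 2 := by
    simpa using sq_sum_le_card_mul_sum_sq (s := Finset.range n) (f := fun i => 1 / r i)
  have h3 : (∑ i ∈ Finset.range n, (1 / r i) ^ 2) ^ 2 ≤ n * Q := by
    have := sq_sum_le_card_mul_sum_sq (s := Finset.range n) (f := fun i => (1 / r i) ^ 2)
    simp only [Finset.card_range, ← pow_mul] at this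
    simpa [Q] using this
  rcases Nat.eq_zero_or_pos n with rfl | hn
  · simp [Q]
  have hn' : (0 : ℝ) < n := by exact_mod_cast hn
  have hX : 0 ≤ X := Finset.sum_nonneg fun i _ => (hr0 i).le
  have hY : 0 ≤ ∑ i ∈ Finset.range n, 1 / r i :=
    Finset.sum_nonneg fun i _ => by have := hr0 i; positivity
  have hZ : 0 ≤ ∑ i ∈ Finset.range n, (1 / r i) ^ 2 := Finset.sum_nonneg fun i _ => by positivity
  -- Three applications of Cauchy–Schwarz, passing from Σ r to Σ r⁻¹, Σ r⁻² and Σ r⁻⁴, combine to n⁸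
  -- ≤ n³ X⁴ Q.
  have h4 : (n : ℝ) ^ 3 * (n : ℝ) ^ 5 ≤ (n : ℝ) ^ 3 * (X ^ 4 * Q) := by
    calc (n : ℝ) ^ 3 * (n : ℝ) ^ 5 = ((n : ℝ) ^ 2) ^ 4 := by ring
      _ ≤ (X * ∑ i ∈ Finset.range n, 1 / r i) ^ 4 := by gcongr
      _ = X ^ 4 * ((∑ i ∈ Finset.range n, 1 / r i) ^ 2) ^ 2 := by ring
      _ ≤ X ^ 4 * (n * ∑ i ∈ Finset.range n, (1 / r i) ^ 2) ^ 2 := by gcongr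
      _ = X ^ 4 * n ^ 2 * (∑ i ∈ Finset.range n, (1 / r i) ^ 2) ^ 2 := by ring
      _ ≤ X ^ 4 * n ^ 2 * (n * Q) := by gcongr
      _ = _ := by ring
  exact le_of_mul_le_mul_left h4 (by positivity)

end Series

/-! ### Consequences of the potential along a whole run. -/

/-- A run of the method along which all invariants hold. -/
structure ValidRun {d : ℕ} {E : Type*} (P : Params) (f : Vec d → ℝ)
    (solver : Mat d → Vec d → ℝ → Vec d) (sep : Mat d → ℝ → ℝ → E → ℝ × Mat d) (e : ℕ → E)
    (S : ℕ → State d) : Prop where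
  params : P.Valid
  smooth : IsSmoothConvex f P.L₁
  linearSolver : IsLinearSolver solver
  step : ∀ k, S (k + 1) = (S k).next P f solver sep (e k)
  valid : ∀ k, (S k).Valid
  A_zero : (S 0).A = 0
  η_zero : (S 0).η = P.σ₀

namespace ValidRun

open State

variable {d : ℕ} {E : Type*} {P : Params} {f : Vec d → ℝ}
    {solver : Mat d → Vec d → ℝ → Vec d} {sep : Mat d → ℝ → ℝ → E → ℝ × Mat d} {e : ℕ → E}
    {S : ℕ → State d}

section Potential

theorem η_pos (h : ValidRun P f solver sep e S) (k : ℕ) : 0 < (S k).η := (h.valid k).η_pos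

theorem A_nonneg (h : ValidRun P f solver sep e S) (k : ℕ) : 0 ≤ (S k).A := (h.valid k).A_nonneg

theorem etaHat_pos (h : ValidRun P f solver sep e S) (k : ℕ) : 0 < (S k).etaHat P f solver :=
  State.etaHat_pos h.params (h.η_pos k)

theorem A_succ (h : ValidRun P f solver sep e S) (k : ℕ) :
    (S (k + 1)).A = (S k).A + (S k).ratio P f solver * (S k).a := by
  rw [h.step, next_A (h.η_pos k)]

theorem etaHat_le_A_succ (h : ValidRun P f solver sep e S) (k : ℕ) :
    (S k).etaHat P f solver ≤ (S (k + 1)).A := by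
  rw [h.A_succ]
  have := etaHat_le_ratio_mul_a (f := f) (solver := solver) h.params (h.η_pos k) (h.A_nonneg k)
  linarith [h.A_nonneg k]

theorem A_pos (h : ValidRun P f solver sep e S) (k : ℕ) : 0 < (S (k + 1)).A :=
  (h.etaHat_pos k).trans_le (h.etaHat_le_A_succ k)

theorem A_le_succ (h : ValidRun P f solver sep e S) (k : ℕ) : (S k).A ≤ (S (k + 1)).A := by
  rw [h.A_succ]
  have := mul_nonneg (ratio_pos (f := f) (solver := solver) h.params (h.η_pos k)).le
    (a_pos (h.η_pos k) (h.A_nonneg k)).le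
  linarith

theorem A_one (h : ValidRun P f solver sep e S) : (S 1).A = (S 0).etaHat P f solver := by
  have h1 : (S 0).a = (S 0).η := by
    rw [a, h.A_zero, mul_zero, add_zero, Real.sqrt_sq (h.η_pos 0).le]
    ring
  rw [h.A_succ, h.A_zero, h1, ratio_mul (h.η_pos 0), zero_add]

theorem η_succ_le (h : ValidRun P f solver sep e S) (k : ℕ) :
    (S (k + 1)).η ≤ (S k).etaHat P f solver / P.β := by
  have hβ := h.params.β_pos
  rw [h.step]
  by_cases hb : (S k).numBacktracks P f solver = 0
  · rw [next_eta_zero hb, etaHat_eq_of_eq_zero hb]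
  · rw [next_eta_ne hb, le_div_iff₀ hβ]
    exact mul_le_of_le_one_right (h.etaHat_pos k).le h.params.β_lt.le

theorem potential_le (h : ValidRun P f solver sep e S) (u : Vec d) (k : ℕ) :
    (S k).A * (f (S k).x - f u) + ‖(S k).z - u‖ ^ 2 / 2
      + (1 - (P.α₁ + P.α₂) ^ 2) / 2 * ∑ j ∈ Finset.range k, (S j).disp P f solver ^ 2
    ≤ ‖(S 0).z - u‖ ^ 2 / 2 := by
  induction k with
  | zero => simp [h.A_zero]
  | succ k ih =>
    have h1 := potential_step (sep := sep) (e := e k) h.params h.smooth h.linearSolver (h.valid k) u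
    rw [← h.step] at h1
    rw [Finset.sum_range_succ, mul_add]
    linarith

theorem one_sub_sq_pos (hP : P.Valid) : 0 < 1 - (P.α₁ + P.α₂) ^ 2 := by
  have h1 := hP.α₁_pos
  have h2 := hP.α₂_pos
  have h3 := hP.add_lt
  nlinarith

theorem sub_le_div (h : ValidRun P f solver sep e S) (u : Vec d) (k : ℕ) :
    f (S (k + 1)).x - f u ≤ ‖(S 0).z - u‖ ^ 2 / (2 * (S (k + 1)).A) := by
  have h1 := h.potential_le u (k + 1)
  have h2 := one_sub_sq_pos h.params
  have h3 : 0 ≤ (1 - (P.α₁ + P.α₂) ^ 2) / 2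
      * ∑ j ∈ Finset.range (k + 1), (S j).disp P f solver ^ 2 :=
    mul_nonneg (by linarith) (Finset.sum_nonneg fun _ _ => sq_nonneg _)
  have h4 := h.A_pos k
  rw [le_div_iff₀ (by positivity)]
  nlinarith [sq_nonneg ‖(S (k + 1)).z - u‖]

variable {u : Vec d}

theorem sum_disp_sq_le (h : ValidRun P f solver sep e S) (hu : ∀ x, f u ≤ f x) (k : ℕ) :
    ∑ j ∈ Finset.range k, (S j).disp P f solver ^ 2
      ≤ 1 / (1 - (P.α₁ + P.α₂) ^ 2) * ‖(S 0).z - u‖ ^ 2 := by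
  have h1 := h.potential_le u k
  have h2 := one_sub_sq_pos h.params
  have h3 := mul_nonneg (h.A_nonneg k) (sub_nonneg.2 (hu (S k).x))
  rw [one_div, inv_mul_eq_div, le_div_iff₀ h2]
  nlinarith [sq_nonneg ‖(S k).z - u‖]

theorem norm_z_sub_le (h : ValidRun P f solver sep e S) (hu : ∀ x, f u ≤ f x) (k : ℕ) :
    ‖(S k).z - u‖ ≤ ‖(S 0).z - u‖ := by
  have h1 := h.potential_le u k
  have h2 := one_sub_sq_pos h.params
  have h3 := mul_nonneg (h.A_nonneg k) (sub_nonneg.2 (hu (S k).x))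
  have h4 : 0 ≤ (1 - (P.α₁ + P.α₂) ^ 2) / 2
      * ∑ j ∈ Finset.range k, (S j).disp P f solver ^ 2 :=
    mul_nonneg (by linarith) (Finset.sum_nonneg fun _ _ => sq_nonneg _)
  exact le_of_sq_le_sq (by linarith) (norm_nonneg _)

theorem one_le_inv_one_sub_sq (hP : P.Valid) : 1 ≤ 1 / (1 - (P.α₁ + P.α₂) ^ 2) := by
  rw [le_div_iff₀ (one_sub_sq_pos hP)]
  nlinarith [sq_nonneg (P.α₁ + P.α₂)]

theorem disp_le (h : ValidRun P f solver sep e S) (hu : ∀ x, f u ≤ f x) (k : ℕ) :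
    (S k).disp P f solver ≤ 1 / (1 - (P.α₁ + P.α₂) ^ 2) * ‖(S 0).z - u‖ := by
  have h1 := h.sum_disp_sq_le hu (k + 1)
  have h2 := one_le_inv_one_sub_sq h.params
  have h3 : (S k).disp P f solver ^ 2
      ≤ ∑ j ∈ Finset.range (k + 1), (S j).disp P f solver ^ 2 :=
    Finset.single_le_sum (f := fun j => (S j).disp P f solver ^ 2) (fun _ _ => sq_nonneg _)
      (Finset.mem_range.2 k.lt_succ_self)
  -- Square summability would give the root of the constant c = 1/(1 - (α₁ + α₂)²); since c ≥ 1, c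
  -- itself is also a bound.
  refine le_of_sq_le_sq ?_ (by positivity)
  rw [mul_pow]
  refine (h3.trans h1).trans ?_
  gcongr
  nlinarith

theorem norm_x_sub_le (h : ValidRun P f solver sep e S) (hu : ∀ x, f u ≤ f x) {k : ℕ}
    (hA : 0 < (S k).A) :
    ‖(S k).x - u‖ ≤ (1 + 1 / (1 - (P.α₁ + P.α₂) ^ 2)) * ‖(S 0).z - u‖ := by
  set C := (1 + 1 / (1 - (P.α₁ + P.α₂) ^ 2)) * ‖(S 0).z - u‖ with hC
  -- The induction runs on the weighted distance, for which k = 0 is trivial because A₀ = 0.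
  suffices key : ∀ k, (S k).A * ‖(S k).x - u‖ ≤ (S k).A * C from
    le_of_mul_le_mul_left (key k) hA
  intro k
  induction k with
  | zero => simp [h.A_zero]
  | succ k ih =>
    have h1 := A_mul_norm_next_x_sub_le (f := f) (solver := solver) (sep := sep) (e := e k)
      h.params (h.valid k) u
    rw [← h.step] at h1
    have h2 := h.norm_z_sub_le hu k
    have h3 := h.disp_le hu k
    have h4 := mul_nonneg (ratio_pos (f := f) (solver := solver) h.params (h.η_pos k)).le
      (a_pos (h.η_pos k) (h.A_nonneg k)).le
    have h5 : (S k).ratio P f solver * (S k).a * (‖(S k).z - u‖ + (S k).disp P f solver)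
        ≤ (S k).ratio P f solver * (S k).a * C := by
      refine mul_le_mul_of_nonneg_left ?_ h4
      rw [hC, add_mul, one_mul]
      linarith
    calc _ ≤ _ := h1
      _ ≤ (S k).A * C + (S k).ratio P f solver * (S k).a * C := add_le_add ih h5
      _ = _ := by rw [h.A_succ]; ring

theorem norm_x_sub_z_le (h : ValidRun P f solver sep e S) (hu : ∀ x, f u ≤ f x) {k : ℕ}
    (hA : 0 < (S k).A) :
    ‖(S k).x - (S k).z‖ ≤ (2 + 1 / (1 - (P.α₁ + P.α₂) ^ 2)) * ‖(S 0).z - u‖ := by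
  have h1 := h.norm_x_sub_le hu hA
  have h2 := h.norm_z_sub_le hu k
  have h3 : ‖(S k).x - (S k).z‖ ≤ ‖(S k).x - u‖ + ‖(S k).z - u‖ := by
    rw [show (S k).x - (S k).z = ((S k).x - u) - ((S k).z - u) by abel]
    exact norm_sub_le _ _
  linarith

end Potential

/-! ### Growth of A in terms of the accepted step sizes. -/

section Growth

theorem sqrt_etaHat_le (h : ValidRun P f solver sep e S) {k : ℕ}
    (hb : (S k).numBacktracks P f solver ≠ 0) :
    √((S k).etaHat P f solver) ≤ √P.β * √(S k).η := by
  rw [← Real.sqrt_mul h.params.β_pos.le]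
  exact Real.sqrt_le_sqrt (etaHat_le_beta_mul h.params (h.η_pos k) hb)

theorem sqrt_beta_lt_one (hP : P.Valid) : √P.β < 1 := by
  rw [Real.sqrt_lt' one_pos, one_pow]
  exact hP.β_lt

/-- The term √β/4 · √η is a reserve. When the initial step is accepted, √A gains √η/2, enough for
the new summand and for the reserve to grow. When the step is cut, √A need not gain at all, but the
reserve falls by enough to pay for the summand √η̂. -/
theorem sqrt_A_ge (h : ValidRun P f solver sep e S) (k : ℕ) :
    (1 - √P.β) / 4 * ∑ j ∈ Finset.range (k + 1), √((S j).etaHat P f solver)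
      + √P.β / 4 * √(S (k + 1)).η ≤ √(S (k + 1)).A := by
  have hb0 : 0 < √P.β := Real.sqrt_pos.2 h.params.β_pos
  have hb1 := sqrt_beta_lt_one h.params
  induction k with
  | zero =>
    simp only [zero_add, Finset.sum_range_one, h.A_one]
    have h1 := Real.sqrt_le_sqrt (h.η_succ_le 0)
    rw [Real.sqrt_div' _ h.params.β_pos.le, le_div_iff₀ hb0] at h1
    have h2 := Real.sqrt_nonneg ((S 0).etaHat P f solver)
    simp only [zero_add] at h1
    nlinarith
  | succ k ih =>
    rw [Finset.sum_range_succ, mul_add]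
    have hη := h.η_pos (k + 1)
    have hA := h.A_nonneg (k + 1)
    by_cases hb : (S (k + 1)).numBacktracks P f solver = 0
    · have h1 := h.A_succ (k + 1)
      rw [ratio_eq_one hη hb, one_mul] at h1
      have h2 := sqrt_add_le hη hA
      rw [← h1] at h2
      have h3 : (S (k + 1 + 1)).η = (S (k + 1)).η / P.β := by
        rw [h.step, next_eta_zero hb]
      have h4 : √P.β * √(S (k + 1 + 1)).η = √(S (k + 1)).η := by
        rw [h3, Real.sqrt_div' _ h.params.β_pos.le]; field_simp
      rw [etaHat_eq_of_eq_zero hb]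
      nlinarith [Real.sqrt_nonneg (S (k + 1)).η]
    · have h1 := Real.sqrt_le_sqrt (h.A_le_succ (k + 1))
      have h2 := h.sqrt_etaHat_le hb
      have h3 : (S (k + 1 + 1)).η = (S (k + 1)).etaHat P f solver := by
        rw [h.step, next_eta_ne hb]
      rw [h3]
      linarith

/-- The lower bound `N^5 ≤ C A_N² ∑ η̂_k⁻²`. -/
theorem pow_five_le (h : ValidRun P f solver sep e S) (k : ℕ) :
    ((1 - √P.β) / 4) ^ 4 * ((k + 1 : ℕ) : ℝ) ^ 5 ≤ (S (k + 1)).A ^ 2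
      * ∑ j ∈ Finset.range (k + 1), 1 / (S j).etaHat P f solver ^ 2 := by
  have h1 := pow_five_le_sum (k + 1) h.etaHat_pos
  have h2 := h.sqrt_A_ge k
  have hb1 := sqrt_beta_lt_one h.params
  have hX : 0 ≤ ∑ j ∈ Finset.range (k + 1), √((S j).etaHat P f solver) :=
    Finset.sum_nonneg fun _ _ => Real.sqrt_nonneg _
  have hQ : 0 ≤ ∑ j ∈ Finset.range (k + 1), 1 / (S j).etaHat P f solver ^ 2 :=
    Finset.sum_nonneg fun _ _ => by positivity
  set X := ∑ j ∈ Finset.range (k + 1), √((S j).etaHat P f solver)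
  set Q := ∑ j ∈ Finset.range (k + 1), 1 / (S j).etaHat P f solver ^ 2
  have hc : 0 ≤ (1 - √P.β) / 4 := by linarith
  have h3 : (1 - √P.β) / 4 * X ≤ √(S (k + 1)).A := by
    have : 0 ≤ √P.β / 4 * √(S (k + 1)).η := by positivity
    linarith
  have h4 : √(S (k + 1)).A ^ 4 = (S (k + 1)).A ^ 2 := by
    rw [show √(S (k + 1)).A ^ 4 = (√(S (k + 1)).A ^ 2) ^ 2 by ring,
      Real.sq_sqrt (h.A_nonneg _)]
  calc _ ≤ ((1 - √P.β) / 4) ^ 4 * (X ^ 4 * Q) := by gcongr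
    _ = ((1 - √P.β) / 4 * X) ^ 4 * Q := by ring
    _ ≤ √(S (k + 1)).A ^ 4 * Q := by gcongr
    _ = _ := by rw [h4]

open Classical in
/-- The sum of the squared inverse step sizes is controlled by the backtracking iterations. -/
theorem sum_inv_sq_le (h : ValidRun P f solver sep e S) (k : ℕ) :
    ∑ j ∈ Finset.range k, 1 / (S j).etaHat P f solver ^ 2
      ≤ 1 / (1 - P.β ^ 2) / P.σ₀ ^ 2 + (1 + 1 / (1 - P.β ^ 2)) * ∑ j ∈ Finset.range k,
        if (S j).numBacktracks P f solver = 0 then 0 else 1 / (S j).etaHat P f solver ^ 2 := by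
  have hβ := h.params.β_pos
  have hβ1 : 0 < 1 - P.β ^ 2 := by nlinarith [h.params.β_lt]
  set κ := 1 / (1 - P.β ^ 2) with hκ
  have hκ0 : 0 < κ := by positivity
  -- The term κ/η² is a potential: accepting the initial step multiplies η by 1/β and lowers κ/η² by
  -- exactly 1/η̂². A backtracking iteration resets it to κ/η̂², whence the factor 1 + κ.
  have key : ∑ j ∈ Finset.range k, 1 / (S j).etaHat P f solver ^ 2 + κ * (1 / (S k).η ^ 2)
      ≤ κ / P.σ₀ ^ 2 + (1 + κ) * ∑ j ∈ Finset.range k,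
        if (S j).numBacktracks P f solver = 0 then 0 else 1 / (S j).etaHat P f solver ^ 2 := by
    induction k with
    | zero => simp [h.η_zero, div_eq_mul_inv]
    | succ k ih =>
      rw [Finset.sum_range_succ, Finset.sum_range_succ]
      have hη := h.η_pos k
      split_ifs with hb
      · have h3 : (S (k + 1)).η = (S k).η / P.β := by rw [h.step, next_eta_zero hb]
        have h4 : κ * (1 / (S (k + 1)).η ^ 2) = κ * (1 / (S k).η ^ 2) - 1 / (S k).η ^ 2 := by
          rw [h3, hκ]; field_simp; ring
        rw [etaHat_eq_of_eq_zero hb, h4]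
        linarith
      · have h3 : (S (k + 1)).η = (S k).etaHat P f solver := by rw [h.step, next_eta_ne hb]
        rw [h3]
        have : 0 ≤ κ * (1 / (S k).η ^ 2) := by positivity
        linarith
  have : 0 ≤ κ * (1 / (S k).η ^ 2) := by positivity
  linarith

end Growth

/-! ### Path length of the points where gradients are linearized. -/

section Path

/-- The weights `θ_k` are summable up to a logarithm of the growth of `A`. -/
theorem sum_theta_le (h : ValidRun P f solver sep e S) (k : ℕ) :
    ∑ j ∈ Finset.range k, (S (j + 1)).theta ≤ 1 / (1 - √P.β) / √P.β
      + (1 + 1 / (1 - √P.β) / √P.β) * (1 + 1 / √P.β)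
        * (Real.log (S (k + 1)).A - Real.log (S 1).A) := by
  have hb0 : 0 < √P.β := Real.sqrt_pos.2 h.params.β_pos
  have hb1 : 0 < 1 - √P.β := by linarith [sqrt_beta_lt_one h.params]
  set κ := 1 / (1 - √P.β) with hκ
  have hκ0 : 0 < κ := by positivity
  have hκ1 : κ * (1 - √P.β) = 1 := by rw [hκ]; field_simp
  -- The next η exceeds η̂ by at most 1/β, and A has just reached at least η̂.
  have hτ : ∀ k, √(S (k + 1)).η / √(S (k + 1)).A ≤ 1 / √P.β := by
    intro k
    rw [div_le_div_iff₀ (Real.sqrt_pos.2 (h.A_pos k)) hb0, one_mul,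
      ← Real.sqrt_mul (h.η_pos _).le]
    refine Real.sqrt_le_sqrt ?_
    rw [← le_div_iff₀ h.params.β_pos]
    refine (h.η_succ_le k).trans ?_
    have := h.params.β_pos
    gcongr
    exact h.etaHat_le_A_succ k
  -- With τ = √(η/A), κτ is a potential. Backtracking shrinks τ by √β, and the drop κ(1 - √β)τ = τ
  -- pays for θ ≤ τ. Otherwise τ grows by at most 1/√β, and both τ and θ are bounded by the increase
  -- of log A.
  have key : ∑ j ∈ Finset.range k, (S (j + 1)).theta
      + κ * (√(S (k + 1)).η / √(S (k + 1)).A) ≤ κ / √P.β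
      + (1 + κ / √P.β) * (1 + 1 / √P.β) * (Real.log (S (k + 1)).A - Real.log (S 1).A) := by
    induction k with
    | zero =>
      simp only [Finset.range_zero, Finset.sum_empty, zero_add, sub_self, mul_zero, add_zero]
      rw [div_eq_mul_one_div κ]
      have := hτ 0
      gcongr
    | succ k ih =>
      rw [Finset.sum_range_succ]
      have hη := h.η_pos (k + 1)
      have hA := h.A_pos k
      have hA' := h.A_pos (k + 1)
      have hτ0 : 0 ≤ √(S (k + 1)).η / √(S (k + 1)).A := by positivity
      have h1 := theta_le_sqrt hη hA
      have hsA := Real.sqrt_le_sqrt (h.A_le_succ (k + 1))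
      have hsA0 := Real.sqrt_pos.2 hA
      by_cases hb : (S (k + 1)).numBacktracks P f solver = 0
      · have h2 := h.A_succ (k + 1)
        rw [ratio_eq_one hη hb, one_mul] at h2
        have h3 : (S (k + 1 + 1)).η = (S (k + 1)).η / P.β := by
          rw [h.step, next_eta_zero hb]
        have h4 := theta_le_log hη hA
        rw [← h2] at h4
        have h5 := sqrt_le_theta hη hA (hτ k)
        have h6 : √(S (k + 1 + 1)).η / √(S (k + 1 + 1)).A
            ≤ √(S (k + 1)).η / √(S (k + 1)).A / √P.β := by
          rw [h3, Real.sqrt_div' _ h.params.β_pos.le, div_right_comm]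
          gcongr
        have h7 : κ * (√(S (k + 1 + 1)).η / √(S (k + 1 + 1)).A)
            ≤ κ / √P.β * (√(S (k + 1)).η / √(S (k + 1)).A) := by
          calc _ ≤ κ * (√(S (k + 1)).η / √(S (k + 1)).A / √P.β) := by gcongr
            _ = _ := by ring
        have h8 : (1 + κ / √P.β) * (√(S (k + 1)).η / √(S (k + 1)).A)
            ≤ (1 + κ / √P.β) * ((1 + 1 / √P.β) *
              (Real.log (S (k + 1 + 1)).A - Real.log (S (k + 1)).A)) := by
          gcongr
          refine h5.trans ?_
          gcongr
        have h9 := mul_nonneg hκ0.le hτ0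
        linarith
      · have h3 : (S (k + 1 + 1)).η = (S (k + 1)).etaHat P f solver := by
          rw [h.step, next_eta_ne hb]
        have h2 := h.sqrt_etaHat_le hb
        have h6 : √(S (k + 1 + 1)).η / √(S (k + 1 + 1)).A
            ≤ √P.β * (√(S (k + 1)).η / √(S (k + 1)).A) := by
          rw [h3, ← mul_div_assoc]
          gcongr
        have h7 : κ * (√(S (k + 1 + 1)).η / √(S (k + 1 + 1)).A)
            ≤ κ * (√P.β * (√(S (k + 1)).η / √(S (k + 1)).A)) := by gcongr
        have h8 : κ * (√P.β * (√(S (k + 1)).η / √(S (k + 1)).A))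
            = κ * (√(S (k + 1)).η / √(S (k + 1)).A) - √(S (k + 1)).η / √(S (k + 1)).A := by
          linear_combination (-(√(S (k + 1)).η / √(S (k + 1)).A)) * hκ1
        have h9 : 0 ≤ (1 + κ / √P.β) * (1 + 1 / √P.β) *
            (Real.log (S (k + 1 + 1)).A - Real.log (S (k + 1)).A) := by
          have := Real.log_le_log hA (h.A_le_succ (k + 1))
          have : 0 ≤ Real.log (S (k + 1 + 1)).A - Real.log (S (k + 1)).A := by linarith
          positivity
        linarith
  have hτ0 : 0 ≤ κ * (√(S (k + 1)).η / √(S (k + 1)).A) := by positivity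
  linarith

variable {u : Vec d}

/-- The move from y_j to y_{j+1} costs a multiple of D for each of θ_j and θ_{j+1}, as x - z and the
scaled displacements are bounded by multiples of D. The summand 1 covers θ₀ ≤ 1, which has no
logarithmic bound because A₀ = 0. -/
theorem sum_norm_y_sub_le (h : ValidRun P f solver sep e S) (hu : ∀ x, f u ≤ f x) (k : ℕ) :
    ∑ j ∈ Finset.range k, ‖(S (j + 1)).y - (S j).y‖
      ≤ (4 + 4 / (1 - (P.α₁ + P.α₂) ^ 2)) * ‖(S 0).z - u‖ *
        (1 + ∑ j ∈ Finset.range k, (S (j + 1)).theta) := by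
  have hc := one_sub_sq_pos h.params
  set c := 1 / (1 - (P.α₁ + P.α₂) ^ 2) with hcdef
  have hc0 : 0 < c := by positivity
  have hc4 : 4 / (1 - (P.α₁ + P.α₂) ^ 2) = 4 * c := by rw [hcdef]; ring
  set D := ‖(S 0).z - u‖ with hD
  have hD0 : 0 ≤ D := norm_nonneg _
  have hθ : ∀ j, 0 < (S j).theta := fun j => theta_pos (h.η_pos j) (h.A_nonneg j)
  have h1 : ∀ j, ‖(S (j + 1)).y - (S j).y‖
      ≤ (S j).theta * ((2 + 3 * c) * D) + (S (j + 1)).theta * ((2 + c) * D) := by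
    intro j
    have h2 := norm_next_y_sub_le (f := f) (solver := solver) (sep := sep) (e := e j)
      h.params (h.valid j) (by rw [← h.step]; exact h.valid _) (C := (2 + c) * D)
      (by positivity) (fun hA => h.norm_x_sub_z_le hu hA)
    rw [← h.step] at h2
    refine h2.trans (add_le_add ?_ ?_)
    · refine mul_le_mul_of_nonneg_left ?_ (hθ j).le
      have := h.disp_le hu j
      linarith
    · exact mul_le_mul_of_nonneg_left (h.norm_x_sub_z_le hu (h.A_pos j)) (hθ _).le
  have h3 : ∑ j ∈ Finset.range k, (S j).theta ≤ 1 + ∑ j ∈ Finset.range k, (S (j + 1)).theta := by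
    have h4 := Finset.sum_range_succ' (fun j => (S j).theta) k
    rw [Finset.sum_range_succ] at h4
    have h5 := theta_le_one (h.η_pos 0) (h.A_nonneg 0)
    have h6 := (hθ k).le
    linarith
  have hT : 0 ≤ ∑ j ∈ Finset.range k, (S (j + 1)).theta := Finset.sum_nonneg fun j _ => (hθ _).le
  rw [hc4]
  calc _ ≤ ∑ j ∈ Finset.range k,
        ((S j).theta * ((2 + 3 * c) * D) + (S (j + 1)).theta * ((2 + c) * D)) :=
        Finset.sum_le_sum fun j _ => h1 j
    _ = (∑ j ∈ Finset.range k, (S j).theta) * ((2 + 3 * c) * D)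
        + (∑ j ∈ Finset.range k, (S (j + 1)).theta) * ((2 + c) * D) := by
        rw [Finset.sum_add_distrib, Finset.sum_mul, Finset.sum_mul]
    _ ≤ (1 + ∑ j ∈ Finset.range k, (S (j + 1)).theta) * ((2 + 3 * c) * D)
        + (1 + ∑ j ∈ Finset.range k, (S (j + 1)).theta) * ((2 + c) * D) := by
        gcongr
        linarith
    _ = _ := by ring

end Path

end ValidRun

/-! ### Regret of the learner against the drifting Hessian. -/

namespace State

variable {d : ℕ} {P : Params} {f : Vec d → ℝ} {solver : Mat d → Vec d → ℝ → Vec d} {s : State d}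

/-- The loss suffered by the online learner in a backtracking iteration. -/
noncomputable def stepLoss (P : Params) (f : Vec d → ℝ) (solver : Mat d → Vec d → ℝ → Vec d)
    (s : State d) : ℝ :=
  loss (s.xTilde P f solver - s.y) (gradient f (s.xTilde P f solver) - gradient f s.y) (s.B P)

/-- The Frobenius distance from `W` to the normalized Hessian at `v`. -/
noncomputable def hessDist (P : Params) (f : Vec d → ℝ) (W : Mat d) (v : Vec d) : ℝ :=
  frobNorm (W - normalized P.L₁ (hessMat f v))

theorem stepLoss_le (hP : P.Valid) (hf : IsSmoothConvex f P.L₁) (hs : s.Valid) :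
    s.stepLoss P f solver ≤ (2 * P.L₁) ^ 2 :=
  loss_smoothed_le hP.L₁_pos hf _ _ hs.norm_Bhat_le

theorem stepLoss_online {L₂ : ℝ} (hP : P.Valid) (hf : IsSmoothConvex f P.L₁) (hL₂ : 0 ≤ L₂)
    (hf2 : HasLipschitzHessian f L₂) (hsol : IsLinearSolver solver) (hs : s.Valid)
    (h : s.numBacktracks P f solver ≠ 0) :
    s.stepLoss P f solver / 2 ≤ L₂ ^ 2 * ((1 + P.α₁) / (P.β * (1 - P.α₁))) ^ 2
        * s.disp P f solver ^ 2 + P.L₁ ^ 2 * delta s.t ^ 2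
      + 16 * P.L₁ ^ 2 * (hessDist P f s.W s.y ^ 2 - hessDist P f (s.nextW P f solver) s.y ^ 2) := by
  have h1 := online_step hP.L₁_pos (delta_pos s.t).le (G := s.G P f solver)
    (Gt := s.Gtilde P f solver) (s := s.xTilde P f solver - s.y)
    (w := gradient f (s.xTilde P f solver) - gradient f s.y) hs.W_symm
    (hessMat_isSymm hf s.y) (norm_normalized_hessMat_le hP.L₁_pos hf s.y) hs.sep
    (Bh := s.Bhat) rfl rfl rfl
  have h2 := loss_hessMat_le hf hL₂ hf2 s.y (s.xTilde P f solver)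
  have h3 := norm_xTilde_sub_le (f := f) hP hsol hs h
  have h4 := norm_xHat_sub_le (P := P) (f := f) (solver := solver) hs.η_pos hs.A_nonneg
  have h5 : 0 ≤ (1 + P.α₁) / (P.β * (1 - P.α₁)) := by
    have := hP.α₁_pos
    have := hP.β_pos
    have : 0 < 1 - P.α₁ := by linarith [hP.add_lt, hP.α₂_pos]
    positivity
  have h6 : L₂ ^ 2 * ‖s.xTilde P f solver - s.y‖ ^ 2
      ≤ L₂ ^ 2 * ((1 + P.α₁) / (P.β * (1 - P.α₁))) ^ 2 * s.disp P f solver ^ 2 := by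
    rw [mul_assoc, ← mul_pow ((1 + P.α₁) / (P.β * (1 - P.α₁)))]
    have h7 := h3.trans (mul_le_mul_of_nonneg_left h4 h5)
    exact mul_le_mul_of_nonneg_left (pow_le_pow_left₀ (norm_nonneg _) h7 2) (sq_nonneg _)
  exact h1.trans (add_le_add (add_le_add (h2.trans h6) le_rfl) le_rfl)

/-- Changing the comparator costs 4d times the normalized change of Hessian (2/L₁)L₂‖v - u‖; the
weight 16L₁² makes this 128 L₁L₂d‖v - u‖. -/
theorem hessDist_sq_le {L₂ : ℝ} (hP : P.Valid) (hf : IsSmoothConvex f P.L₁)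
    (hf2 : HasLipschitzHessian f L₂) {W : Mat d} (hW : frobNorm W ≤ √d) (u v : Vec d) :
    16 * P.L₁ ^ 2 * hessDist P f W v ^ 2
      ≤ 16 * P.L₁ ^ 2 * hessDist P f W u ^ 2 + 128 * P.L₁ * L₂ * d * ‖v - u‖ := by
  have hL := hP.L₁_pos
  have h1 := frobNorm_sub_sq_le hW (norm_normalized_hessMat_le hL hf u)
    (norm_normalized_hessMat_le hL hf v)
  have h2 := norm_normalized_hessMat_sub_le hL hf2 v u
  unfold hessDist
  calc _ ≤ 16 * P.L₁ ^ 2 * (frobNorm (W - normalized P.L₁ (hessMat f u)) ^ 2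
        + 4 * d * (2 / P.L₁ * (L₂ * ‖v - u‖))) := by
        gcongr
        refine h1.trans ?_
        gcongr
    _ = _ := by field_simp; ring

end State

namespace ValidRun

open State

variable {d : ℕ} {E : Type*} {P : Params} {f : Vec d → ℝ}
    {solver : Mat d → Vec d → ℝ → Vec d} {sep : Mat d → ℝ → ℝ → E → ℝ × Mat d} {e : ℕ → E}
    {S : ℕ → State d}

open Classical in
/-- The loss of iteration `k`, counted only if the iteration backtracks. -/
noncomputable def countedLoss (P : Params) (f : Vec d → ℝ) (solver : Mat d → Vec d → ℝ → Vec d)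
    (s : State d) : ℝ :=
  if s.numBacktracks P f solver = 0 then 0 else s.stepLoss P f solver

/-- One iteration of the online learner, before the comparator moves. -/
theorem countedLoss_online {L₂ : ℝ} (h : ValidRun P f solver sep e S) (hL₂ : 0 ≤ L₂)
    (hf2 : HasLipschitzHessian f L₂) (k : ℕ) :
    countedLoss P f solver (S k) / 2 + 16 * P.L₁ ^ 2 * hessDist P f (S (k + 1)).W (S k).y ^ 2
      + P.L₁ ^ 2 * ∑ i ∈ Finset.range (S k).t, delta i ^ 2
    ≤ L₂ ^ 2 * ((1 + P.α₁) / (P.β * (1 - P.α₁))) ^ 2 * (S k).disp P f solver ^ 2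
      + 16 * P.L₁ ^ 2 * hessDist P f (S k).W (S k).y ^ 2
      + P.L₁ ^ 2 * ∑ i ∈ Finset.range (S (k + 1)).t, delta i ^ 2 := by
  unfold countedLoss
  rw [h.step]
  split_ifs with hb
  · have h1 : ((S k).next P f solver sep (e k)).W = (S k).W := by simp [next, hb]
    have h2 : ((S k).next P f solver sep (e k)).t = (S k).t := by simp [next, hb]
    rw [h1, h2]
    have : 0 ≤ L₂ ^ 2 * ((1 + P.α₁) / (P.β * (1 - P.α₁))) ^ 2 * (S k).disp P f solver ^ 2 := by
      positivity
    linarith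
  · have h1 : ((S k).next P f solver sep (e k)).W = (S k).nextW P f solver := by simp [next, hb]
    have h2 : ((S k).next P f solver sep (e k)).t = (S k).t + 1 := by simp [next, hb]
    rw [h1, h2, Finset.sum_range_succ]
    have := stepLoss_online h.params h.smooth hL₂ hf2 h.linearSolver (h.valid k) hb
    linarith

/-- Each iteration is a learning step against the Hessian at y_k followed by a move of the
comparator to y_{k+1}. The oracle errors are summed over rounds, which advance only in backtracking
iterations. -/
theorem sum_countedLoss_aux {L₂ : ℝ} (h : ValidRun P f solver sep e S) (hL₂ : 0 ≤ L₂)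
    (hf2 : HasLipschitzHessian f L₂) (k : ℕ) :
    (∑ j ∈ Finset.range k, countedLoss P f solver (S j)) / 2
      + 16 * P.L₁ ^ 2 * hessDist P f (S k).W (S k).y ^ 2
    ≤ L₂ ^ 2 * ((1 + P.α₁) / (P.β * (1 - P.α₁))) ^ 2
        * ∑ j ∈ Finset.range k, (S j).disp P f solver ^ 2
      + 16 * P.L₁ ^ 2 * hessDist P f (S 0).W (S 0).y ^ 2
      + P.L₁ ^ 2 * ∑ i ∈ Finset.range (S k).t, delta i ^ 2
      + 128 * P.L₁ * L₂ * d * ∑ j ∈ Finset.range k, ‖(S (j + 1)).y - (S j).y‖ := by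
  induction k with
  | zero =>
    have : 0 ≤ P.L₁ ^ 2 * ∑ i ∈ Finset.range (S 0).t, delta i ^ 2 := by positivity
    simp only [Finset.range_zero, Finset.sum_empty]
    linarith
  | succ k ih =>
    have h1 := h.countedLoss_online hL₂ hf2 k
    have h2 := hessDist_sq_le h.params h.smooth hf2 (h.valid (k + 1)).W_le (S k).y (S (k + 1)).y
    rw [Finset.sum_range_succ, Finset.sum_range_succ, Finset.sum_range_succ]
    linarith

/-- The regret bound: the total loss is bounded by the total loss of the Hessians, the initial
error and the path length. -/
theorem sum_countedLoss_le {L₂ : ℝ} (h : ValidRun P f solver sep e S) (hL₂ : 0 ≤ L₂)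
    (hf2 : HasLipschitzHessian f L₂) {B₀ : Mat d} (hW : (S 0).W = normalized P.L₁ B₀)
    {u : Vec d} (hu : ∀ x, f u ≤ f x) (k : ℕ) :
    ∑ j ∈ Finset.range (k + 1), countedLoss P f solver (S j)
    ≤ 2 * ((1 + P.α₁) / (P.β * (1 - P.α₁))) ^ 2 / (1 - (P.α₁ + P.α₂) ^ 2) * L₂ ^ 2
        * ‖(S 0).z - u‖ ^ 2
      + 128 * frobNorm (B₀ - hessMat f (S 0).z) ^ 2 + 5 * P.L₁ ^ 2
      + 256 * P.L₁ * L₂ * d * ∑ j ∈ Finset.range k, ‖(S (j + 1)).y - (S j).y‖ := by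
  have hL := h.params.L₁_pos
  -- The last iteration is added without moving the comparator, so k + 1 losses cost only k moves.
  -- This keeps the path bound in terms of A_{k+1}, the quantity in the gap estimate.
  have h1 := h.countedLoss_online hL₂ hf2 k
  have h2 := h.sum_countedLoss_aux hL₂ hf2 k
  have h3 := h.sum_disp_sq_le hu (k + 1)
  have h4 := mul_le_mul_of_nonneg_left (sum_delta_sq_le (S (k + 1)).t) (sq_nonneg P.L₁)
  have h5 : (S 0).y = (S 0).z := by
    have ha := a_pos (h.η_pos 0) (h.A_nonneg 0)
    rw [y, h.A_zero, zero_add, zero_div, zero_smul, zero_add, div_self ha.ne', one_smul]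
  have h6 : 16 * P.L₁ ^ 2 * hessDist P f (S 0).W (S 0).y ^ 2
      = 64 * frobNorm (B₀ - hessMat f (S 0).z) ^ 2 := by
    rw [hessDist, hW, h5, normalized_sub, frobNorm_eq_norm, map_smul, norm_smul, mul_pow,
      ← frobNorm_eq_norm, Real.norm_of_nonneg (by positivity)]
    field_simp
    ring
  have h7 : 0 ≤ 16 * P.L₁ ^ 2 * hessDist P f (S (k + 1)).W (S k).y ^ 2 := by positivity
  have h8 : L₂ ^ 2 * ((1 + P.α₁) / (P.β * (1 - P.α₁))) ^ 2
        * ∑ j ∈ Finset.range (k + 1), (S j).disp P f solver ^ 2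
      ≤ L₂ ^ 2 * ((1 + P.α₁) / (P.β * (1 - P.α₁))) ^ 2
        * (1 / (1 - (P.α₁ + P.α₂) ^ 2) * ‖(S 0).z - u‖ ^ 2) := by gcongr
  have h9 : L₂ ^ 2 * ((1 + P.α₁) / (P.β * (1 - P.α₁))) ^ 2
        * (1 / (1 - (P.α₁ + P.α₂) ^ 2) * ‖(S 0).z - u‖ ^ 2)
      = ((1 + P.α₁) / (P.β * (1 - P.α₁))) ^ 2 / (1 - (P.α₁ + P.α₂) ^ 2) * L₂ ^ 2
        * ‖(S 0).z - u‖ ^ 2 := by ring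
  have h10 : 2 * ((1 + P.α₁) / (P.β * (1 - P.α₁))) ^ 2 / (1 - (P.α₁ + P.α₂) ^ 2) * L₂ ^ 2
        * ‖(S 0).z - u‖ ^ 2 = 2 * (((1 + P.α₁) / (P.β * (1 - P.α₁))) ^ 2
        / (1 - (P.α₁ + P.α₂) ^ 2) * L₂ ^ 2 * ‖(S 0).z - u‖ ^ 2) := by ring
  rw [Finset.sum_range_succ, mul_add] at h8
  rw [h6] at h2
  rw [Finset.sum_range_succ, h10]
  linarith

/-- The sum of the squared inverse step sizes is controlled by the losses. -/
theorem sum_inv_sq_le_countedLoss (h : ValidRun P f solver sep e S) (k : ℕ) :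
    ∑ j ∈ Finset.range k, 1 / (S j).etaHat P f solver ^ 2
      ≤ 1 / (1 - P.β ^ 2) / P.σ₀ ^ 2 + (1 + 1 / (1 - P.β ^ 2)) / (P.α₂ * P.β) ^ 2
        * ∑ j ∈ Finset.range k, countedLoss P f solver (S j) := by
  refine (h.sum_inv_sq_le k).trans ?_
  have hβ := h.params.β_pos
  have hβ1 : 0 < 1 - P.β ^ 2 := by nlinarith [h.params.β_lt]
  rw [div_mul_eq_mul_div (1 + 1 / (1 - P.β ^ 2)), mul_div_assoc (1 + 1 / (1 - P.β ^ 2)),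
    Finset.sum_div]
  gcongr with j hj
  unfold countedLoss
  split_ifs with hb
  · simp
  · exact inv_etaHat_sq_le h.params h.linearSolver (h.valid j) hb

theorem countedLoss_le (h : ValidRun P f solver sep e S) (k : ℕ) :
    countedLoss P f solver (S k) ≤ (2 * P.L₁) ^ 2 := by
  unfold countedLoss; split_ifs
  · positivity
  · exact stepLoss_le h.params h.smooth (h.valid k)

/-- A₁ is the first accepted step: either σ₀, or a step whose inverse is controlled by the crude
loss bound (2L₁)². It supplies the denominator in log(A_N/A₁). -/
theorem inv_A_one_le (h : ValidRun P f solver sep e S) :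
    1 / (S 1).A ≤ 2 * max (P.L₁ / (P.α₂ * P.β)) (1 / P.σ₀) := by
  have hα := h.params.α₂_pos
  have hβ := h.params.β_pos
  have hL := h.params.L₁_pos
  have hσ := h.params.σ₀_pos
  rw [h.A_one]
  by_cases hb : (S 0).numBacktracks P f solver = 0
  · rw [etaHat_eq_of_eq_zero hb, h.η_zero]
    have := le_max_right (P.L₁ / (P.α₂ * P.β)) (1 / P.σ₀)
    have h0 : 0 < 1 / P.σ₀ := by positivity
    linarith
  · have h1 := inv_etaHat_sq_le (f := f) h.params h.linearSolver (h.valid 0) hb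
    have h2 : (1 / (S 0).etaHat P f solver) ^ 2 ≤ (2 * (P.L₁ / (P.α₂ * P.β))) ^ 2 := by
      rw [div_pow, one_pow]
      refine h1.trans ?_
      rw [show (2 * (P.L₁ / (P.α₂ * P.β))) ^ 2 = (2 * P.L₁) ^ 2 / (P.α₂ * P.β) ^ 2 by
        field_simp]
      gcongr
      exact stepLoss_le h.params h.smooth (h.valid 0)
    refine (le_of_sq_le_sq h2 (by positivity)).trans ?_
    gcongr
    exact le_max_left _ _

end ValidRun

/-! ### The constants of the theorem. -/

section Constants

/-- The constant of the growth bound for `A`. -/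
noncomputable def growthConst (β : ℝ) : ℝ := (1 - √β) / 4

/-- The weight of the initial step size in the sum of the squared inverse step sizes. -/
noncomputable def initConst (β : ℝ) : ℝ := 1 / (1 - β ^ 2)

/-- The weight of the losses in the sum of the squared inverse step sizes. -/
noncomputable def lossConst (α₂ β : ℝ) : ℝ := (1 + initConst β) / (α₂ * β) ^ 2

/-- The constant of the path length bound. -/
noncomputable def pathConst (α₁ α₂ β : ℝ) : ℝ :=
  (4 + 4 / (1 - (α₁ + α₂) ^ 2)) * (1 + 1 / (1 - √β) / √β
    + (1 + 1 / (1 - √β) / √β) * (1 + 1 / √β))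

/-- The constant `C₄`. -/
noncomputable def rateC₄ (α₂ β : ℝ) : ℝ := √(lossConst α₂ β) / growthConst β ^ 2

/-- The constant `C₅`. -/
noncomputable def rateC₅ (β : ℝ) : ℝ := √(initConst β) / (2 * growthConst β ^ 2)

/-- The constant `C₆`. -/
noncomputable def rateC₆ (β : ℝ) : ℝ := initConst β / (4 * growthConst β ^ 4)

/-- The constant `C₇`. -/
noncomputable def rateC₇ (α₂ β : ℝ) : ℝ := lossConst α₂ β / (4 * growthConst β ^ 4) * 5

/-- The constant `C₈`. -/
noncomputable def rateC₈ (α₂ β : ℝ) : ℝ := lossConst α₂ β / (4 * growthConst β ^ 4) * 128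

/-- The constant `C₉`. -/
noncomputable def rateC₉ (α₁ α₂ β : ℝ) : ℝ := lossConst α₂ β / (4 * growthConst β ^ 4) *
  (2 * ((1 + α₁) / (β * (1 - α₁))) ^ 2 / (1 - (α₁ + α₂) ^ 2))

/-- The constant `C₁₀`. -/
noncomputable def rateC₁₀ (α₁ α₂ β : ℝ) : ℝ := lossConst α₂ β / (4 * growthConst β ^ 4) *
  (256 * pathConst α₁ α₂ β)

variable {P : Params}

theorem growthConst_pos (hP : P.Valid) : 0 < growthConst P.β := by
  have := ValidRun.sqrt_beta_lt_one hP
  unfold growthConst; linarith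

theorem initConst_pos (hP : P.Valid) : 0 < initConst P.β := by
  have : 0 < 1 - P.β ^ 2 := by nlinarith [hP.β_lt, hP.β_pos]
  unfold initConst; positivity

theorem lossConst_pos (hP : P.Valid) : 0 < lossConst P.α₂ P.β := by
  have h1 := initConst_pos hP
  have h2 := hP.α₂_pos
  have h3 := hP.β_pos
  unfold lossConst; positivity

theorem pathConst_pos (hP : P.Valid) : 0 < pathConst P.α₁ P.α₂ P.β := by
  have h1 := ValidRun.one_sub_sq_pos hP
  have h2 : 0 < √P.β := Real.sqrt_pos.2 hP.β_pos
  have h3 : 0 < 1 - √P.β := by linarith [ValidRun.sqrt_beta_lt_one hP]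
  unfold pathConst; positivity

theorem rateC₄_pos (hP : P.Valid) : 0 < rateC₄ P.α₂ P.β :=
  div_pos (Real.sqrt_pos.2 (lossConst_pos hP)) (pow_pos (growthConst_pos hP) 2)

theorem rateC₅_pos (hP : P.Valid) : 0 < rateC₅ P.β := by
  have h1 := growthConst_pos hP
  have h2 := Real.sqrt_pos.2 (initConst_pos hP)
  unfold rateC₅; positivity

theorem rateC₆_pos (hP : P.Valid) : 0 < rateC₆ P.β := by
  have h1 := growthConst_pos hP
  have h2 := initConst_pos hP
  unfold rateC₆; positivity

theorem lossConst_div_pos (hP : P.Valid) : 0 < lossConst P.α₂ P.β / (4 * growthConst P.β ^ 4) := by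
  have h1 := growthConst_pos hP
  have h2 := lossConst_pos hP
  positivity

theorem rateC₇_pos (hP : P.Valid) : 0 < rateC₇ P.α₂ P.β :=
  mul_pos (lossConst_div_pos hP) (by norm_num)

theorem rateC₈_pos (hP : P.Valid) : 0 < rateC₈ P.α₂ P.β :=
  mul_pos (lossConst_div_pos hP) (by norm_num)

theorem rateC₉_pos (hP : P.Valid) : 0 < rateC₉ P.α₁ P.α₂ P.β := by
  refine mul_pos (lossConst_div_pos hP) ?_
  have h1 := ValidRun.one_sub_sq_pos hP
  have h2 := hP.α₁_pos
  have h3 := hP.β_pos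
  have h4 : 0 < 1 - P.α₁ := by linarith [hP.add_lt, hP.α₂_pos]
  positivity

theorem rateC₁₀_pos (hP : P.Valid) : 0 < rateC₁₀ P.α₁ P.α₂ P.β :=
  mul_pos (lossConst_div_pos hP) (mul_pos (by norm_num) (pathConst_pos hP))

end Constants

/-! ### The two rates along a valid run. -/

theorem rpow_five_halves (k : ℕ) : (k : ℝ) ^ (5 / 2 : ℝ) = (k : ℝ) ^ 2 * √k := by
  rw [Real.sqrt_eq_rpow, ← Real.rpow_natCast, ← Real.rpow_add_of_nonneg] <;> norm_num

theorem rpow_five_halves_sq (k : ℕ) : ((k : ℝ) ^ (5 / 2 : ℝ)) ^ 2 = (k : ℝ) ^ 5 := by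
  rw [rpow_five_halves, mul_pow, Real.sq_sqrt (Nat.cast_nonneg k)]; ring

namespace ValidRun

open State

variable {d : ℕ} {E : Type*} {P : Params} {f : Vec d → ℝ}
    {solver : Mat d → Vec d → ℝ → Vec d} {sep : Mat d → ℝ → ℝ → E → ℝ × Mat d} {e : ℕ → E}
    {S : ℕ → State d} {u : Vec d}

/-- The gap in terms of the sum `Q` of the squared inverse step sizes. -/
theorem gap_le_of_sum_le (h : ValidRun P f solver sep e S) (k : ℕ) {Q : ℝ}
    (hQ : ∑ j ∈ Finset.range (k + 1), 1 / (S j).etaHat P f solver ^ 2 ≤ Q) :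
    f (S (k + 1)).x - f u ≤ ‖(S 0).z - u‖ ^ 2 / ((k + 1 : ℕ) : ℝ) ^ (5 / 2 : ℝ)
      * (√Q / (2 * growthConst P.β ^ 2)) := by
  have hA := h.A_pos k
  have hc := growthConst_pos h.params
  set p := ((k + 1 : ℕ) : ℝ) ^ (5 / 2 : ℝ) with hp
  have hp0 : 0 < p := Real.rpow_pos_of_pos (by positivity) _
  have hp2 : p ^ 2 = ((k + 1 : ℕ) : ℝ) ^ 5 := rpow_five_halves_sq _
  have h1 : (growthConst P.β ^ 2 * p) ^ 2 ≤ (S (k + 1)).A ^ 2 * Q := by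
    rw [mul_pow, hp2]
    calc _ = growthConst P.β ^ 4 * ((k + 1 : ℕ) : ℝ) ^ 5 := by ring
      _ ≤ _ := h.pow_five_le k
      _ ≤ _ := by gcongr
  have h2 : growthConst P.β ^ 2 * p ≤ (S (k + 1)).A * √Q := by
    have := Real.le_sqrt_of_sq_le h1
    rwa [Real.sqrt_mul (sq_nonneg _), Real.sqrt_sq hA.le] at this
  refine (h.sub_le_div u k).trans ?_
  rw [div_mul_div_comm, div_le_div_iff₀ (by positivity) (by positivity)]
  calc _ = ‖(S 0).z - u‖ ^ 2 * 2 * (growthConst P.β ^ 2 * p) := by ring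
    _ ≤ ‖(S 0).z - u‖ ^ 2 * 2 * ((S (k + 1)).A * √Q) := by gcongr
    _ = _ := by ring

/-- Nothing is learned here: each loss is at most (2L₁)², so Σ η̂⁻² grows linearly in k, and its
root costs √k against k^(5/2). -/
theorem first_order_rate (h : ValidRun P f solver sep e S) {k : ℕ} (hk : 1 ≤ k) :
    f (S k).x - f u ≤ rateC₄ P.α₂ P.β * P.L₁ * ‖(S 0).z - u‖ ^ 2 / (k : ℝ) ^ 2
      + rateC₅ P.β * ‖(S 0).z - u‖ ^ 2 / (P.σ₀ * (k : ℝ) ^ (5 / 2 : ℝ)) := by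
  obtain ⟨k, rfl⟩ := Nat.exists_eq_add_of_le' hk
  have hL := h.params.L₁_pos
  have hσ := h.params.σ₀_pos
  have hc := growthConst_pos h.params
  have hi := initConst_pos h.params
  have hl := lossConst_pos h.params
  have h1 : ∑ j ∈ Finset.range (k + 1), 1 / (S j).etaHat P f solver ^ 2
      ≤ initConst P.β / P.σ₀ ^ 2 + lossConst P.α₂ P.β * (((k + 1 : ℕ) : ℝ) * (2 * P.L₁) ^ 2) := by
    refine (h.sum_inv_sq_le_countedLoss (k + 1)).trans ?_
    unfold lossConst initConst at *
    gcongr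
    calc _ ≤ ∑ _j ∈ Finset.range (k + 1), (2 * P.L₁) ^ 2 :=
          Finset.sum_le_sum fun j _ => h.countedLoss_le j
      _ = _ := by simp
  refine (h.gap_le_of_sum_le k h1).trans ?_
  have h2 : √(initConst P.β / P.σ₀ ^ 2 + lossConst P.α₂ P.β * (((k + 1 : ℕ) : ℝ) * (2 * P.L₁) ^ 2))
      ≤ √(initConst P.β) / P.σ₀ + √(lossConst P.α₂ P.β) * (√((k + 1 : ℕ) : ℝ) * (2 * P.L₁)) := by
    refine Real.sqrt_le_iff.2 ⟨by positivity, ?_⟩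
    rw [add_sq, div_pow, mul_pow (√(lossConst P.α₂ P.β)), mul_pow (√((k + 1 : ℕ) : ℝ)),
      Real.sq_sqrt hi.le, Real.sq_sqrt hl.le,
      Real.sq_sqrt (Nat.cast_nonneg _)]
    have : 0 ≤ 2 * (√(initConst P.β) / P.σ₀)
      * (√(lossConst P.α₂ P.β) * (√((k + 1 : ℕ) : ℝ) * (2 * P.L₁))) := by positivity
    linarith
  rw [rpow_five_halves, rateC₄, rateC₅]
  have hk0 : (0 : ℝ) < ((k + 1 : ℕ) : ℝ) := by positivity
  have hs := Real.sqrt_pos.2 hk0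
  calc _ ≤ ‖(S 0).z - u‖ ^ 2 / (((k + 1 : ℕ) : ℝ) ^ 2 * √((k + 1 : ℕ) : ℝ)) *
      ((√(initConst P.β) / P.σ₀ + √(lossConst P.α₂ P.β) * (√((k + 1 : ℕ) : ℝ) * (2 * P.L₁)))
        / (2 * growthConst P.β ^ 2)) := by gcongr
    _ = _ := by field_simp; ring

/-- The regret bound contains log A_k through the path length, although A_k is what has to be
bounded below. A dichotomy on the size of A_k breaks the circle. -/
theorem quasi_newton_rate {L₂ : ℝ} (h : ValidRun P f solver sep e S) (hL₂ : 0 ≤ L₂)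
    (hf2 : HasLipschitzHessian f L₂) {B₀ : Mat d} (hW : (S 0).W = normalized P.L₁ B₀)
    (hu : ∀ x, f u ≤ f x) {M : ℝ}
    (hM : M = rateC₆ P.β / P.σ₀ ^ 2 + rateC₇ P.α₂ P.β * P.L₁ ^ 2
      + rateC₈ P.α₂ P.β * frobNorm (B₀ - hessMat f (S 0).z) ^ 2
      + rateC₉ P.α₁ P.α₂ P.β * L₂ ^ 2 * ‖(S 0).z - u‖ ^ 2
      + rateC₁₀ P.α₁ P.α₂ P.β * P.L₁ * L₂ * d * ‖(S 0).z - u‖)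
    {k : ℕ} (hk : 1 ≤ k) :
    f (S k).x - f u ≤ ‖(S 0).z - u‖ ^ 2 / (k : ℝ) ^ (5 / 2 : ℝ) *
      √(M + rateC₁₀ P.α₁ P.α₂ P.β * P.L₁ * L₂ * d * ‖(S 0).z - u‖ *
        max (Real.log (max (P.L₁ / (P.α₂ * P.β)) (1 / P.σ₀) * (k : ℝ) ^ (5 / 2 : ℝ) / √M)) 0) := by
  obtain ⟨k, rfl⟩ := Nat.exists_eq_add_of_le' hk
  have hL := h.params.L₁_pos
  have hσ := h.params.σ₀_pos
  have hc := growthConst_pos h.params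
  have hA := h.A_pos k
  have hA1 := h.A_pos 0
  set p := ((k + 1 : ℕ) : ℝ) ^ (5 / 2 : ℝ) with hp
  have hp0 : 0 < p := Real.rpow_pos_of_pos (by positivity) _
  set mx := max (P.L₁ / (P.α₂ * P.β)) (1 / P.σ₀)
  have hmx : 0 < mx := lt_max_of_lt_right (by positivity)
  set D := ‖(S 0).z - u‖ with hD
  have hD0 : 0 ≤ D := norm_nonneg _
  set F := frobNorm (B₀ - hessMat f (S 0).z)
  have c6 := rateC₆_pos h.params
  have c7 := rateC₇_pos h.params
  have c8 := rateC₈_pos h.params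
  have c9 := rateC₉_pos h.params
  have c10 := rateC₁₀_pos h.params
  have hM0 : 0 < M := by rw [hM]; positivity
  have hsM := Real.sqrt_pos.2 hM0
  set ℒ := max (Real.log (mx * p / √M)) 0 with hℒ
  have hℒ0 : 0 ≤ ℒ := le_max_right _ _
  have hadd : 0 ≤ rateC₁₀ P.α₁ P.α₂ P.β * P.L₁ * L₂ * d * D * ℒ := by positivity
  -- Above this threshold D²/(2A) is already at most D²√M/p. Below it, log(A/A₁) is at most the
  -- logarithm in the statement: the factor 2 of `inv_A_one_le` cancels the one in the threshold.
  rcases le_or_gt (p / (2 * √M)) (S (k + 1)).A with hcase | hcase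
  · refine (h.sub_le_div u k).trans ?_
    calc D ^ 2 / (2 * (S (k + 1)).A) ≤ D ^ 2 / (2 * (p / (2 * √M))) := by gcongr
      _ = D ^ 2 / p * √M := by field_simp
      _ ≤ _ := by
        gcongr
        linarith
  have hlog : Real.log (S (k + 1)).A - Real.log (S 1).A ≤ ℒ := by
    refine le_trans ?_ (le_max_left _ _)
    rw [← Real.log_div hA.ne' hA1.ne']
    refine Real.log_le_log (by positivity) ?_
    calc (S (k + 1)).A / (S 1).A = (S (k + 1)).A * (1 / (S 1).A) := by ring
      _ ≤ p / (2 * √M) * (2 * mx) := by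
        gcongr
        exact h.inv_A_one_le
      _ = _ := by field_simp
  have hpath : ∑ j ∈ Finset.range k, ‖(S (j + 1)).y - (S j).y‖
      ≤ pathConst P.α₁ P.α₂ P.β * D * (1 + ℒ) := by
    refine (h.sum_norm_y_sub_le hu k).trans ?_
    have h1 := h.sum_theta_le k
    have h2 := one_sub_sq_pos h.params
    have h3 : 0 < √P.β := Real.sqrt_pos.2 h.params.β_pos
    have h4 : 0 < 1 - √P.β := by linarith [sqrt_beta_lt_one h.params]
    unfold pathConst
    set t₀ := 1 / (1 - √P.β) / √P.β
    have ht0 : 0 < t₀ := by positivity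
    set t₁ := (1 + t₀) * (1 + 1 / √P.β)
    have ht1 : 0 < t₁ := by positivity
    set c := 4 + 4 / (1 - (P.α₁ + P.α₂) ^ 2)
    have hc0 : 0 < c := by positivity
    have h5 : 1 + ∑ j ∈ Finset.range k, (S (j + 1)).theta ≤ (1 + t₀ + t₁) * (1 + ℒ) := by
      have h6 : t₁ * (Real.log (S (k + 1)).A - Real.log (S 1).A) ≤ t₁ * ℒ := by gcongr
      nlinarith [mul_nonneg ht0.le hℒ0]
    calc c * D * (1 + ∑ j ∈ Finset.range k, (S (j + 1)).theta)
        ≤ c * D * ((1 + t₀ + t₁) * (1 + ℒ)) := by gcongr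
      _ = _ := by ring
  have hloss := h.sum_countedLoss_le hL₂ hf2 hW hu k
  set X := 2 * ((1 + P.α₁) / (P.β * (1 - P.α₁))) ^ 2 / (1 - (P.α₁ + P.α₂) ^ 2) with hX
  have hQ := h.sum_inv_sq_le_countedLoss (k + 1)
  have hl := lossConst_pos h.params
  -- The factor (2c²)², with c the growth constant, cancels the denominator of `gap_le_of_sum_le`;
  -- the rate constants carry 1/(4c⁴) for this reason.
  have hQ' : ∑ j ∈ Finset.range (k + 1), 1 / (S j).etaHat P f solver ^ 2
      ≤ (2 * growthConst P.β ^ 2) ^ 2 * (M + rateC₁₀ P.α₁ P.α₂ P.β * P.L₁ * L₂ * d * D * ℒ) := by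
    refine hQ.trans ?_
    change initConst P.β / P.σ₀ ^ 2 + lossConst P.α₂ P.β * _ ≤ _
    calc _ ≤ initConst P.β / P.σ₀ ^ 2 + lossConst P.α₂ P.β *
          (X * L₂ ^ 2 * D ^ 2 + 128 * F ^ 2 + 5 * P.L₁ ^ 2
            + 256 * P.L₁ * L₂ * d * (pathConst P.α₁ P.α₂ P.β * D * (1 + ℒ))) := by
          gcongr
          refine hloss.trans ?_
          gcongr
      _ = _ := by
          rw [hM, rateC₆, rateC₇, rateC₈, rateC₉, rateC₁₀, ← hX]
          field_simp
          ring
  refine (h.gap_le_of_sum_le k hQ').trans (le_of_eq ?_)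
  rw [Real.sqrt_mul (sq_nonneg _), Real.sqrt_sq (by positivity), ← hp, ← hD]
  field_simp

end ValidRun

/-! ### The combined rate with explicit dimension. -/

/-- Both normalized matrices lie in the operator norm unit ball, so they differ by at most 2 there
and by 2√d in Frobenius norm; undoing the normalization multiplies by L/2. This removes B₀ and f
from the constant K. -/
theorem frobNorm_sub_hessMat_sq_le {d : ℕ} {f : Vec d → ℝ} {L : ℝ} (hL : 0 < L)
    (hf : IsSmoothConvex f L) {B₀ : Mat d} (hB : B₀.PosSemidef)
    (hB' : (L • (1 : Mat d) - B₀).PosSemidef) (z : Vec d) :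
    frobNorm (B₀ - hessMat f z) ^ 2 ≤ L ^ 2 * d := by
  have h1 := norm_normalized_le hL hB hB'
  have h2 := norm_normalized_hessMat_le hL hf z
  have h3 : frobNorm (normalized L B₀ - normalized L (hessMat f z)) ≤ √d * 2 := by
    refine (frobNorm_le _).trans ?_
    rw [op_sub]
    gcongr
    exact (norm_sub_le _ _).trans (by linarith)
  rw [normalized_sub, frobNorm_eq_norm, map_smul, norm_smul, ← frobNorm_eq_norm,
    Real.norm_of_nonneg (by positivity), div_mul_eq_mul_div, div_le_iff₀ hL] at h3
  have h4 : frobNorm (B₀ - hessMat f z) ≤ L * √d := by linarith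
  calc _ ≤ (L * √d) ^ 2 := pow_le_pow_left₀ (frobNorm_nonneg _) h4 2
    _ = _ := by rw [mul_pow, Real.sq_sqrt (Nat.cast_nonneg d)]

/-- The bound for `M / d` in the dimension-explicit rate. -/
noncomputable def dimConst (C₆ C₇ C₈ C₉ C₁₀ L₁ L₂ σ₀ R : ℝ) : ℝ :=
  C₆ / σ₀ ^ 2 + C₇ * L₁ ^ 2 + C₈ * L₁ ^ 2 + C₉ * L₂ ^ 2 * R ^ 2 + C₁₀ * L₁ * L₂ * R

/-- The bound for the logarithmic factor in the dimension-explicit rate. -/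
noncomputable def logFactor (m C₆ σ₀ : ℝ) : ℝ :=
  max (Real.log (m * σ₀ / √C₆)) 0 / Real.log 2 + 5 / 2

/-- The bound for the quantity under the root, divided by `d log k`. -/
noncomputable def rootConst (m C₆ C₇ C₈ C₉ C₁₀ L₁ L₂ σ₀ R : ℝ) : ℝ :=
  dimConst C₆ C₇ C₈ C₉ C₁₀ L₁ L₂ σ₀ R / Real.log 2 + C₁₀ * L₁ * L₂ * R * logFactor m C₆ σ₀

/-- The constant `K` of the combined rate. -/
noncomputable def combinedConst (m C₄ C₅ C₆ C₇ C₈ C₉ C₁₀ L₁ L₂ σ₀ R : ℝ) : ℝ :=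
  C₄ * L₁ * R ^ 2 + C₅ * R ^ 2 / σ₀ + R ^ 2 * √(rootConst m C₆ C₇ C₈ C₉ C₁₀ L₁ L₂ σ₀ R)

/-- The combined rate as a consequence of the two individual rates. -/
theorem combined_rate {m C₄ C₅ C₆ C₇ C₈ C₉ C₁₀ L₁ L₂ σ₀ R D F gap M : ℝ} {d k : ℕ}
    (h4 : 0 < C₄) (h5 : 0 < C₅) (h6 : 0 < C₆) (h7 : 0 < C₇) (h8 : 0 < C₈) (h9 : 0 < C₉)
    (h10 : 0 < C₁₀) (hL₁ : 0 < L₁) (hL₂ : 0 ≤ L₂) (hσ : 0 < σ₀) (hD : 0 ≤ D) (hDR : D ≤ R)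
    (hm : 0 < m) (hd : 1 ≤ d) (hk : 2 ≤ k) (hF : F ≤ L₁ ^ 2 * d) (hF0 : 0 ≤ F)
    (hM : M = C₆ / σ₀ ^ 2 + C₇ * L₁ ^ 2 + C₈ * F + C₉ * L₂ ^ 2 * D ^ 2 + C₁₀ * L₁ * L₂ * d * D)
    (ha : gap ≤ C₄ * L₁ * D ^ 2 / (k : ℝ) ^ 2 + C₅ * D ^ 2 / (σ₀ * (k : ℝ) ^ (5 / 2 : ℝ)))
    (hb : gap ≤ D ^ 2 / (k : ℝ) ^ (5 / 2 : ℝ) * √(M + C₁₀ * L₁ * L₂ * d * D *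
      max (Real.log (m * (k : ℝ) ^ (5 / 2 : ℝ) / √M)) 0)) :
    gap ≤ combinedConst m C₄ C₅ C₆ C₇ C₈ C₉ C₁₀ L₁ L₂ σ₀ R *
      min (1 / (k : ℝ) ^ 2) (√(d * Real.log k) / (k : ℝ) ^ (5 / 2 : ℝ)) := by
  have hk' : (2 : ℝ) ≤ k := by exact_mod_cast hk
  have hd' : (1 : ℝ) ≤ d := by exact_mod_cast hd
  have hR : 0 ≤ R := hD.trans hDR
  have hl2 : 0 < Real.log 2 := Real.log_pos one_lt_two
  have hlk : Real.log 2 ≤ Real.log k := Real.log_le_log two_pos hk'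
  have hlk0 : 0 < Real.log k := hl2.trans_le hlk
  set p := (k : ℝ) ^ (5 / 2 : ℝ) with hp
  have hp0 : 0 < p := Real.rpow_pos_of_pos (by linarith) _
  have hpk : (k : ℝ) ^ 2 ≤ p := by
    rw [hp, rpow_five_halves]
    have : 1 ≤ √(k : ℝ) := Real.one_le_sqrt.2 (by linarith)
    nlinarith [sq_nonneg (k : ℝ)]
  have hdim0 : 0 ≤ dimConst C₆ C₇ C₈ C₉ C₁₀ L₁ L₂ σ₀ R := by unfold dimConst; positivity
  have hlf0 : 0 ≤ logFactor m C₆ σ₀ := by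
    have : 0 ≤ max (Real.log (m * σ₀ / √C₆)) 0 := le_max_right _ _
    unfold logFactor; positivity
  have hroot0 : 0 ≤ rootConst m C₆ C₇ C₈ C₉ C₁₀ L₁ L₂ σ₀ R := by unfold rootConst; positivity
  rw [mul_min_of_nonneg _ _ (by unfold combinedConst; positivity)]
  refine le_min ?_ ?_
  · refine ha.trans ?_
    calc C₄ * L₁ * D ^ 2 / (k : ℝ) ^ 2 + C₅ * D ^ 2 / (σ₀ * p)
        ≤ C₄ * L₁ * R ^ 2 / (k : ℝ) ^ 2 + C₅ * R ^ 2 / (σ₀ * (k : ℝ) ^ 2) := by gcongr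
      _ = (C₄ * L₁ * R ^ 2 + C₅ * R ^ 2 / σ₀ + 0) * (1 / (k : ℝ) ^ 2) := by field_simp; ring
      _ ≤ _ := by
        unfold combinedConst
        gcongr
        positivity
  -- M is replaced by an upper bound where it is added, but inside the logarithm it is a denominator
  -- and needs this lower bound, independent of d and f.
  · have hM6 : C₆ / σ₀ ^ 2 ≤ M := by
      rw [hM]
      have : 0 ≤ C₇ * L₁ ^ 2 + C₈ * F + C₉ * L₂ ^ 2 * D ^ 2 + C₁₀ * L₁ * L₂ * d * D := by
        positivity
      linarith
    have hM60 : 0 < C₆ / σ₀ ^ 2 := by positivity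
    have hM0 : 0 < M := hM60.trans_le hM6
    have hsM : √C₆ / σ₀ ≤ √M := by
      refine Real.le_sqrt_of_sq_le ?_
      rwa [div_pow, Real.sq_sqrt h6.le]
    have hs6 := Real.sqrt_pos.2 h6
    have hMd : M ≤ d * Real.log k * (dimConst C₆ C₇ C₈ C₉ C₁₀ L₁ L₂ σ₀ R / Real.log 2) := by
      have e1 : M ≤ d * dimConst C₆ C₇ C₈ C₉ C₁₀ L₁ L₂ σ₀ R := by
        have e2 : C₆ / σ₀ ^ 2 + C₇ * L₁ ^ 2 + C₉ * L₂ ^ 2 * R ^ 2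
            ≤ d * (C₆ / σ₀ ^ 2 + C₇ * L₁ ^ 2 + C₉ * L₂ ^ 2 * R ^ 2) :=
          le_mul_of_one_le_left (by positivity) hd'
        have e3 : C₈ * F ≤ C₈ * (L₁ ^ 2 * d) := by gcongr
        have e4 : C₉ * L₂ ^ 2 * D ^ 2 ≤ C₉ * L₂ ^ 2 * R ^ 2 := by gcongr
        have e5 : C₁₀ * L₁ * L₂ * d * D ≤ C₁₀ * L₁ * L₂ * d * R := by gcongr
        rw [hM, dimConst]
        linarith
      calc M ≤ d * dimConst C₆ C₇ C₈ C₉ C₁₀ L₁ L₂ σ₀ R := e1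
        _ = d * Real.log 2 * (dimConst C₆ C₇ C₈ C₉ C₁₀ L₁ L₂ σ₀ R / Real.log 2) := by field_simp
        _ ≤ _ := by gcongr
    have hlog : max (Real.log (m * p / √M)) 0 ≤ Real.log k * logFactor m C₆ σ₀ := by
      have hx : 0 ≤ max (Real.log (m * σ₀ / √C₆)) 0 := le_max_right _ _
      refine max_le ?_ (by positivity)
      have e1 : Real.log (m * p / √M) ≤ Real.log (m * σ₀ / √C₆ * p) := by
        refine Real.log_le_log (by positivity) ?_
        calc m * p / √M ≤ m * p / (√C₆ / σ₀) := by gcongr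
          _ = _ := by field_simp
      have e2 : Real.log (m * σ₀ / √C₆ * p) = Real.log (m * σ₀ / √C₆) + 5 / 2 * Real.log k := by
        rw [Real.log_mul (by positivity) hp0.ne', hp, Real.log_rpow (by linarith)]
      have e3 : max (Real.log (m * σ₀ / √C₆)) 0
          ≤ Real.log k * (max (Real.log (m * σ₀ / √C₆)) 0 / Real.log 2) := by
        calc _ = Real.log 2 * (max (Real.log (m * σ₀ / √C₆)) 0 / Real.log 2) := by field_simp
          _ ≤ _ := by gcongr
      have e4 := le_max_left (Real.log (m * σ₀ / √C₆)) 0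
      rw [logFactor, mul_add]
      linarith
    have hsum : M + C₁₀ * L₁ * L₂ * d * D * max (Real.log (m * p / √M)) 0
        ≤ d * Real.log k * rootConst m C₆ C₇ C₈ C₉ C₁₀ L₁ L₂ σ₀ R := by
      have e1 : C₁₀ * L₁ * L₂ * d * D * max (Real.log (m * p / √M)) 0
          ≤ C₁₀ * L₁ * L₂ * d * R * (Real.log k * logFactor m C₆ σ₀) := by gcongr
      rw [rootConst, mul_add]
      linarith
    refine hb.trans ?_
    calc _ ≤ R ^ 2 / p * √(d * Real.log k * rootConst m C₆ C₇ C₈ C₉ C₁₀ L₁ L₂ σ₀ R) := by gcongr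
      _ = (0 + R ^ 2 * √(rootConst m C₆ C₇ C₈ C₉ C₁₀ L₁ L₂ σ₀ R)) * (√(d * Real.log k) / p) := by
        rw [Real.sqrt_mul (by positivity)]; field_simp; ring
      _ ≤ _ := by
        unfold combinedConst
        gcongr
        positivity

/-! ### From correct oracle answers to a valid run. -/

section Run

variable {d : ℕ} {E : Type*} {P : Params} {f : Vec d → ℝ}
    {solver : Mat d → Vec d → ℝ → Vec d} {sep : Mat d → ℝ → ℝ → E → ℝ × Mat d} {e : ℕ → E}
    {x₀ z₀ : Vec d} {B₀ : Mat d}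

/-- The oracle query of iteration `k`, if there is one, is answered correctly. -/
def CorrectAt (P : Params) (f : Vec d → ℝ) (solver : Mat d → Vec d → ℝ → Vec d)
    (sep : Mat d → ℝ → ℝ → E → ℝ × Mat d) (s : State d) (e : E) : Prop :=
  s.numBacktracks P f solver ≠ 0 → SepCorrect (s.nextW P f solver) (delta (s.t + 1))
    (sep (s.nextW P f solver) (delta (s.t + 1)) (failProb P.p (s.t + 1)) e)

theorem failProb_pos {p : ℝ} (hp : 0 < p) (t : ℕ) : 0 < failProb p (t + 1) := by
  have : 0 < Real.log (((t + 1 : ℕ) : ℝ) + 1) :=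
    Real.log_pos (by push_cast; linarith [t.cast_nonneg (α := ℝ)])
  unfold failProb
  positivity

theorem sum_failProb_le {p : ℝ} (hp : 0 ≤ p) (n : ℕ) :
    ∑ t ∈ Finset.range n, failProb p (t + 1) ≤ p := by
  have h := sum_one_div_mul_log_sq_le n
  have e : ∀ t : ℕ, failProb p (t + 1)
      = p / 2.5 * (1 / (((t : ℝ) + 2) * Real.log ((t : ℝ) + 2) ^ 2)) := by
    intro t
    have e1 : ((t + 1 : ℕ) : ℝ) + 1 = t + 2 := by push_cast; ring
    rw [failProb, e1, div_mul_div_comm, mul_one, mul_assoc]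
  simp only [e, ← Finset.mul_sum]
  calc _ ≤ p / 2.5 * 2.5 := by gcongr
    _ = p := by field_simp

theorem failProb_lt_one {p : ℝ} (hp : 0 < p) (hp1 : p < 1) (t : ℕ) : failProb p (t + 1) < 1 := by
  refine lt_of_le_of_lt ?_ hp1
  refine le_trans ?_ (sum_failProb_le hp.le (t + 1))
  exact Finset.single_le_sum (f := fun t => failProb p (t + 1)) (fun i _ => (failProb_pos hp i).le)
    (Finset.mem_range.2 t.lt_succ_self)

/-- The learner's matrices stay symmetric, whatever the answers of the oracle. -/
theorem run_isSymm (hP : P.Valid) (hB : B₀.IsSymm)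
    (hsep : ∀ W δ q e, W.IsSymm → 0 < δ → 0 < q → q < 1 → (sep W δ q e).2.IsSymm) (k : ℕ) :
    (run P f solver sep x₀ z₀ B₀ e k).W.IsSymm ∧ (run P f solver sep x₀ z₀ B₀ e k).S.IsSymm := by
  induction k with
  | zero => exact ⟨normalized_isSymm hB, Matrix.transpose_zero⟩
  | succ k ih =>
    have h1 := State.nextW_isSymm (P := P) (f := f) (solver := solver) ih.1 ih.2
    rw [run, State.next]
    split_ifs
    · exact ih
    · exact ⟨h1, hsep _ _ _ _ h1 (delta_pos _) (failProb_pos hP.p_pos _)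
        (failProb_lt_one hP.p_pos hP.p_lt _)⟩

theorem init_valid (hP : P.Valid) (hB : B₀.PosSemidef)
    (hB' : (P.L₁ • (1 : Mat d) - B₀).PosSemidef) : (State.init P x₀ z₀ B₀).Valid where
  η_pos := hP.σ₀_pos
  A_nonneg := le_rfl
  W_symm := normalized_isSymm (posSemidef_iff_inner.1 hB).1
  S_symm := Matrix.transpose_zero
  W_le := by
    have h1 := norm_normalized_le hP.L₁_pos hB hB'
    exact (frobNorm_le _).trans (mul_le_of_le_one_right (Real.sqrt_nonneg _) h1)
  -- Round 0 has the default answer γ = 1, so only the first clause of correctness has content, and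
  -- the assumption 0 ≤ B₀ ≤ L₁I provides it.
  sep := ⟨fun _ => norm_normalized_le hP.L₁_pos hB hB', fun h => absurd h (lt_irrefl _)⟩

theorem validRun_of_correct (hP : P.Valid) (hf : IsSmoothConvex f P.L₁)
    (hsol : IsLinearSolver solver) (hB : B₀.PosSemidef)
    (hB' : (P.L₁ • (1 : Mat d) - B₀).PosSemidef)
    (hsep : ∀ W δ q e, W.IsSymm → 0 < δ → 0 < q → q < 1 → (sep W δ q e).2.IsSymm)
    (hcor : ∀ k, CorrectAt P f solver sep (run P f solver sep x₀ z₀ B₀ e k) (e k)) :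
    ValidRun P f solver sep e (run P f solver sep x₀ z₀ B₀ e) where
  params := hP
  smooth := hf
  linearSolver := hsol
  step _ := rfl
  valid k := by
    induction k with
    | zero => exact init_valid hP hB hB'
    | succ k ih =>
      exact State.Valid.next hP ih
        (run_isSymm hP (posSemidef_iff_inner.1 hB).1 hsep (k + 1)).2 (hcor k)
  A_zero := rfl
  η_zero := rfl

end Run

/-! ### Measurability of the matrix operations. -/

open MeasureTheory

section MatrixMeasurability

variable {d : ℕ}

instance instSecondCountableTopologyMat (d : ℕ) :
    SecondCountableTopology (Matrix (Fin d) (Fin d) ℝ) :=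
  inferInstanceAs (SecondCountableTopology (Fin d → Fin d → ℝ))

theorem continuous_op : Continuous fun B : Mat d => op B :=
  LinearMap.continuous_of_finiteDimensional
    (Matrix.toEuclideanCLM (n := Fin d) (𝕜 := ℝ)).toAlgEquiv.toLinearMap

theorem continuous_frobInner : Continuous fun p : Mat d × Mat d => frobInner p.1 p.2 :=
  continuous_finsetSum _ fun i _ => continuous_finsetSum _ fun j _ =>
    (continuous_fst.matrix_elem i j).mul (continuous_snd.matrix_elem i j)

theorem continuous_frobNorm : Continuous fun A : Mat d => frobNorm A :=
  (continuous_frobInner.comp (continuous_id.prodMk continuous_id)).sqrt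

theorem continuous_vecMulVec : Continuous fun p : Vec d × Vec d =>
    (Matrix.vecMulVec (p.1 : Fin d → ℝ) (p.2 : Fin d → ℝ) : Mat d) :=
  Continuous.matrix_vecMulVec (by fun_prop) (by fun_prop)

variable {X : Type*} [MeasurableSpace X]

theorem measurable_op_apply {B : X → Mat d} {s : X → Vec d} (hB : Measurable B)
    (hs : Measurable s) : Measurable fun x => op (B x) (s x) := by
  have h : Continuous fun p : Mat d × Vec d =>
      (WithLp.toLp 2 (p.1.mulVec (p.2 : Fin d → ℝ)) : Vec d) :=
    (PiLp.continuous_toLp 2 _).comp (Continuous.matrix_mulVec continuous_fst (by fun_prop))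
  exact h.measurable.comp (hB.prodMk hs)

theorem measurable_frobInner {A B : X → Mat d} (hA : Measurable A) (hB : Measurable B) :
    Measurable fun x => frobInner (A x) (B x) :=
  continuous_frobInner.measurable.comp (hA.prodMk hB)

theorem measurable_frobNorm {A : X → Mat d} (hA : Measurable A) :
    Measurable fun x => frobNorm (A x) :=
  continuous_frobNorm.measurable.comp hA

theorem measurable_lossGrad {s w : X → Vec d} {B : X → Mat d} (hs : Measurable s)
    (hw : Measurable w) (hB : Measurable B) : Measurable fun x => lossGrad (s x) (w x) (B x) := by
  have hv : Measurable fun x => w x - op (B x) (s x) := hw.sub (measurable_op_apply hB hs)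
  have h1 : Measurable fun x => (Matrix.vecMulVec (s x : Fin d → ℝ)
      (w x - op (B x) (s x) : Vec d) : Mat d) := continuous_vecMulVec.measurable.comp (hs.prodMk hv)
  have h2 : Measurable fun x => (Matrix.vecMulVec (w x - op (B x) (s x) : Vec d)
      (s x : Fin d → ℝ) : Mat d) := continuous_vecMulVec.measurable.comp (hv.prodMk hs)
  exact (measurable_const.div (hs.norm.pow_const 2)).smul (h1.neg.sub h2)

theorem measurableSet_sepCorrect (δ : ℝ) :
    MeasurableSet {p : Mat d × ℝ × Mat d | SepCorrect p.1 δ p.2} := by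
  have hW : Measurable fun p : Mat d × ℝ × Mat d => p.1 := measurable_fst
  have hγ : Measurable fun p : Mat d × ℝ × Mat d => p.2.1 := measurable_snd.fst
  have hS : Measurable fun p : Mat d × ℝ × Mat d => p.2.2 := measurable_snd.snd
  have h1 : MeasurableSet {p : Mat d × ℝ × Mat d | p.2.1 ≤ 1} :=
    measurableSet_le hγ measurable_const
  have h2 : MeasurableSet {p : Mat d × ℝ × Mat d | ‖op p.1‖ ≤ 1} :=
    measurableSet_le (continuous_op.norm.measurable.comp hW) measurable_const
  have h3 : MeasurableSet {p : Mat d × ℝ × Mat d | 1 < p.2.1} :=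
    measurableSet_lt measurable_const hγ
  have h4 : MeasurableSet {p : Mat d × ℝ × Mat d | ‖op (p.2.1⁻¹ • p.1)‖ ≤ 1} :=
    measurableSet_le (continuous_op.norm.measurable.comp (hγ.inv.smul hW)) measurable_const
  have h5 : MeasurableSet {p : Mat d × ℝ × Mat d | frobNorm p.2.2 ≤ 3} :=
    measurableSet_le (measurable_frobNorm hS) measurable_const
  -- The quantifier ranges over uncountably many matrices, but each condition is closed, so their
  -- intersection is closed and hence measurable.
  have h6 : MeasurableSet {p : Mat d × ℝ × Mat d | ∀ Bh : Mat d, Bh.IsSymm → ‖op Bh‖ ≤ 1 →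
      p.2.1 - 1 - δ ≤ frobInner p.2.2 (p.1 - Bh)} := by
    refine IsClosed.measurableSet ?_
    simp only [Set.ofPred_forall]
    refine isClosed_iInter fun Bh => isClosed_iInter fun _ => isClosed_iInter fun _ => ?_
    refine isClosed_le (by fun_prop) ?_
    exact continuous_frobInner.comp
      (continuous_snd.snd.prodMk (continuous_fst.sub continuous_const))
  have e : {p : Mat d × ℝ × Mat d | SepCorrect p.1 δ p.2}
      = ({p | p.2.1 ≤ 1}ᶜ ∪ {p | ‖op p.1‖ ≤ 1}) ∩ ({p | 1 < p.2.1}ᶜ ∪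
        ({p | ‖op (p.2.1⁻¹ • p.1)‖ ≤ 1} ∩ ({p | frobNorm p.2.2 ≤ 3} ∩
          {p | ∀ Bh : Mat d, Bh.IsSymm → ‖op Bh‖ ≤ 1 →
            p.2.1 - 1 - δ ≤ frobInner p.2.2 (p.1 - Bh)}))) := by
    ext p
    simp only [SepCorrect, Set.mem_ofPred_eq, Set.mem_inter_iff, Set.mem_union, Set.mem_compl_iff,
      imp_iff_not_or]
  rw [e]
  exact (h1.compl.union h2).inter (h3.compl.union (h4.inter (h5.inter h6)))

end MatrixMeasurability

/-! ### Measurability of selections by a random index. -/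

section CountableChoice

variable {X Y : Type*} [MeasurableSpace X] [MeasurableSpace Y]

theorem measurable_nat_choice {F : ℕ → X → Y} {n : X → ℕ} (hF : ∀ i, Measurable (F i))
    (hn : Measurable n) : Measurable fun x => F (n x) x := by
  have h : Measurable fun p : X × ℕ => F p.2 p.1 := measurable_from_prod_countable_left hF
  exact h.comp (measurable_id.prodMk hn)

theorem measurable_sInf_nat {p : ℕ → X → Prop} (hp : ∀ i, MeasurableSet {x | p i x}) :
    Measurable fun x => sInf {i | p i x} := by
  refine measurable_to_countable' fun n => ?_
  have h0 : MeasurableSet {x | ∀ i, ¬ p i x} := by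
    rw [Set.ofPred_forall]
    exact MeasurableSet.iInter fun i => (hp i).compl
  have h2 : MeasurableSet {x | ∀ i, i < n → ¬ p i x} := by
    have e : {x | ∀ i, i < n → ¬ p i x} = ⋂ i, ⋂ _ : i < n, {x | p i x}ᶜ := by
      ext x; simp
    rw [e]
    exact MeasurableSet.iInter fun i => MeasurableSet.iInter fun _ => (hp i).compl
  have h1 : MeasurableSet {x | p n x ∧ ∀ i, i < n → ¬ p i x} := (hp n).inter h2
  -- Since `sInf ∅ = 0`, the fibre over 0 also contains the points where no index qualifies. They
  -- must be covered: after a wrong oracle answer the line search need not terminate.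
  have e : (fun x => sInf {i | p i x}) ⁻¹' {n}
      = {x | p n x ∧ ∀ i, i < n → ¬ p i x} ∪ ({x | ∀ i, ¬ p i x} ∩ {_x | n = 0}) := by
    ext x
    simp only [Set.mem_preimage, Set.mem_singleton_iff, Set.mem_union, Set.mem_ofPred_eq,
      Set.mem_inter_iff]
    constructor
    · rintro rfl
      by_cases hx : ∃ i, p i x
      · exact Or.inl ⟨Nat.sInf_mem (s := {i | p i x}) hx, fun i hi => Nat.notMem_of_lt_sInf hi⟩
      · push Not at hx
        refine Or.inr ⟨hx, ?_⟩
        have : {i | p i x} = ∅ := Set.eq_empty_iff_forall_notMem.2 hx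
        rw [this, Nat.sInf_empty]
    · rintro (⟨h3, h4⟩ | ⟨h3, rfl⟩)
      · refine le_antisymm (Nat.sInf_le h3) (not_lt.1 fun hlt => ?_)
        exact h4 _ hlt (Nat.sInf_mem (s := {i | p i x}) ⟨n, h3⟩)
      · have : {i | p i x} = ∅ := Set.eq_empty_iff_forall_notMem.2 h3
        rw [this, Nat.sInf_empty]
  rw [e]
  exact h1.union (h0.inter (MeasurableSet.const _))

end CountableChoice

/-! ### Measurability of the random state. -/

namespace State

variable {d : ℕ} {X : Type*} [MeasurableSpace X]

/-- A random state all of whose components are measurable. -/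
structure IsMeasurable (F : X → State d) : Prop where
  x : Measurable fun u => (F u).x
  z : Measurable fun u => (F u).z
  A : Measurable fun u => (F u).A
  η : Measurable fun u => (F u).η
  t : Measurable fun u => (F u).t
  W : Measurable fun u => (F u).W
  γ : Measurable fun u => (F u).γ
  S : Measurable fun u => (F u).S

variable {P : Params} {f : Vec d → ℝ} {solver : Mat d → Vec d → ℝ → Vec d} {F : X → State d}

theorem IsMeasurable.comp {Y : Type*} [MeasurableSpace Y] (hF : IsMeasurable F) {g : Y → X}
    (hg : Measurable g) : IsMeasurable fun y => F (g y) where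
  x := hF.x.comp hg
  z := hF.z.comp hg
  A := hF.A.comp hg
  η := hF.η.comp hg
  t := hF.t.comp hg
  W := hF.W.comp hg
  γ := hF.γ.comp hg
  S := hF.S.comp hg

theorem IsMeasurable.Bhat (hF : IsMeasurable F) : Measurable fun u => (F u).Bhat :=
  Measurable.ite (measurableSet_le hF.γ measurable_const) hF.W (hF.γ.inv.smul hF.W)

theorem IsMeasurable.B (hF : IsMeasurable F) : Measurable fun u => (F u).B P := by
  have h := hF.Bhat
  unfold State.B
  exact ((measurable_const (a := P.L₁ / 2)).smul h).add measurable_const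

theorem IsMeasurable.a (hF : IsMeasurable F) : Measurable fun u => (F u).a := by
  have hA := hF.A
  have hη := hF.η
  unfold State.a
  fun_prop

theorem IsMeasurable.y (hF : IsMeasurable F) : Measurable fun u => (F u).y :=
  ((hF.A.div (hF.A.add hF.a)).smul hF.x).add ((hF.a.div (hF.A.add hF.a)).smul hF.z)

theorem IsMeasurable.trialStep (hF : IsMeasurable F) (i : ℕ) :
    Measurable fun u => (F u).trialStep P i :=
  hF.η.mul_const _

theorem measurable_gradient {L : ℝ} (hf : IsSmoothConvex f L) : Measurable (gradient f) :=
  hf.differentiable_gradient.continuous.measurable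

theorem IsMeasurable.trialPoint (hF : IsMeasurable F) (hf : IsSmoothConvex f P.L₁)
    (hsol : IsLinearSolver solver) (i : ℕ) :
    Measurable fun u => (F u).trialPoint P f solver i := by
  have hy : Measurable fun u => (F u).y := hF.y
  have hB : Measurable fun u => (F u).B P := hF.B
  have ht : Measurable fun u => (F u).trialStep P i := hF.trialStep i
  have hg : Measurable fun u => gradient f (F u).y := (measurable_gradient hf).comp hy
  exact hy.add ((hsol.measurable P.α₁).comp
    ((measurable_const.add (ht.smul hB)).prodMk (ht.smul hg).neg))

theorem IsMeasurable.accepts (hF : IsMeasurable F) (hf : IsSmoothConvex f P.L₁)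
    (hsol : IsLinearSolver solver) (i : ℕ) :
    MeasurableSet {u | (F u).Accepts P f solver i} := by
  have hx := hF.trialPoint hf hsol i
  have hd := hx.sub hF.y
  exact measurableSet_le
    (hd.add ((hF.trialStep i).smul ((measurable_gradient hf).comp hx))).norm
    (hd.norm.const_mul _)

theorem IsMeasurable.numBacktracks (hF : IsMeasurable F) (hf : IsSmoothConvex f P.L₁)
    (hsol : IsLinearSolver solver) : Measurable fun u => (F u).numBacktracks P f solver :=
  measurable_sInf_nat fun i => hF.accepts hf hsol i

theorem IsMeasurable.etaHat (hF : IsMeasurable F) (hf : IsSmoothConvex f P.L₁)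
    (hsol : IsLinearSolver solver) : Measurable fun u => (F u).etaHat P f solver :=
  measurable_nat_choice (F := fun i u => (F u).trialStep P i) (fun i => hF.trialStep i)
    (hF.numBacktracks hf hsol)

theorem IsMeasurable.xHat (hF : IsMeasurable F) (hf : IsSmoothConvex f P.L₁)
    (hsol : IsLinearSolver solver) : Measurable fun u => (F u).xHat P f solver :=
  measurable_nat_choice (F := fun i u => (F u).trialPoint P f solver i)
    (fun i => hF.trialPoint hf hsol i) (hF.numBacktracks hf hsol)

theorem IsMeasurable.xTilde (hF : IsMeasurable F) (hf : IsSmoothConvex f P.L₁)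
    (hsol : IsLinearSolver solver) : Measurable fun u => (F u).xTilde P f solver :=
  measurable_nat_choice (F := fun i u => (F u).trialPoint P f solver (i - 1))
    (fun i => hF.trialPoint hf hsol (i - 1)) (hF.numBacktracks hf hsol)

theorem IsMeasurable.G (hF : IsMeasurable F) (hf : IsSmoothConvex f P.L₁)
    (hsol : IsLinearSolver solver) : Measurable fun u => (F u).G P f solver := by
  have hx := hF.xTilde hf hsol
  exact (measurable_const (a := 2 / P.L₁)).smul (measurable_lossGrad (hx.sub hF.y)
    (((measurable_gradient hf).comp hx).sub ((measurable_gradient hf).comp hF.y)) hF.B)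

theorem IsMeasurable.Gtilde (hF : IsMeasurable F) (hf : IsSmoothConvex f P.L₁)
    (hsol : IsLinearSolver solver) : Measurable fun u => (F u).Gtilde P f solver := by
  have hG := hF.G hf hsol
  exact Measurable.ite (measurableSet_le hF.γ measurable_const) hG
    (hG.add ((measurable_const.max (measurable_frobInner hG hF.Bhat).neg).smul hF.S))

theorem IsMeasurable.nextW (hF : IsMeasurable F) (hf : IsSmoothConvex f P.L₁)
    (hsol : IsLinearSolver solver) : Measurable fun u => (F u).nextW P f solver := by
  have h := hF.W.sub ((hF.Gtilde hf hsol).const_smul rho)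
  exact (measurable_const.div (measurable_const.max (measurable_frobNorm h))).smul h

/-- The oracle is measurable only for fixed accuracy and failure probability. These depend on the
state through the natural number t alone, so countable choice suffices. -/
theorem IsMeasurable.answer {E : Type*} [MeasurableSpace E]
    {sep : Mat d → ℝ → ℝ → E → ℝ × Mat d}
    (hsep : ∀ δ q, Measurable fun i : Mat d × E => sep i.1 δ q i.2) (hF : IsMeasurable F)
    (hf : IsSmoothConvex f P.L₁) (hsol : IsLinearSolver solver) {g : X → E} (hg : Measurable g) :
    Measurable fun u => sep ((F u).nextW P f solver) (delta ((F u).t + 1))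
      (failProb P.p ((F u).t + 1)) (g u) :=
  measurable_nat_choice
    (F := fun t u => sep ((F u).nextW P f solver) (delta (t + 1)) (failProb P.p (t + 1)) (g u))
    (fun t => (hsep (delta (t + 1)) (failProb P.p (t + 1))).comp
      ((hF.nextW hf hsol).prodMk hg)) hF.t

theorem IsMeasurable.next {E : Type*} [MeasurableSpace E]
    {sep : Mat d → ℝ → ℝ → E → ℝ × Mat d}
    (hsep : ∀ δ q, Measurable fun i : Mat d × E => sep i.1 δ q i.2) (hF : IsMeasurable F)
    (hf : IsSmoothConvex f P.L₁) (hsol : IsLinearSolver solver) {g : X → E} (hg : Measurable g) :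
    IsMeasurable fun u => (F u).next P f solver sep (g u) := by
  have hb : MeasurableSet {u | (F u).numBacktracks P f solver = 0} :=
    (hF.numBacktracks hf hsol) (measurableSet_singleton 0)
  have hx := hF.xHat hf hsol
  have hgr := (measurable_gradient hf).comp hx
  have hη := hF.etaHat hf hsol
  have hr : Measurable fun u => (F u).ratio P f solver := hη.div hF.η
  have hA' := hF.A.add (hr.mul hF.a)
  have hans := hF.answer hsep hf hsol hg
  constructor <;> simp only [State.next, apply_ite State.x, apply_ite State.z, apply_ite State.A,
    apply_ite State.η, apply_ite State.t, apply_ite State.W, apply_ite State.γ, apply_ite State.S]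
  · exact Measurable.ite hb hx
      ((((((measurable_const.sub hr).mul hF.A)).div hA').smul hF.x).add
        (((hr.mul (hF.A.add hF.a)).div hA').smul hx))
  · exact Measurable.ite hb (hF.z.sub (hF.a.smul hgr)) (hF.z.sub ((hr.mul hF.a).smul hgr))
  · exact Measurable.ite hb (hF.A.add hF.a) hA'
  · exact Measurable.ite hb (hη.div_const _) hη
  · exact Measurable.ite hb hF.t (hF.t.add_const 1)
  · exact Measurable.ite hb hF.W (hF.nextW hf hsol)
  · exact Measurable.ite hb hF.γ hans.fst
  · exact Measurable.ite hb hF.S hans.snd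

end State

/-! ### Probability that some oracle answer is wrong. -/

open MeasureTheory ProbabilityTheory

section Failure

variable {d : ℕ} {E : Type*} {P : Params} {f : Vec d → ℝ}
    {solver : Mat d → Vec d → ℝ → Vec d} {sep : Mat d → ℝ → ℝ → E → ℝ × Mat d}
    {x₀ z₀ : Vec d} {B₀ : Mat d}

theorem run_congr {e e' : ℕ → E} {k : ℕ} (h : ∀ j < k, e j = e' j) :
    run P f solver sep x₀ z₀ B₀ e k = run P f solver sep x₀ z₀ B₀ e' k := by
  induction k with
  | zero => rfl
  | succ k ih =>
    rw [run, run, ih fun j hj => h j (hj.trans k.lt_succ_self), h k k.lt_succ_self]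

theorem run_t_mono (e : ℕ → E) : Monotone fun k => (run P f solver sep x₀ z₀ B₀ e k).t := by
  refine monotone_nat_of_le_succ fun k => ?_
  rw [run, State.next]
  split_ifs
  · exact le_rfl
  · exact Nat.le_succ _

theorem run_t_succ {e : ℕ → E} {k : ℕ}
    (h : (run P f solver sep x₀ z₀ B₀ e k).numBacktracks P f solver ≠ 0) :
    (run P f solver sep x₀ z₀ B₀ e (k + 1)).t = (run P f solver sep x₀ z₀ B₀ e k).t + 1 := by
  rw [run, State.next, if_neg h]

/-- Iteration `k` performs the update of round `t`. -/
def Updates (P : Params) (f : Vec d → ℝ) (solver : Mat d → Vec d → ℝ → Vec d) (t : ℕ)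
    (s : State d) : Prop :=
  s.numBacktracks P f solver ≠ 0 ∧ s.t = t

theorem updates_unique {e : ℕ → E} {t k l : ℕ} (hkl : k < l)
    (hk : Updates P f solver t (run P f solver sep x₀ z₀ B₀ e k))
    (hl : Updates P f solver t (run P f solver sep x₀ z₀ B₀ e l)) : False := by
  have h1 := run_t_succ hk.1
  have h2 := run_t_mono (P := P) (f := f) (solver := solver) (sep := sep) (x₀ := x₀) (z₀ := z₀)
    (B₀ := B₀) e (Nat.succ_le_of_lt hkl)
  simp only [Nat.succ_eq_add_one] at h2
  rw [h1, hk.2, hl.2] at h2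
  omega

variable [MeasurableSpace E]

theorem run_isMeasurable (hf : IsSmoothConvex f P.L₁) (hsol : IsLinearSolver solver)
    (hsep : ∀ δ q, Measurable fun i : Mat d × E => sep i.1 δ q i.2) (k : ℕ) :
    State.IsMeasurable fun e : ℕ → E => run P f solver sep x₀ z₀ B₀ e k := by
  induction k with
  | zero => constructor <;> exact measurable_const
  | succ k ih => exact ih.next hsep hf hsol (measurable_pi_apply k)

theorem measurableSet_updates {Ω : Type*} [MeasurableSpace Ω] {ξ : ℕ → Ω → E}
    (hf : IsSmoothConvex f P.L₁) (hsol : IsLinearSolver solver)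
    (hsep : ∀ δ q, Measurable fun i : Mat d × E => sep i.1 δ q i.2)
    (hξ : ∀ k, Measurable (ξ k)) (k t : ℕ) :
    MeasurableSet
      {ω | Updates P f solver t (run P f solver sep x₀ z₀ B₀ (fun j => ξ j ω) k)} := by
  have hF : State.IsMeasurable fun ω => run P f solver sep x₀ z₀ B₀ (fun j => ξ j ω) k :=
    (run_isMeasurable hf hsol hsep k).comp (measurable_pi_lambda _ fun j => hξ j)
  exact MeasurableSet.inter ((hF.numBacktracks hf hsol) (measurableSet_singleton 0)).compl
    (hF.t (measurableSet_singleton t))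

theorem IsSepOracle.failure_le {ν : Measure E} [IsProbabilityMeasure ν] (h : IsSepOracle ν sep)
    {W : Mat d} {δ q : ℝ} (hW : W.IsSymm) (hδ : 0 < δ) (hq : 0 < q) (hq1 : q < 1) :
    ν {e | ¬ SepCorrect W δ (sep W δ q e)} ≤ ENNReal.ofReal q := by
  have h1 := h.correct W δ q hW hδ hq hq1
  have hm : MeasurableSet {e | SepCorrect W δ (sep W δ q e)} :=
    (measurableSet_sepCorrect δ).preimage (measurable_const.prodMk
      ((h.measurable δ q).comp (measurable_const.prodMk measurable_id)))
  change ν {e | SepCorrect W δ (sep W δ q e)}ᶜ ≤ _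
  rw [prob_compl_eq_one_sub hm]
  exact tsub_le_iff_tsub_le.1 h1

variable {ν : Measure E} [IsProbabilityMeasure ν] {Ω : Type*} [MeasurableSpace Ω] {μ : Measure Ω}
  [IsProbabilityMeasure μ] {ξ : ℕ → Ω → E}

/-- The failure probability of one query, jointly with the event that it is made. -/
theorem measure_failure_le (hP : P.Valid) (hf : IsSmoothConvex f P.L₁)
    (hsol : IsLinearSolver solver) (hB : B₀.IsSymm) (hsep : IsSepOracle ν sep)
    (hξ : ∀ k, Measurable (ξ k)) (hν : ∀ k, μ.map (ξ k) = ν) (hind : iIndepFun ξ μ) (k t : ℕ) :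
    μ {ω | Updates P f solver t (run P f solver sep x₀ z₀ B₀ (fun j => ξ j ω) k) ∧
        ¬ CorrectAt P f solver sep (run P f solver sep x₀ z₀ B₀ (fun j => ξ j ω) k) (ξ k ω)}
      ≤ ENNReal.ofReal (failProb P.p (t + 1)) *
        μ {ω | Updates P f solver t (run P f solver sep x₀ z₀ B₀ (fun j => ξ j ω) k)} := by
  obtain ⟨e₀⟩ : Nonempty E := nonempty_of_isProbabilityMeasure ν
  -- The state at iteration k depends on the first k draws only, so padding them with an arbitrary
  -- e₀ expresses it as a function of the finite past.
  let ext : (Finset.range k → E) → ℕ → E := fun u j => if hj : j ∈ Finset.range k then u ⟨j, hj⟩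
    else e₀
  have hext : Measurable ext := by
    refine measurable_pi_lambda _ fun j => ?_
    by_cases hj : j ∈ Finset.range k
    · simpa only [ext, hj, dite_true] using measurable_pi_apply _
    · simpa only [ext, hj, dite_false] using measurable_const
  let F : (Finset.range k → E) → State d := fun u => run P f solver sep x₀ z₀ B₀ (ext u) k
  have hF : State.IsMeasurable F := (run_isMeasurable hf hsol hsep.measurable k).comp hext
  let U : Ω → Finset.range k → E := fun ω i => ξ i ω
  have hU : Measurable U := measurable_pi_lambda _ fun i => hξ i
  have hrun : ∀ ω, run P f solver sep x₀ z₀ B₀ (fun j => ξ j ω) k = F (U ω) := by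
    intro ω
    refine run_congr fun j hj => ?_
    simp [ext, U, hj]
  have hindep : IndepFun U (ξ k) μ := by
    have h1 := hind.indepFun_finset (Finset.range k) {k} (by simp) hξ
    exact h1.comp (φ := id) (ψ := fun v : ({k} : Finset ℕ) → E => v ⟨k, by simp⟩)
      measurable_id (measurable_pi_apply _)
  have hmap : μ.map (fun ω => (U ω, ξ k ω)) = (μ.map U).prod ν := by
    rw [(indepFun_iff_map_prod_eq_prod_map_map hU.aemeasurable (hξ k).aemeasurable).1 hindep, hν]
  have hV : MeasurableSet {u | Updates P f solver t (F u)} := by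
    refine MeasurableSet.inter ?_ ?_
    · exact ((hF.numBacktracks hf hsol) (measurableSet_singleton 0)).compl
    · exact hF.t (measurableSet_singleton t)
  set q := failProb P.p (t + 1)
  set δ := delta (t + 1)
  have hN : MeasurableSet {p : (Finset.range k → E) × E | ¬ SepCorrect ((F p.1).nextW P f solver) δ
      (sep ((F p.1).nextW P f solver) δ q p.2)} := by
    have hW : Measurable fun p : (Finset.range k → E) × E => (F p.1).nextW P f solver :=
      (hF.nextW hf hsol).comp measurable_fst
    exact ((measurableSet_sepCorrect δ).preimage (hW.prodMk
      ((hsep.measurable δ q).comp (hW.prodMk measurable_snd)))).compl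
  have hV' : MeasurableSet {p : (Finset.range k → E) × E | Updates P f solver t (F p.1)} :=
    hV.preimage measurable_fst
  set B := {p : (Finset.range k → E) × E | Updates P f solver t (F p.1)} ∩
    {p | ¬ SepCorrect ((F p.1).nextW P f solver) δ (sep ((F p.1).nextW P f solver) δ q p.2)}
    with hBdef
  have hBm : MeasurableSet B := hV'.inter hN
  have hbad : {ω | Updates P f solver t (run P f solver sep x₀ z₀ B₀ (fun j => ξ j ω) k) ∧
      ¬ CorrectAt P f solver sep (run P f solver sep x₀ z₀ B₀ (fun j => ξ j ω) k) (ξ k ω)}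
      ⊆ (fun ω => (U ω, ξ k ω)) ⁻¹' B := by
    rintro ω ⟨h1, h2⟩
    rw [hrun] at h1 h2
    refine ⟨h1, ?_⟩
    simp only [CorrectAt, Classical.not_imp] at h2
    have h3 := h2.2
    -- Restricting to round t freezes the random accuracy and failure probability at fixed values,
    -- as `IsSepOracle.failure_le` requires.
    rwa [h1.2] at h3
  have hVeq : {ω | Updates P f solver t (run P f solver sep x₀ z₀ B₀ (fun j => ξ j ω) k)}
      = U ⁻¹' {u | Updates P f solver t (F u)} := by
    ext ω
    simp only [Set.mem_ofPred_eq, Set.mem_preimage, hrun]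
  -- For a fixed past the query is deterministic, so its fresh randomness fails with probability at
  -- most q; if round t is not played, the section is empty.
  have hsec : ∀ u, ν (Prod.mk u ⁻¹' B)
      ≤ Set.indicator {u | Updates P f solver t (F u)} (fun _ => ENNReal.ofReal q) u := by
    intro u
    by_cases hu : Updates P f solver t (F u)
    · rw [Set.indicator_of_mem (show u ∈ {u | Updates P f solver t (F u)} from hu)]
      -- Every past has to be covered, including those with earlier wrong answers, so symmetry of
      -- the query cannot come from the invariants of a valid run.
      have hs := run_isSymm (f := f) (solver := solver) (x₀ := x₀) (z₀ := z₀) (e := ext u) hP hB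
        hsep.symm k
      refine le_trans (measure_mono ?_) (hsep.failure_le
        (State.nextW_isSymm (P := P) (f := f) (solver := solver) hs.1 hs.2) (delta_pos (t + 1))
        (failProb_pos hP.p_pos t) (failProb_lt_one hP.p_pos hP.p_lt t))
      exact fun e he => he.2
    · have : Prod.mk u ⁻¹' B = ∅ := Set.eq_empty_iff_forall_notMem.2 fun e he => hu he.1
      rw [this, measure_empty]
      exact zero_le
  calc _ ≤ μ ((fun ω => (U ω, ξ k ω)) ⁻¹' B) := measure_mono hbad
    _ = ((μ.map U).prod ν) B := by rw [← hmap, Measure.map_apply (hU.prodMk (hξ k)) hBm]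
    _ = ∫⁻ u, ν (Prod.mk u ⁻¹' B) ∂(μ.map U) := Measure.prod_apply hBm
    _ ≤ ∫⁻ u, Set.indicator {u | Updates P f solver t (F u)} (fun _ => ENNReal.ofReal q) u
        ∂(μ.map U) := lintegral_mono hsec
    _ = ENNReal.ofReal q * (μ.map U) {u | Updates P f solver t (F u)} :=
        lintegral_indicator_const hV _
    _ = _ := by rw [Measure.map_apply hU hV, hVeq]

/-- With probability at least `1 - p` every answer of the separation oracle is correct. -/
theorem measure_exists_failure_le (hP : P.Valid) (hf : IsSmoothConvex f P.L₁)
    (hsol : IsLinearSolver solver) (hB : B₀.IsSymm) (hsep : IsSepOracle ν sep)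
    (hξ : ∀ k, Measurable (ξ k)) (hν : ∀ k, μ.map (ξ k) = ν) (hind : iIndepFun ξ μ) :
    μ {ω | ∀ k, CorrectAt P f solver sep
        (run P f solver sep x₀ z₀ B₀ (fun j => ξ j ω) k) (ξ k ω)}ᶜ ≤ ENNReal.ofReal P.p := by
  have hsub : {ω | ∀ k, CorrectAt P f solver sep
        (run P f solver sep x₀ z₀ B₀ (fun j => ξ j ω) k) (ξ k ω)}ᶜ
      ⊆ ⋃ t, ⋃ k, {ω | Updates P f solver t (run P f solver sep x₀ z₀ B₀ (fun j => ξ j ω) k) ∧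
        ¬ CorrectAt P f solver sep (run P f solver sep x₀ z₀ B₀ (fun j => ξ j ω) k) (ξ k ω)} := by
    intro ω hω
    simp only [Set.mem_compl_iff, Set.mem_ofPred_eq, not_forall] at hω
    obtain ⟨k, hk⟩ := hω
    simp only [Set.mem_iUnion]
    exact ⟨_, k, ⟨(Classical.not_imp.1 hk).1, rfl⟩, hk⟩
  refine (measure_mono hsub).trans ((measure_iUnion_le _).trans ?_)
  -- A round is updated in at most one iteration, so the probabilities that iteration k plays it sum
  -- to at most 1. The infinitely many iterations thus cost only one q per round.
  have hround : ∀ t, μ (⋃ k, {ω | Updates P f solver t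
        (run P f solver sep x₀ z₀ B₀ (fun j => ξ j ω) k) ∧
        ¬ CorrectAt P f solver sep (run P f solver sep x₀ z₀ B₀ (fun j => ξ j ω) k) (ξ k ω)})
      ≤ ENNReal.ofReal (failProb P.p (t + 1)) := by
    intro t
    refine (measure_iUnion_le _).trans ((ENNReal.tsum_le_tsum fun k =>
      measure_failure_le hP hf hsol hB hsep hξ hν hind k t).trans ?_)
    rw [ENNReal.tsum_mul_left, ← measure_iUnion ?_
      (fun k => measurableSet_updates hf hsol hsep.measurable hξ k t)]
    · exact mul_le_of_le_one_right zero_le prob_le_one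
    · intro k l hkl
      refine Set.disjoint_left.2 fun ω hk hl => ?_
      rcases lt_or_gt_of_ne hkl with h | h
      · exact updates_unique h hk hl
      · exact updates_unique h hl hk
  refine (ENNReal.tsum_le_tsum hround).trans (ENNReal.tsum_le_of_sum_range_le fun n => ?_)
  rw [← ENNReal.ofReal_sum_of_nonneg fun t _ => (failProb_pos hP.p_pos t).le]
  exact ENNReal.ofReal_le_ofReal (sum_failProb_le hP.p_pos.le n)

end Failure

/-! ### Assembly of the theorem. -/

open MeasureTheory ProbabilityTheory

/-- The constant `K` of the combined rate, for the constants of the two individual rates. -/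
noncomputable def rateK (α₁ α₂ β L₁ L₂ σ₀ R : ℝ) : ℝ :=
  combinedConst (max (L₁ / (α₂ * β)) (1 / σ₀)) (rateC₄ α₂ β) (rateC₅ β) (rateC₆ β) (rateC₇ α₂ β)
    (rateC₈ α₂ β) (rateC₉ α₁ α₂ β) (rateC₁₀ α₁ α₂ β) L₁ L₂ σ₀ R

/-- All three rates hold with probability at least `1 - p`. -/
theorem one_sub_le_measure_rates {P : Params} (hP : P.Valid) {L₂ : ℝ} (hL₂ : 0 ≤ L₂) {d : ℕ}
    {f : Vec d → ℝ} (hf : IsSmoothConvex f P.L₁) (hf2 : HasLipschitzHessian f L₂) {xs : Vec d}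
    (hmin : ∀ x, f xs ≤ f x) (x₀ z₀ : Vec d) {B₀ : Mat d} (hB : B₀.PosSemidef)
    (hB' : (P.L₁ • (1 : Mat d) - B₀).PosSemidef) {solver : Mat d → Vec d → ℝ → Vec d}
    (hsol : IsLinearSolver solver) {E : Type*} [MeasurableSpace E] {ν : Measure E}
    [IsProbabilityMeasure ν] {sep : Mat d → ℝ → ℝ → E → ℝ × Mat d} (hsep : IsSepOracle ν sep)
    {Ω : Type*} [MeasurableSpace Ω] {μ : Measure Ω} [IsProbabilityMeasure μ] {ξ : ℕ → Ω → E}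
    (hξ : ∀ k, Measurable (ξ k)) (hν : ∀ k, μ.map (ξ k) = ν) (hind : iIndepFun ξ μ)
    {x : ℕ → Ω → Vec d}
    (hx : ∀ k ω, x k ω = (run P f solver sep x₀ z₀ B₀ (fun j => ξ j ω) k).x) {M : ℝ}
    (hM : M = rateC₆ P.β / P.σ₀ ^ 2 + rateC₇ P.α₂ P.β * P.L₁ ^ 2
      + rateC₈ P.α₂ P.β * frobNorm (B₀ - hessMat f z₀) ^ 2
      + rateC₉ P.α₁ P.α₂ P.β * L₂ ^ 2 * ‖z₀ - xs‖ ^ 2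
      + rateC₁₀ P.α₁ P.α₂ P.β * P.L₁ * L₂ * d * ‖z₀ - xs‖) :
    1 - ENNReal.ofReal P.p ≤ μ {ω |
      (∀ k : ℕ, 1 ≤ k →
        f (x k ω) - f xs ≤
          rateC₄ P.α₂ P.β * P.L₁ * ‖z₀ - xs‖ ^ 2 / (k : ℝ) ^ 2
            + rateC₅ P.β * ‖z₀ - xs‖ ^ 2 / (P.σ₀ * (k : ℝ) ^ (5 / 2 : ℝ))) ∧
      (∀ k : ℕ, 1 ≤ k →
        f (x k ω) - f xs ≤
          ‖z₀ - xs‖ ^ 2 / (k : ℝ) ^ (5 / 2 : ℝ) *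
            √(M + rateC₁₀ P.α₁ P.α₂ P.β * P.L₁ * L₂ * d * ‖z₀ - xs‖ *
              max (Real.log (max (P.L₁ / (P.α₂ * P.β)) (1 / P.σ₀) *
                (k : ℝ) ^ (5 / 2 : ℝ) / √M)) 0)) ∧
      (∀ R : ℝ, ‖z₀ - xs‖ ≤ R → ∀ k : ℕ, 2 ≤ k →
        f (x k ω) - f xs ≤
          rateK P.α₁ P.α₂ P.β P.L₁ L₂ P.σ₀ R *
            min (1 / (k : ℝ) ^ 2) (√(d * Real.log k) / (k : ℝ) ^ (5 / 2 : ℝ)))} := by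
  have hσ₀ := hP.σ₀_pos
  have hfail := measure_exists_failure_le (x₀ := x₀) (z₀ := z₀) hP hf hsol
    (posSemidef_iff_inner.1 hB).1 hsep hξ hν hind
  refine tsub_le_iff_right.2 ?_
  -- Subadditivity over the good event and its complement suffices, so measurability of the good
  -- event is not needed.
  have hone : (1 : ENNReal) ≤ μ {ω | ∀ k, CorrectAt P f solver sep
      (run P f solver sep x₀ z₀ B₀ (fun j => ξ j ω) k) (ξ k ω)} + ENNReal.ofReal P.p := by
    refine le_trans ?_ (add_le_add le_rfl hfail)
    rw [← measure_univ (μ := μ)]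
    refine le_trans (le_of_eq ?_) (measure_union_le _ _)
    rw [Set.union_compl_self]
  refine hone.trans (add_le_add (measure_mono ?_) le_rfl)
  intro ω hω
  have hrun := validRun_of_correct hP hf hsol hB hB' hsep.symm hω
  have ha := fun (k : ℕ) (hk : 1 ≤ k) => hrun.first_order_rate (u := xs) hk
  have hb := fun (k : ℕ) (hk : 1 ≤ k) => hrun.quasi_newton_rate hL₂ hf2 rfl hmin hM hk
  simp only [← hx] at ha hb
  refine ⟨ha, hb, fun R hR k hk => ?_⟩
  -- In dimension 0 the right side vanishes, but so does the gap, as the space is a single point.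
  rcases Nat.eq_zero_or_pos d with rfl | hd
  · rw [Subsingleton.elim (x k ω) xs]
    simp
  · exact combined_rate (rateC₄_pos hP) (rateC₅_pos hP) (rateC₆_pos hP) (rateC₇_pos hP)
      (rateC₈_pos hP) (rateC₉_pos hP) (rateC₁₀_pos hP) hP.L₁_pos hL₂ hσ₀ (norm_nonneg _) hR
      (lt_max_of_lt_right (by positivity)) hd hk
      (frobNorm_sub_hessMat_sq_le hP.L₁_pos hf hB hB' z₀) (sq_nonneg _) hM
      (ha k (one_le_two.trans hk)) (hb k (one_le_two.trans hk))

end AQNPE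

theorem theorem1 (α₁ α₂ β : ℝ) (hα₁ : 0 < α₁) (hα₂ : 0 < α₂) (hα : α₁ + α₂ < 1)
    (hβ₀ : 0 < β) (hβ₁ : β < 1) :
    ∃ C₄ C₅ C₆ C₇ C₈ C₉ C₁₀ : ℝ,
      0 < C₄ ∧ 0 < C₅ ∧ 0 < C₆ ∧ 0 < C₇ ∧ 0 < C₈ ∧ 0 < C₉ ∧ 0 < C₁₀ ∧
    ∃ K : ℝ → ℝ → ℝ → ℝ → ℝ,
    ∀ L₁ L₂ σ₀ p : ℝ, 0 < L₁ → 0 ≤ L₂ → 0 < σ₀ → 0 < p → p < 1 →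
    ∀ (d : ℕ) (f : AQNPE.Vec d → ℝ),
      AQNPE.IsSmoothConvex f L₁ → AQNPE.HasLipschitzHessian f L₂ →
    ∀ xs : AQNPE.Vec d, (∀ x, f xs ≤ f x) →
    ∀ (x₀ z₀ : AQNPE.Vec d) (B₀ : AQNPE.Mat d),
      B₀.PosSemidef → (L₁ • (1 : AQNPE.Mat d) - B₀).PosSemidef →
    ∀ solver : AQNPE.Mat d → AQNPE.Vec d → ℝ → AQNPE.Vec d, AQNPE.IsLinearSolver solver →
    ∀ (E : Type*) [MeasurableSpace E] (ν : MeasureTheory.Measure E)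
      [MeasureTheory.IsProbabilityMeasure ν]
      (sep : AQNPE.Mat d → ℝ → ℝ → E → ℝ × AQNPE.Mat d), AQNPE.IsSepOracle ν sep →
    ∀ (Ω : Type*) [MeasurableSpace Ω] (μ : MeasureTheory.Measure Ω)
      [MeasureTheory.IsProbabilityMeasure μ] (ξ : ℕ → Ω → E),
      (∀ k, Measurable (ξ k)) → (∀ k, μ.map (ξ k) = ν) → ProbabilityTheory.iIndepFun ξ μ →
    ∀ x : ℕ → Ω → AQNPE.Vec d,
      (∀ k ω, x k ω =
        (AQNPE.run { α₁ := α₁, α₂ := α₂, β := β, σ₀ := σ₀, L₁ := L₁, p := p }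
          f solver sep x₀ z₀ B₀ (fun j => ξ j ω) k).x) →
    ∀ M : ℝ,
      M = C₆ / σ₀ ^ 2 + C₇ * L₁ ^ 2 + C₈ * AQNPE.frobNorm (B₀ - AQNPE.hessMat f z₀) ^ 2
        + C₉ * L₂ ^ 2 * ‖z₀ - xs‖ ^ 2 + C₁₀ * L₁ * L₂ * d * ‖z₀ - xs‖ →
    1 - ENNReal.ofReal p ≤ μ {ω |
      (∀ k : ℕ, 1 ≤ k →
        f (x k ω) - f xs ≤
          C₄ * L₁ * ‖z₀ - xs‖ ^ 2 / (k : ℝ) ^ 2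
            + C₅ * ‖z₀ - xs‖ ^ 2 / (σ₀ * (k : ℝ) ^ (5 / 2 : ℝ))) ∧
      (∀ k : ℕ, 1 ≤ k →
        f (x k ω) - f xs ≤
          ‖z₀ - xs‖ ^ 2 / (k : ℝ) ^ (5 / 2 : ℝ) *
            √(M + C₁₀ * L₁ * L₂ * d * ‖z₀ - xs‖ *
              max (Real.log (max (L₁ / (α₂ * β)) (1 / σ₀) * (k : ℝ) ^ (5 / 2 : ℝ) / √M)) 0)) ∧
      (∀ R : ℝ, ‖z₀ - xs‖ ≤ R → ∀ k : ℕ, 2 ≤ k →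
        f (x k ω) - f xs ≤
          K L₁ L₂ σ₀ R *
            min (1 / (k : ℝ) ^ 2) (√(d * Real.log k) / (k : ℝ) ^ (5 / 2 : ℝ)))} := by
  have hvalid : ∀ L₁ σ₀ p : ℝ, 0 < L₁ → 0 < σ₀ → 0 < p → p < 1 →
      AQNPE.Params.Valid { α₁ := α₁, α₂ := α₂, β := β, σ₀ := σ₀, L₁ := L₁, p := p } :=
    fun L₁ σ₀ p h1 h2 h3 h4 => ⟨hα₁, hα₂, hα, hβ₀, hβ₁, h2, h1, h3, h4⟩
  -- The constants see only α₁, α₂ and β, so their positivity can be read off from any admissible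
  -- choice of the other parameters.
  have hP := hvalid 1 1 (1 / 2) one_pos one_pos (by norm_num) (by norm_num)
  have c4 := AQNPE.rateC₄_pos hP
  have c5 := AQNPE.rateC₅_pos hP
  have c6 := AQNPE.rateC₆_pos hP
  have c7 := AQNPE.rateC₇_pos hP
  have c8 := AQNPE.rateC₈_pos hP
  have c9 := AQNPE.rateC₉_pos hP
  have c10 := AQNPE.rateC₁₀_pos hP
  refine ⟨AQNPE.rateC₄ α₂ β, AQNPE.rateC₅ β, AQNPE.rateC₆ β, AQNPE.rateC₇ α₂ β,
    AQNPE.rateC₈ α₂ β, AQNPE.rateC₉ α₁ α₂ β, AQNPE.rateC₁₀ α₁ α₂ β, c4, c5, c6, c7, c8, c9, c10,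
    AQNPE.rateK α₁ α₂ β, ?_⟩
  intro L₁ L₂ σ₀ p hL₁ hL₂ hσ₀ hp hp1 d f hf hf2 xs hmin x₀ z₀ B₀ hB hB' solver hsol E _ ν _ sep
    hsep Ω _ μ _ ξ hξ hν hind x hx M hM
  have hrates := AQNPE.one_sub_le_measure_rates (hvalid L₁ σ₀ p hL₁ hσ₀ hp hp1) hL₂ hf hf2 hmin
    x₀ z₀ hB hB' hsol hsep hξ hν hind hx hM
  exact hrates
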